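/- Let $n\ge 1$, let $W_f=S_n$ act on $X=\mathbb Z^n$ by permuting the standard basis $e_1,\dots,e_n$, and let $W=W_f\ltimes X$, with $t_\tau\in W$ the translation by $\tau\in X$. Let $\Delta^+$ be the set of affine functions $\tau\mapsto \tau_i-\tau_j+k$ on $X$ with $i\ne j$, $k\in\mathbb Z$ and either $k>0$, or $k=0$ and $i<j$; let $W$ act on functions by $(w\alpha)(\tau)=\alpha(w^{-1}\tau)$, and put $\ell(w)=\#\{\alpha\in\Delta^+\mid w\alpha\in-\Delta^+\}$. Let $s_i=(i\;i{+}1)$ for $1\le i\le n-1$, $s_0(\tau)=(\tau_n+1,\tau_2,\dots,\tau_{n-1},\tau_1-1)$ (there are no $s_i$ if $n=1$), and $\omega=t_{-e_n}s_{n-1}\cdots s_1$, so $\omega(\tau)=(\tau_2,\dots,\tau_n,\tau_1-1)$. Let $\mathcal L=\mathbb Z[v,v^{-1}]$. The extended affine Hecke algebra $\mathcal H$ is the $\mathcal L$-algebra generated by $H_0,\dots,H_{n-1}$ (no $H_i$ if $n=1$) and $\omega^{\pm1}$ with relations $H_iH_j=H_jH_i$ for $1<|i-j|<n-1$; $H_iH_{i+1}H_i=H_{i+1}H_iH_{i+1}$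 for all $i$ modulo $n$ if $n\ge3$; $\omega H_i\omega^{-1}=H_{i-1}$ for all $i$ modulo $n$; and $(H_i+v)(H_i-v^{-1})=0$. For $w\in W$ put $H_w=H_{i_1}\cdots H_{i_r}\omega^k$ where $w=s_{i_1}\cdots s_{i_r}\omega^k$ is a reduced expression, i.e. $r=\ell(w)$. Let $\mathcal H_f$ be the subalgebra generated by $H_1,\dots,H_{n-1}$, and $\mathcal H^{\rm pol}$ the subalgebra generated by $\mathcal H_f$ and $\omega$. For $1\le i\le n$ put $X_i=H_{t_{\tau'}}H_{t_{\tau''}}^{-1}$ with $\tau'=e_1+\dots+e_i$, $\tau''=e_1+\dots+e_{i-1}$, and $Z_i=X_i^{-1}$. Let $W^{\rm pol}=W_f\ltimes(-\mathbb N^n)\subseteq W$. **Theorem 7.1.** Every $w\in W$ has a reduced expression, $H_w$ does not depend on its choice, and $\mathcal H_f$ is the $\mathcal L$-span of $\{H_w\mid w\in W_f\}$. The family $(H_w)_{w\in W^{\rm pol}}$ is an $\mathcal L$-basis of $\mathcal H^{\rm pol}$. Moreover $Z_i\in\mathcal H^{\rm pol}$ for all $i$, the $Z_i$ commute with each other,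 and with $\mathcal L[Z_1,\dots,Z_n]$ denoting the polynomial ring, the map $$\mathcal L[Z_1,\dots,Z_n]\otimes_{\mathcal L}\mathcal H_f\to\mathcal H^{\rm pol},\qquad p(Z)\otimes u\mapsto p(Z)u$$ is bijective. Furthermore $\mathcal H^{\rm pol}$ has each of the following presentations (the canonical map from the $\mathcal L$-algebra so presented to $\mathcal H^{\rm pol}$ is an isomorphism): 1. generated by the algebras $\mathcal H_f$ and $\mathcal L[Z_1,\dots,Z_n]$ with the relations $$H_ip-(s_ip)H_i=(v-v^{-1})\,Z_{i+1}\,\frac{p-s_ip}{Z_i-Z_{i+1}}\quad\text{for } 1\le i\le n-1,\ p\in\mathcal L[Z_1,\dots,Z_n],$$ where $s_i$ interchanges $Z_i$ and $Z_{i+1}$; 2. generated by the algebra $\mathcal H_f$ and $Z_1,\dots,Z_n$ with the relations $H_iZ_iH_i=Z_{i+1}$ for $1\le i\le n-1$; $H_jZ_i=Z_iH_j$ for $1\le i\le n$, $1\le j\le n-1$, $i-j\ne0,1$; and $Z_iZ_j=Z_jZ_i$ for $1\le i,j\le n$; 3. generated by the algebra $\mathcal H_f$ and $Z_1$ with the relations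 $H_1Z_1H_1Z_1=Z_1H_1Z_1H_1$ (if $n\ge2$) and $H_iZ_1=Z_1H_i$ for $2\le i\le n-1$; 4. generated by the algebra $\mathcal H_f$ and $\omega$ with the relations $H_i\omega=\omega H_{i+1}$ for $1\le i\le n-2$ and $H_{n-1}\omega^2=\omega^2H_1$ (if $n\ge2$). -/

import Mathlib

noncomputable section

namespace AffineHecke

/-! ### The extended affine Weyl group of `GL_n`

Indices run over `Fin n` and start at `0`: the coordinate `τ_i` (`1 ≤ i ≤ n`) is `τ (i - 1)`. -/

/-- The lattice `X = ℤ^n`. -/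
abbrev Lattice (n : ℕ) : Type := Fin n → ℤ

/-- The action of `S_n` on `ℤ^n`, `(π τ)_i = τ_{π⁻¹ i}` (with `ℤ^n` written multiplicatively). -/
def permAct (n : ℕ) : Equiv.Perm (Fin n) →* MulAut (Multiplicative (Lattice n)) where
  toFun π :=
    { toFun := fun τ => Multiplicative.ofAdd fun i => τ.toAdd (π⁻¹ i)
      invFun := fun τ => Multiplicative.ofAdd fun i => τ.toAdd (π i)
      left_inv := fun τ => by ext i; simp
      right_inv := fun τ => by ext i; simp
      map_mul' := fun _ _ => rfl }
  map_one' := rfl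
  map_mul' _ _ := rfl

/-- The extended affine Weyl group `W = S_n ⋉ ℤ^n`. The element `t_τ π` is `⟨τ, π⟩`. -/
abbrev Weyl (n : ℕ) : Type := Multiplicative (Lattice n) ⋊[permAct n] Equiv.Perm (Fin n)

/-- The translation `t_τ`. -/
def transl {n : ℕ} (τ : Lattice n) : Weyl n := SemidirectProduct.inl (Multiplicative.ofAdd τ)

/-- The embedding of `W_f = S_n` into `W`. -/
def ofPerm {n : ℕ} (π : Equiv.Perm (Fin n)) : Weyl n := SemidirectProduct.inr π

/-- The affine action of `W` on the lattice: `(t_σ π) τ = σ + π τ`. -/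
def act {n : ℕ} (w : Weyl n) (τ : Lattice n) : Lattice n :=
  fun i => w.left.toAdd i + τ (w.right⁻¹ i)

/-- The affine linear function `ε_i - ε_j + k` on the lattice. -/
def affRoot {n : ℕ} (i j : Fin n) (k : ℤ) : Lattice n → ℤ := fun τ => τ i - τ j + k

/-- The positive affine roots: `ε_i - ε_j + k` with `i ≠ j`, and `k > 0`, or `k = 0` and `i < j`. -/
def posRoots (n : ℕ) : Set (Lattice n → ℤ) :=
  {α | ∃ (i j : Fin n) (k : ℤ), i ≠ j ∧ (0 < k ∨ (k = 0 ∧ i < j)) ∧ α = affRoot i j k}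

/-- The length of `w`: the number of positive affine roots `α` with `w α` negative, where
`(w α)(τ) = α (w⁻¹ τ)`. -/
def len {n : ℕ} (w : Weyl n) : ℕ :=
  Set.ncard {α | α ∈ posRoots n ∧ (-fun τ => α (act w⁻¹ τ)) ∈ posRoots n}

/-- The index set `{0, …, n-1}` of the simple affine reflections; it is empty for `n = 1`,
where there are no roots. -/
abbrev SimpleIdx (n : ℕ) : Type := {_i : Fin n // 2 ≤ n}

section
variable (n : ℕ) [NeZero n]

/-- The simple reflections. For `1 ≤ i ≤ n-1`, `s_i` interchanges the coordinates `τ_i`, `τ_{i+1}`,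
while `s_0 τ = (τ_n + 1, τ_2, …, τ_{n-1}, τ_1 - 1)`. (In `Fin n` the index arithmetic is cyclic, so
`-1` is the last index.) -/
def simpleRefl (i : SimpleIdx n) : Weyl n :=
  if i.1 = 0 then transl (Pi.single 0 1 - Pi.single (-1) 1) * ofPerm (Equiv.swap (-1) 0)
  else ofPerm (Equiv.swap (i.1 - 1) i.1)

/-- The element `ω = t_{-e_n} s_{n-1} ⋯ s_1` of length zero,
`ω τ = (τ_2, …, τ_n, τ_1 - 1)`. -/
def omegaW : Weyl n := transl (-Pi.single (-1) 1) * ofPerm (finRotate n)⁻¹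

/-- `w = s_{i_1} ⋯ s_{i_r} ω^k` is a reduced expression, i.e. `r = ℓ(w)`. -/
def IsReducedExpr (w : Weyl n) (l : List (SimpleIdx n)) (k : ℤ) : Prop :=
  w = (l.map (simpleRefl n)).prod * omegaW n ^ k ∧ l.length = len w

/-- The submonoid `W_f ⋉ (-ℕ^n)` of `W`. -/
def Wpol : Submonoid (Weyl n) where
  carrier := {w | ∀ i, w.left.toAdd i ≤ 0}
  one_mem' := fun _ => le_refl 0
  mul_mem' := fun {a _} ha hb i => add_nonpos (ha i) (hb (a.right⁻¹ i))

end

/-! ### The extended affine Hecke algebra -/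

/-- The ring `ℤ[v, v⁻¹]`. -/
abbrev LL : Type := LaurentPolynomial ℤ

/-- The variable `v`. -/
def v : LL := LaurentPolynomial.T 1

/-- The inverse of `v`. -/
def vinv : LL := LaurentPolynomial.T (-1)

theorem v_mul_vinv : v * vinv = 1 := by
  rw [v, vinv, ← LaurentPolynomial.T_add, add_neg_cancel, LaurentPolynomial.T_zero]

/-- Generators of the extended affine Hecke algebra. -/
inductive HGen (n : ℕ) : Type
  | H (i : SimpleIdx n)
  | om
  | omInv

/-- The free algebra on the generators. -/
abbrev HFree (n : ℕ) : Type := FreeAlgebra LL (HGen n)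

/-- The generator `H_i` in the free algebra. -/
def fH {n : ℕ} (i : SimpleIdx n) : HFree n := FreeAlgebra.ι LL (HGen.H i)

/-- The generator `ω` in the free algebra. -/
def fOm (n : ℕ) : HFree n := FreeAlgebra.ι LL HGen.om

/-- The generator `ω⁻¹` in the free algebra. -/
def fOmInv (n : ℕ) : HFree n := FreeAlgebra.ι LL HGen.omInv

/-- The defining relations of the extended affine Hecke algebra. Index arithmetic in `Fin n` is
cyclic. As usual there is no braid relation between `H_0` and `H_1` when `n = 2`. -/
inductive HRel (n : ℕ) [NeZero n] : HFree n → HFree n → Prop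
  | om_omInv : HRel n (fOm n * fOmInv n) 1
  | omInv_om : HRel n (fOmInv n * fOm n) 1
  | comm (i j : SimpleIdx n) (h1 : (i.1 : ℕ) + 1 < (j.1 : ℕ))
      (h2 : (j.1 : ℕ) - (i.1 : ℕ) < n - 1) : HRel n (fH i * fH j) (fH j * fH i)
  | braid (hn : 3 ≤ n) (i j : SimpleIdx n) (hj : j.1 = i.1 + 1) :
      HRel n (fH i * fH j * fH i) (fH j * fH i * fH j)
  | conj (i j : SimpleIdx n) (hj : j.1 = i.1 - 1) : HRel n (fOm n * fH i * fOmInv n) (fH j)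
  | quad (i : SimpleIdx n) :
      HRel n ((fH i + algebraMap LL (HFree n) v) * (fH i - algebraMap LL (HFree n) vinv)) 0

section
variable (n : ℕ) [NeZero n]

/-- The extended affine Hecke algebra of `GL_n` over `ℤ[v, v⁻¹]`. -/
def Hecke : Type := RingQuot (HRel n)

instance : Ring (Hecke n) := inferInstanceAs (Ring (RingQuot (HRel n)))

instance : Algebra LL (Hecke n) := inferInstanceAs (Algebra LL (RingQuot (HRel n)))

/-- The quotient map from the free algebra. -/
def hq : HFree n →ₐ[LL] Hecke n := RingQuot.mkAlgHom LL (HRel n)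

theorem hq_rel {a b : HFree n} (h : HRel n a b) : hq n a = hq n b :=
  RingQuot.mkAlgHom_rel LL h

theorem quad_aux (i : SimpleIdx n) :
    hq n (fH i) * hq n (fH i) + (v - vinv) • hq n (fH i) = 1 := by
  have h := hq_rel n (HRel.quad i)
  rw [map_mul, map_add, map_sub, map_zero, AlgHom.commutes, AlgHom.commutes] at h
  rw [add_mul, mul_sub, mul_sub, ← Algebra.commutes vinv (hq n (fH i)),
    ← map_mul (algebraMap LL (Hecke n)), v_mul_vinv,
    map_one, ← Algebra.smul_def, ← Algebra.smul_def] at h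
  rw [sub_smul, ← sub_eq_zero, ← h]
  abel

/-- The generator `H_i` as a unit, with inverse `H_i + (v - v⁻¹)`. -/
def HU (i : SimpleIdx n) : (Hecke n)ˣ where
  val := hq n (fH i)
  inv := hq n (fH i) + algebraMap LL (Hecke n) (v - vinv)
  val_inv := by
    rw [mul_add, ← Algebra.commutes, ← Algebra.smul_def]
    exact quad_aux n i
  inv_val := by
    rw [add_mul, ← Algebra.smul_def]
    exact quad_aux n i

/-- The generator `ω` as a unit. -/
def omU : (Hecke n)ˣ where
  val := hq n (fOm n)
  inv := hq n (fOmInv n)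
  val_inv := by
    rw [← map_mul, ← map_one (hq n)]
    exact hq_rel n HRel.om_omInv
  inv_val := by
    rw [← map_mul, ← map_one (hq n)]
    exact hq_rel n HRel.omInv_om

/-- The product `H_{i_1} ⋯ H_{i_r} ω^k`. -/
def wordU (l : List (SimpleIdx n)) (k : ℤ) : (Hecke n)ˣ := (l.map (HU n)).prod * omU n ^ k

open Classical in
/-- `H_w = H_{i_1} ⋯ H_{i_r} ω^k` for a reduced expression `w = s_{i_1} ⋯ s_{i_r} ω^k`. -/
def HwU (w : Weyl n) : (Hecke n)ˣ :=
  if h : ∃ p : List (SimpleIdx n) × ℤ, IsReducedExpr n w p.1 p.2 then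
    wordU n h.choose.1 h.choose.2
  else 1

/-- The element `X_i = X^{e_i} = X^{τ'} (X^{τ''})⁻¹`, where `X^τ = H_{t_τ}` for dominant `τ` and
`e_i = τ' - τ''` with the dominant `τ' = e_1 + ⋯ + e_i`, `τ'' = e_1 + ⋯ + e_{i-1}`. -/
def XU (i : Fin n) : (Hecke n)ˣ :=
  HwU n (transl fun j => if j ≤ i then 1 else 0) *
    (HwU n (transl fun j => if j < i then 1 else 0))⁻¹

/-- `Z_i = X_i⁻¹`. -/
def Z (i : Fin n) : Hecke n := ((XU n i)⁻¹ : (Hecke n)ˣ)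

/-- The finite Hecke algebra, the subalgebra generated by `H_1, …, H_{n-1}`. -/
def Hf : Subalgebra LL (Hecke n) :=
  Algebra.adjoin LL {x | ∃ i : SimpleIdx n, i.1 ≠ 0 ∧ x = HU n i}

/-- The polynomial part, the subalgebra generated by `H_f` and `ω`. -/
def Hpol : Subalgebra LL (Hecke n) :=
  Algebra.adjoin LL ((Hf n : Set (Hecke n)) ∪ {(omU n : Hecke n)})

/-- `hf k` is the generator `H_{k+1}` of `H_f`, for `1 ≤ k+1 ≤ n-1`. -/
def hf (k : ℕ) (hk : k + 1 < n) : Hf n :=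
  ⟨HU n ⟨⟨k + 1, hk⟩, by omega⟩, Algebra.subset_adjoin ⟨⟨⟨k + 1, hk⟩, by omega⟩,
    fun h => absurd (congrArg Fin.val h) (by simp), rfl⟩⟩

end

/-! ### Algebras generated by two algebras with relations -/

/-- The relations making the generators `B ⊔ C` into (images of) the algebras `B` and `C`, together
with further relations `rel`. -/
inductive GenRel (B C : Type) [Ring B] [Algebra LL B] [Ring C] [Algebra LL C]
    (rel : FreeAlgebra LL (B ⊕ C) → FreeAlgebra LL (B ⊕ C) → Prop) :
    FreeAlgebra LL (B ⊕ C) → FreeAlgebra LL (B ⊕ C) → Prop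
  | addB (x y : B) : GenRel B C rel (FreeAlgebra.ι LL (Sum.inl (x + y)))
      (FreeAlgebra.ι LL (Sum.inl x) + FreeAlgebra.ι LL (Sum.inl y))
  | mulB (x y : B) : GenRel B C rel (FreeAlgebra.ι LL (Sum.inl (x * y)))
      (FreeAlgebra.ι LL (Sum.inl x) * FreeAlgebra.ι LL (Sum.inl y))
  | scalarB (r : LL) : GenRel B C rel (FreeAlgebra.ι LL (Sum.inl (algebraMap LL B r)))
      (algebraMap LL _ r)
  | addC (x y : C) : GenRel B C rel (FreeAlgebra.ι LL (Sum.inr (x + y)))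
      (FreeAlgebra.ι LL (Sum.inr x) + FreeAlgebra.ι LL (Sum.inr y))
  | mulC (x y : C) : GenRel B C rel (FreeAlgebra.ι LL (Sum.inr (x * y)))
      (FreeAlgebra.ι LL (Sum.inr x) * FreeAlgebra.ι LL (Sum.inr y))
  | scalarC (r : LL) : GenRel B C rel (FreeAlgebra.ι LL (Sum.inr (algebraMap LL C r)))
      (algebraMap LL _ r)
  | of (a b : FreeAlgebra LL (B ⊕ C)) (h : rel a b) : GenRel B C rel a b

/-- The algebra generated by the algebras `B` and `C` subject to the relations `rel`, that is, the
free product of `B` and `C` modulo the two-sided ideal generated by `rel`. -/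
abbrev GenAlg (B C : Type) [Ring B] [Algebra LL B] [Ring C] [Algebra LL C]
    (rel : FreeAlgebra LL (B ⊕ C) → FreeAlgebra LL (B ⊕ C) → Prop) : Type :=
  RingQuot (GenRel B C rel)

section
variable {B C : Type} [Ring B] [Algebra LL B] [Ring C] [Algebra LL C]
  (rel : FreeAlgebra LL (B ⊕ C) → FreeAlgebra LL (B ⊕ C) → Prop)

/-- The image of `b : B` in the algebra generated by `B` and `C` subject to `rel`. -/
def GenAlg.left (b : B) : GenAlg B C rel :=
  RingQuot.mkAlgHom LL (GenRel B C rel) (FreeAlgebra.ι LL (Sum.inl b))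

/-- The image of `c : C` in the algebra generated by `B` and `C` subject to `rel`. -/
def GenAlg.right (c : C) : GenAlg B C rel :=
  RingQuot.mkAlgHom LL (GenRel B C rel) (FreeAlgebra.ι LL (Sum.inr c))

end

/-! ### The four sets of relations -/

section
variable (n : ℕ) [NeZero n]

/-- The polynomial ring `L[Z_1, …, Z_n]`; the variable `Z_{k+1}` is `MvPolynomial.X k`. -/
abbrev PolyZ : Type := MvPolynomial (Fin n) LL

/-- The action of `s_{k+1}` on polynomials, interchanging `Z_{k+1}` and `Z_{k+2}`. -/
def swapVar (k : ℕ) (hk : k + 1 < n) : PolyZ n →ₐ[LL] PolyZ n :=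
  MvPolynomial.rename (Equiv.swap (⟨k, by omega⟩ : Fin n) ⟨k + 1, hk⟩)

variable {n} in
/-- An element of `H_f` as a generator. -/
def gB {C : Type} (x : Hf n) : FreeAlgebra LL (Hf n ⊕ C) := FreeAlgebra.ι LL (Sum.inl x)

variable {n} in
/-- An element of the second algebra as a generator. -/
def gC {C : Type} (c : C) : FreeAlgebra LL (Hf n ⊕ C) := FreeAlgebra.ι LL (Sum.inr c)

/-- `H_i p - (s_i p) H_i = (v - v⁻¹) Z_{i+1} (p - s_i p) / (Z_i - Z_{i+1})`, for `1 ≤ i ≤ n-1` and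
all polynomials `p`, with `i = k + 1`. Here `q` is the polynomial
`(p - s_i p) / (Z_i - Z_{i+1})`. -/
inductive Rel1 : FreeAlgebra LL (Hf n ⊕ PolyZ n) → FreeAlgebra LL (Hf n ⊕ PolyZ n) → Prop
  | bernstein (k : ℕ) (hk : k + 1 < n) (p q : PolyZ n)
      (hq : q * (MvPolynomial.X ⟨k, by omega⟩ - MvPolynomial.X ⟨k + 1, hk⟩)
        = p - swapVar n k hk p) :
      Rel1 (gB (hf n k hk) * gC p - gC (swapVar n k hk p) * gB (hf n k hk))
        (gC ((v - vinv) • (MvPolynomial.X ⟨k + 1, hk⟩ * q)))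

/-- The generator `Z_{i+1}` of the free algebra `L⟨Z_1, …, Z_n⟩`, as a generator. -/
def gZ (i : Fin n) : FreeAlgebra LL (Hf n ⊕ FreeAlgebra LL (Fin n)) := gC (FreeAlgebra.ι LL i)

/-- `H_i Z_i H_i = Z_{i+1}`; `H_j Z_i = Z_i H_j` for `i - j ≠ 0, 1`; `Z_i Z_j = Z_j Z_i`.
(`hf n k _` and `gZ n k` stand for `H_{k+1}` and `Z_{k+1}`.) -/
inductive Rel2 : FreeAlgebra LL (Hf n ⊕ FreeAlgebra LL (Fin n)) →
    FreeAlgebra LL (Hf n ⊕ FreeAlgebra LL (Fin n)) → Prop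
  | step (k : ℕ) (hk : k + 1 < n) :
      Rel2 (gB (hf n k hk) * gZ n ⟨k, by omega⟩ * gB (hf n k hk)) (gZ n ⟨k + 1, hk⟩)
  | comm (i : Fin n) (j : ℕ) (hj : j + 1 < n) (h0 : (i : ℕ) ≠ j) (h1 : (i : ℕ) ≠ j + 1) :
      Rel2 (gB (hf n j hj) * gZ n i) (gZ n i * gB (hf n j hj))
  | commZ (i j : Fin n) : Rel2 (gZ n i * gZ n j) (gZ n j * gZ n i)

/-- The generator of the free algebra on one element, as a generator. -/
def gOne : FreeAlgebra LL (Hf n ⊕ FreeAlgebra LL Unit) := gC (FreeAlgebra.ι LL ())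

/-- `H_1 Z_1 H_1 Z_1 = Z_1 H_1 Z_1 H_1` (if `n ≥ 2`) and `H_i Z_1 = Z_1 H_i` for
`2 ≤ i ≤ n-1`, with `Z_1` the single further generator. -/
inductive Rel3 : FreeAlgebra LL (Hf n ⊕ FreeAlgebra LL Unit) →
    FreeAlgebra LL (Hf n ⊕ FreeAlgebra LL Unit) → Prop
  | four (hn : 0 + 1 < n) :
      Rel3 (gB (hf n 0 hn) * gOne n * gB (hf n 0 hn) * gOne n)
        (gOne n * gB (hf n 0 hn) * gOne n * gB (hf n 0 hn))
  | comm (k : ℕ) (hk : k + 1 < n) (h1 : 1 ≤ k) :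
      Rel3 (gB (hf n k hk) * gOne n) (gOne n * gB (hf n k hk))

/-- `H_i ω = ω H_{i+1}` for `1 ≤ i ≤ n-2` and `H_{n-1} ω² = ω² H_1` (if `n ≥ 2`), with `ω` the
single further generator. -/
inductive Rel4 : FreeAlgebra LL (Hf n ⊕ FreeAlgebra LL Unit) →
    FreeAlgebra LL (Hf n ⊕ FreeAlgebra LL Unit) → Prop
  | shift (k : ℕ) (hk : k + 1 + 1 < n) :
      Rel4 (gB (hf n k (by omega)) * gOne n) (gOne n * gB (hf n (k + 1) hk))
  | square (hn : 2 ≤ n) :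
      Rel4 (gB (hf n (n - 2) (by omega)) * gOne n ^ 2) (gOne n ^ 2 * gB (hf n 0 (by omega)))

end

end AffineHecke

end

open AffineHecke
open scoped TensorProduct

/-!
The proof has a combinatorial half, about lengths in `W`, and an algebraic half, about relations.

**The group.** `W` is realized by permutations `hat w` of `ℤ` which commute with the shift by `n`;
`ω` becomes `a ↦ a - 1`, and `s_i` interchanges neighbours `a - 1`, `a` with `a ≡ i`. The length is
the number of inversions modulo `n` (`len_eq_ncard_inversions`), so that `ℓ(s_i w) > ℓ(w)` unless
`w⁻¹` reverses the order of such neighbours (`Desc i w`), and an element without descents is a power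
of `ω`. Hence reduced expressions exist, and `wordU_eq_of_isReducedExpr` (Matsumoto's theorem) shows
by induction on the length that `H_w` does not depend on the expression.

**The bases.** `H_i H_w` is `H_{s_i w}`, or `H_{s_i w} + (v⁻¹ - v) H_w` if `i` is a descent of `w`.
The same formulas define the regular representation `regRep` on the free module on `W`, which shows
that the `H_w` are linearly independent (`linearIndependent_HwU`). They span `H_f` resp. `H^pol` for
`w` in `W_f` resp. `W^pol`, as every `w ∈ W^pol` can be shortened to `1` inside `W^pol` by removing
factors `s_1, …, s_{n-1}` and `ω` from the left.

**The elements `Z_i`.** One element of `W` has the two length-additive factorizations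
`ω s_1 ⋯ s_{i-1} t_{τ'}` and `s_{n-1} ⋯ s_i t_{τ''}`, which gives
`Z_i = H_i⁻¹ ⋯ H_{n-1}⁻¹ ω H_1 ⋯ H_{i-1}` (`XU_inv_eq`). In particular `Z_{i+1} = H_i Z_i H_i`, and
`Z_1 = H_1⁻¹ ⋯ H_{n-1}⁻¹ ω`.

**The presentations.** In an arbitrary algebra with a homomorphism from `H_f`, the relations of the
fourth presentation imply those of the third for `Z_1 = H_1⁻¹ ⋯ H_{n-1}⁻¹ ω`, these imply those of
the second for `Z_{i+1} = H_i Z_i H_i`, and these imply the Bernstein relations of the first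
(`Sat4.sat3`, `Sat3.sat2`, `Sat2.sat1`). So, with `A_k` the algebra of the `k`-th presentation,
there are surjections `A_1 → A_2 → A_3 → A_4 → H^pol` compatible with the canonical maps to `H^pol`.
The Bernstein relations allow one to move the `H_i` to the right, so that `L[Z] ⊗ H_f → A_1` is
surjective. Finally the composite `L[Z] ⊗ H_f → H^pol` is injective (`injective_tensorMap`): at
`v = 1` the regular representation becomes that of the group ring of `W`, where `Z^a H_π` acts as
`t_{-a} π`. These are pairwise different elements, and a linear relation over `ℤ[v, v⁻¹]` which is
trivial at `v = 1` can be divided by `v - 1` again and again. Therefore all maps in the chain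
`L[Z] ⊗ H_f → A_1 → A_2 → A_3 → A_4 → H^pol` are bijective.
-/

namespace AffineHecke

variable {n : ℕ} [NeZero n]

/-! ### Affine permutations -/

/-- The class in `{0, …, n-1}` of an integer modulo `n`. -/
def res (n : ℕ) [NeZero n] (a : ℤ) : Fin n :=
  ⟨(a % n).toNat, by
    have := Int.emod_lt_of_pos a (b := n) (by have := NeZero.pos n; omega)
    have := Int.emod_nonneg a (b := n) (by have := NeZero.ne n; omega)
    omega⟩

theorem val_pos : (0 : ℤ) < n := by have := NeZero.pos n; omega

theorem coe_res (a : ℤ) : ((res n a : ℕ) : ℤ) = a % n := by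
  have := Int.emod_nonneg a (b := n) (by have := NeZero.ne n; omega)
  simp [res, this]

theorem res_eq_iff {a b : ℤ} : res n a = res n b ↔ (n : ℤ) ∣ a - b := by
  rw [Fin.ext_iff, ← Int.natCast_inj, coe_res, coe_res, ← dvd_neg, neg_sub]
  exact Int.modEq_iff_dvd

theorem res_add_div (a : ℤ) : ((res n a : ℕ) : ℤ) + n * (a / n) = a := by
  rw [coe_res]; exact Int.emod_add_mul_ediv a n

theorem res_coe_add (r : Fin n) (q : ℤ) : res n ((r : ℕ) + n * q) = r := by
  rw [Fin.ext_iff, ← Int.natCast_inj, coe_res, Int.add_mul_emod_self_left]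
  exact Int.emod_eq_of_lt (by omega) (by have := r.2; omega)

theorem res_coe (r : Fin n) : res n (r : ℕ) = r := by simpa using res_coe_add r 0

theorem coe_add_div (r : Fin n) (q : ℤ) : (((r : ℕ) : ℤ) + n * q) / n = q := by
  rw [Int.add_mul_ediv_left _ _ (val_pos).ne',
    Int.ediv_eq_zero_of_lt (by omega) (by have := r.2; omega)]
  simp

theorem res_periodic (a m : ℤ) : res n (a + n * m) = res n a := by
  rw [res_eq_iff]; exact ⟨m, by ring⟩

theorem div_periodic (a m : ℤ) : (a + n * m) / n = a / n + m :=
  Int.add_mul_ediv_left _ _ (val_pos).ne'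

theorem res_add_one (a : ℤ) : res n (a + 1) = res n a + 1 := by
  rw [Fin.ext_iff, ← Int.natCast_inj, coe_res, Fin.val_add, Fin.val_one']
  push_cast
  rw [coe_res]
  simp [Int.add_emod]

theorem res_sub_one (a : ℤ) : res n (a - 1) = res n a - 1 := by
  rw [eq_sub_iff_add_eq, ← res_add_one, sub_add_cancel]

theorem coe_neg_one : (((-1 : Fin n) : ℕ) : ℤ) = n - 1 := by
  have h : (-1 : Fin n) = res n (-1) := by
    have := res_sub_one (n := n) 0
    have h0 : res n 0 = 0 := by simpa using res_coe (0 : Fin n)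
    rw [h0] at this
    simpa using this.symm
  rw [h, coe_res, ← Int.add_emod_right]
  exact Int.emod_eq_of_lt (by have := val_pos (n := n); omega) (by omega)

theorem coe_sub_one {r : Fin n} (h : r ≠ 0) : (((r - 1 : Fin n) : ℕ) : ℤ) = (r : ℕ) - 1 := by
  have h3 : 0 < (r : ℕ) := Nat.pos_of_ne_zero fun h' => h (Fin.ext (by simpa using h'))
  have := res_sub_one (n := n) (r : ℕ)
  rw [res_coe] at this
  rw [← this, coe_res]
  exact Int.emod_eq_of_lt (by omega) (by have := r.2; omega)

/-- The affine permutation of `ℤ` attached to `w = t_τ π`: it commutes with the translation by `n`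
and sends `r ∈ {0, …, n-1}` to `π r + n τ_{π r}`. -/
def hat (w : Weyl n) (a : ℤ) : ℤ :=
  ((w.right (res n a) : ℕ) : ℤ) + n * (w.left.toAdd (w.right (res n a)) + a / n)

theorem hat_periodic (w : Weyl n) (a m : ℤ) : hat w (a + n * m) = hat w a + n * m := by
  simp only [hat, res_periodic, div_periodic]; ring

theorem hat_one (a : ℤ) : hat (1 : Weyl n) a = a := by
  simpa [hat] using res_add_div a

theorem hat_mul (w w' : Weyl n) (a : ℤ) : hat (w * w') a = hat w (hat w' a) := by
  unfold hat
  rw [res_coe_add, coe_add_div]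
  simp only [permAct, SemidirectProduct.mul_left, SemidirectProduct.mul_right, toAdd_mul,
    Equiv.Perm.coe_mul, Function.comp_apply, Pi.add_apply, MonoidHom.coe_mk, OneHom.coe_mk,
    MulEquiv.coe_mk, Equiv.coe_fn_mk, toAdd_ofAdd, Equiv.Perm.coe_inv, Equiv.symm_apply_apply]
  ring

theorem hat_inv_hat (w : Weyl n) (a : ℤ) : hat w⁻¹ (hat w a) = a := by
  rw [← hat_mul, inv_mul_cancel, hat_one]

theorem hat_hat_inv (w : Weyl n) (a : ℤ) : hat w (hat w⁻¹ a) = a := by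
  rw [← hat_mul, mul_inv_cancel, hat_one]

theorem hat_injective (w : Weyl n) : Function.Injective (hat w) :=
  Function.LeftInverse.injective (hat_inv_hat w)

/-- An element of `W` is determined by its affine permutation. The relations between
`ω` and the `s_i` are proved in this way. -/
theorem hat_ext {w w' : Weyl n} (h : ∀ a, hat w a = hat w' a) : w = w' := by
  have key : ∀ r : Fin n, w.right r = w'.right r ∧
      w.left.toAdd (w.right r) = w'.left.toAdd (w'.right r) := by
    intro r
    have h0 := h (r : ℕ)
    unfold hat at h0
    rw [res_coe] at h0
    have h1 := congrArg (res n) h0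
    have h2 := congrArg (· / (n : ℤ)) h0
    simp only [res_coe_add, coe_add_div] at h1 h2
    exact ⟨h1, by simpa using h2⟩
  have hr : w.right = w'.right := Equiv.ext fun r => (key r).1
  refine SemidirectProduct.ext ?_ hr
  apply Multiplicative.toAdd.injective
  funext i
  have := (key (w.right⁻¹ i)).2
  rw [← hr] at this
  simpa using this

theorem hat_omegaW (a : ℤ) : hat (omegaW n) a = a - 1 := by
  have h := res_add_div (n := n) a
  unfold hat omegaW
  generalize res n a = r at *
  have hr : ((finRotate n)⁻¹ : Equiv.Perm (Fin n)) r = r - 1 := by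
    rw [Equiv.Perm.inv_eq_iff_eq, finRotate_apply]; simp
  simp only [transl, ofPerm, SemidirectProduct.mul_right, SemidirectProduct.right_inl,
    SemidirectProduct.right_inr, one_mul, SemidirectProduct.mul_left, SemidirectProduct.left_inl,
    SemidirectProduct.left_inr, map_one, mul_one, hr, toAdd_ofAdd, Pi.neg_apply]
  by_cases h0 : r = 0
  · subst h0
    have h1 := coe_neg_one (n := n)
    rw [zero_sub, h1, Pi.single_eq_same, mul_add]
    simp at h ⊢
    omega
  · have h1 : r - 1 ≠ -1 := by
      intro h; apply h0; rw [sub_eq_iff_eq_add] at h; simpa using h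
    rw [coe_sub_one h0, Pi.single_eq_of_ne h1]
    simp; omega

theorem hat_omegaW_inv (a : ℤ) : hat (omegaW n)⁻¹ a = a + 1 := by
  have := hat_inv_hat (omegaW n) (a + 1)
  rwa [hat_omegaW, add_sub_cancel_right] at this

theorem hat_omegaW_zpow (k a : ℤ) : hat (omegaW n ^ k) a = a - k := by
  induction k using Int.induction_on generalizing a with
  | zero => simp [hat_one]
  | succ k ih => rw [zpow_add_one, hat_mul, hat_omegaW, ih]; ring
  | pred k ih => rw [zpow_sub_one, hat_mul, hat_omegaW_inv, ih]; ring

theorem hat_simpleRefl (i : SimpleIdx n) (a : ℤ) : hat (simpleRefl n i) a =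
    if res n a = i.1 then a - 1 else if res n (a + 1) = i.1 then a + 1 else a := by
  obtain ⟨i, hn⟩ := i
  have h := res_add_div (n := n) a
  have h10 : (-1 : Fin n) ≠ 0 := by
    intro h
    have := coe_neg_one (n := n)
    rw [h] at this
    simp at this
    omega
  rw [res_add_one]
  unfold hat simpleRefl
  generalize res n a = r at *
  dsimp only
  by_cases hi : i = 0
  · subst hi
    simp only [if_true, transl, ofPerm, SemidirectProduct.mul_right, SemidirectProduct.right_inl,
      SemidirectProduct.right_inr, one_mul, SemidirectProduct.mul_left, SemidirectProduct.left_inl,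
      SemidirectProduct.left_inr, map_one, mul_one, toAdd_ofAdd, Pi.sub_apply]
    by_cases h1 : r = 0
    · subst h1
      rw [if_pos rfl, Equiv.swap_apply_right, coe_neg_one, Pi.single_eq_same,
        Pi.single_eq_of_ne h10, mul_add]
      simp at h ⊢
      omega
    · rw [if_neg h1]
      by_cases h2 : r = -1
      · subst h2
        rw [if_pos (neg_add_cancel 1), Equiv.swap_apply_left, Pi.single_eq_same,
          Pi.single_eq_of_ne h10.symm, mul_add]
        rw [coe_neg_one] at h
        simp
        omega
      · rw [if_neg (fun h => h2 (eq_neg_of_add_eq_zero_left h)),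
          Equiv.swap_apply_of_ne_of_ne h2 h1, Pi.single_eq_of_ne h1, Pi.single_eq_of_ne h2]
        simpa using h
  · have h3 : i - 1 ≠ i := by
      intro h
      have := coe_sub_one hi
      rw [h] at this
      omega
    simp only [if_neg hi, ofPerm, SemidirectProduct.right_inr, SemidirectProduct.left_inr,
      toAdd_one, Pi.zero_apply, zero_add]
    by_cases h1 : r = i
    · subst h1
      rw [if_pos rfl, Equiv.swap_apply_right, coe_sub_one hi]
      omega
    · rw [if_neg h1]
      by_cases h2 : r = i - 1
      · subst h2
        rw [if_pos (sub_add_cancel _ _), Equiv.swap_apply_left]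
        rw [coe_sub_one hi] at h
        omega
      · rw [if_neg (fun h => h2 (eq_sub_of_add_eq h)), Equiv.swap_apply_of_ne_of_ne h2 h1]
        exact h

/-- An integer version of `hat_simpleRefl`: `s_i` interchanges `a₀ - 1` and `a₀` modulo `n`, where
`a₀` is any integer of residue class `i`. -/
theorem hat_simpleRefl' {i : SimpleIdx n} {a₀ : ℤ} (h : res n a₀ = i.1) (a : ℤ) :
    hat (simpleRefl n i) a =
      if (n : ℤ) ∣ a - a₀ then a - 1 else if (n : ℤ) ∣ a + 1 - a₀ then a + 1 else a := by
  rw [hat_simpleRefl, ← h]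
  simp only [res_eq_iff]

theorem not_dvd_one {n : ℕ} (hn : 2 ≤ n) {a : ℤ} (h : (n : ℤ) ∣ a) : ¬ (n : ℤ) ∣ a + 1 := by
  rintro h'
  have := (Int.dvd_iff_dvd_of_dvd_add h').1 h
  have := Int.le_of_dvd one_pos this
  omega

theorem simpleRefl_sq (i : SimpleIdx n) : simpleRefl n i * simpleRefl n i = 1 := by
  refine hat_ext fun a => ?_
  rw [hat_mul, hat_one]
  have h := hat_simpleRefl' (res_coe i.1)
  rw [h a]
  generalize ((i.1 : ℕ) : ℤ) = b at *
  split_ifs with h1 h2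
  · rw [h, if_neg, if_pos (by convert h1 using 1; ring)]
    · ring
    · intro h2
      apply not_dvd_one i.2 h2
      convert h1 using 1; ring
  · rw [h, if_pos (by convert h2 using 1)]
    ring
  · rw [h, if_neg h1, if_neg h2]

theorem simpleRefl_inv (i : SimpleIdx n) : (simpleRefl n i)⁻¹ = simpleRefl n i :=
  inv_eq_of_mul_eq_one_left (simpleRefl_sq i)

theorem simpleRefl_mul_cancel (i : SimpleIdx n) (w : Weyl n) :
    simpleRefl n i * (simpleRefl n i * w) = w := by
  rw [← mul_assoc, simpleRefl_sq, one_mul]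

theorem omega_mul_simpleRefl {i j : SimpleIdx n} (h : j.1 = i.1 - 1) :
    omegaW n * simpleRefl n i = simpleRefl n j * omegaW n := by
  refine hat_ext fun a => ?_
  rw [hat_mul, hat_mul, hat_omegaW, hat_omegaW, hat_simpleRefl' (res_coe i.1),
    hat_simpleRefl' (a₀ := (i.1 : ℕ) - 1) (by rw [res_sub_one, res_coe, h])]
  have e1 : a - 1 - (((i.1 : ℕ) : ℤ) - 1) = a - (i.1 : ℕ) := by ring
  have e2 : a - 1 + 1 - (((i.1 : ℕ) : ℤ) - 1) = a + 1 - (i.1 : ℕ) := by ring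
  rw [e1, e2]
  split_ifs <;> ring

/-! ### Descents -/

/-- `s_i` is a left descent of `w`: the root `w⁻¹ α_i` is negative. -/
def Desc (i : SimpleIdx n) (w : Weyl n) : Prop :=
  hat w⁻¹ ((i.1 : ℕ) : ℤ) < hat w⁻¹ ((i.1 : ℕ) - 1)

theorem eq_add_of_res_eq {a b : ℤ} (h : res n a = res n b) : ∃ m, a = b + n * m := by
  obtain ⟨m, hm⟩ := res_eq_iff.1 h
  exact ⟨m, by linarith⟩

/-- The descent condition does not depend on the representative `a` of the residue class `i`. -/
theorem desc_iff {i : SimpleIdx n} {a : ℤ} (h : res n a = i.1) (w : Weyl n) :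
    Desc i w ↔ hat w⁻¹ a < hat w⁻¹ (a - 1) := by
  rw [← res_coe i.1] at h
  obtain ⟨m, rfl⟩ := eq_add_of_res_eq h
  have : ((i.1 : ℕ) : ℤ) + n * m - 1 = (i.1 : ℕ) - 1 + n * m := by ring
  rw [this, hat_periodic, hat_periodic, Desc]
  simp

theorem not_desc_iff {i : SimpleIdx n} {a : ℤ} (h : res n a = i.1) (w : Weyl n) :
    ¬ Desc i w ↔ hat w⁻¹ (a - 1) < hat w⁻¹ a := by
  rw [desc_iff h, not_lt, le_iff_lt_or_eq, or_iff_left]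
  intro h
  have := hat_injective _ h
  omega

theorem hat_inv_simpleRefl_mul (i : SimpleIdx n) (w : Weyl n) (a : ℤ) :
    hat (simpleRefl n i * w)⁻¹ a = hat w⁻¹ (hat (simpleRefl n i) a) := by
  rw [mul_inv_rev, simpleRefl_inv, hat_mul]

theorem hat_simpleRefl_self {i : SimpleIdx n} {a : ℤ} (h : res n a = i.1) :
    hat (simpleRefl n i) a = a - 1 := by
  rw [hat_simpleRefl, if_pos h]

theorem hat_simpleRefl_pred {i : SimpleIdx n} {a : ℤ} (h : res n a = i.1) :
    hat (simpleRefl n i) (a - 1) = a := by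
  rw [← hat_simpleRefl_self h, ← hat_mul, simpleRefl_sq, hat_one]

theorem hat_simpleRefl_fix {i : SimpleIdx n} {a : ℤ} (h : res n a ≠ i.1)
    (h' : res n (a + 1) ≠ i.1) :
    hat (simpleRefl n i) a = a := by
  rw [hat_simpleRefl, if_neg h, if_neg h']

theorem desc_simpleRefl_mul (i : SimpleIdx n) (w : Weyl n) :
    Desc i (simpleRefl n i * w) ↔ ¬ Desc i w := by
  have h := res_coe i.1
  rw [desc_iff h, not_desc_iff h, hat_inv_simpleRefl_mul, hat_inv_simpleRefl_mul,
    hat_simpleRefl_self h, hat_simpleRefl_pred h]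

theorem res_ne_succ (hn : 2 ≤ n) (a : ℤ) : res n (a + 1) ≠ res n a := by
  intro h
  rw [res_eq_iff] at h
  have := Int.le_of_dvd (by omega) h
  omega

theorem res_ne_succ_succ (hn : 3 ≤ n) (a : ℤ) : res n (a + 1 + 1) ≠ res n a := by
  intro h
  rw [res_eq_iff] at h
  have := Int.le_of_dvd (by omega) h
  omega

section far
variable {i j : SimpleIdx n} (h0 : i.1 ≠ j.1) (h1 : j.1 ≠ i.1 + 1) (h2 : i.1 ≠ j.1 + 1)
include h0 h1 h2

theorem desc_simpleRefl_mul_far (w : Weyl n) : Desc j (simpleRefl n i * w) ↔ Desc j w := by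
  obtain ⟨a, ha⟩ : ∃ a : ℤ, res n a = j.1 := ⟨_, res_coe j.1⟩
  rw [desc_iff ha, desc_iff ha, hat_inv_simpleRefl_mul, hat_inv_simpleRefl_mul,
    hat_simpleRefl_fix, hat_simpleRefl_fix]
  · rw [res_sub_one, ha]; intro h; exact h1 (by rw [← h]; simp)
  · rw [sub_add_cancel, ha]; exact h0.symm
  · rw [ha]; exact h0.symm
  · rw [res_add_one, ha]; exact h2.symm

theorem simpleRefl_comm_far :
    simpleRefl n i * simpleRefl n j = simpleRefl n j * simpleRefl n i := by
  have key : ∀ {i j : SimpleIdx n}, i.1 ≠ j.1 → j.1 ≠ i.1 + 1 → i.1 ≠ j.1 + 1 → ∀ a,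
      hat (simpleRefl n j) a ≠ a →
      hat (simpleRefl n i) a = a ∧ hat (simpleRefl n i) (hat (simpleRefl n j) a) =
        hat (simpleRefl n j) a := by
    intro i j h0 h1 h2 a ha
    by_cases h3 : res n a = j.1
    · rw [hat_simpleRefl_self h3]
      refine ⟨hat_simpleRefl_fix ?_ ?_, hat_simpleRefl_fix ?_ ?_⟩
      · rw [h3]; exact h0.symm
      · rw [res_add_one, h3]; exact h2.symm
      · rw [res_sub_one, h3]; intro h; exact h1 (by rw [← h]; simp)
      · rw [sub_add_cancel, h3]; exact h0.symm
    by_cases h4 : res n (a + 1) = j.1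
    · have h5 := hat_simpleRefl_pred h4
      rw [add_sub_cancel_right] at h5
      rw [h5]
      refine ⟨hat_simpleRefl_fix ?_ ?_, hat_simpleRefl_fix ?_ ?_⟩
      · intro h; rw [res_add_one, h] at h4; exact h1 h4.symm
      · rw [h4]; exact h0.symm
      · rw [h4]; exact h0.symm
      · rw [res_add_one, h4]; exact h2.symm
    · exact absurd (hat_simpleRefl_fix h3 h4) ha
  refine hat_ext fun a => ?_
  rw [hat_mul, hat_mul]
  by_cases hj : hat (simpleRefl n j) a = a
  · by_cases hi : hat (simpleRefl n i) a = a
    · rw [hj, hi, hj]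
    · rw [(key h0.symm h2 h1 a hi).2, hj]
  · obtain ⟨h3, h4⟩ := key h0 h1 h2 a hj
    rw [h4, h3]

end far

section adjacent
variable {i j : SimpleIdx n} (hj : j.1 = i.1 + 1)
include hj

theorem desc_adjacent {a : ℤ} (ha : res n a = i.1) (w : Weyl n) :
    (Desc i w ↔ hat w⁻¹ a < hat w⁻¹ (a - 1)) ∧ (Desc j w ↔ hat w⁻¹ (a + 1) < hat w⁻¹ a) := by
  have ha' : res n (a + 1) = j.1 := by rw [res_add_one, ha, hj]
  refine ⟨desc_iff ha w, ?_⟩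
  rw [desc_iff ha' w, add_sub_cancel_right]

variable (hn : 3 ≤ n)
include hn

/-- The action of `s_i` and `s_{i+1}` on the three consecutive integers `a - 1`, `a`, `a + 1` with
`a ≡ i`; for `n ≥ 3` they are pairwise incongruent modulo `n`. -/
theorem hat_adjacent {a : ℤ} (ha : res n a = i.1) :
    hat (simpleRefl n i) a = a - 1 ∧ hat (simpleRefl n i) (a - 1) = a ∧
    hat (simpleRefl n i) (a + 1) = a + 1 ∧
    hat (simpleRefl n j) (a + 1) = a ∧ hat (simpleRefl n j) a = a + 1 ∧
    hat (simpleRefl n j) (a - 1) = a - 1 := by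
  have ha' : res n (a + 1) = j.1 := by rw [res_add_one, ha, hj]
  refine ⟨hat_simpleRefl_self ha, hat_simpleRefl_pred ha, hat_simpleRefl_fix ?_ ?_, ?_, ?_,
    hat_simpleRefl_fix ?_ ?_⟩
  · rw [← ha]; exact res_ne_succ (by omega) a
  · rw [← ha]; exact res_ne_succ_succ hn a
  · simpa using hat_simpleRefl_self ha'
  · simpa using hat_simpleRefl_pred ha'
  · rw [← ha']; have := res_ne_succ_succ hn (a - 1); rw [sub_add_cancel] at this; exact this.symm
  · rw [← ha', sub_add_cancel]; exact (res_ne_succ (by omega) a).symm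

theorem desc_swap_adjacent (w : Weyl n) :
    Desc i (simpleRefl n j * w) ↔ Desc j (simpleRefl n i * w) := by
  obtain ⟨a, ha⟩ : ∃ a : ℤ, res n a = i.1 := ⟨_, res_coe i.1⟩
  obtain ⟨h1, h2, h3, h4, h5, h6⟩ := hat_adjacent hj hn ha
  rw [(desc_adjacent hj ha _).1, (desc_adjacent hj ha _).2]
  simp only [hat_inv_simpleRefl_mul, *]

theorem desc_mul_mul_adjacent (w : Weyl n) :
    Desc j (simpleRefl n i * (simpleRefl n j * w)) ↔ Desc i w := by
  obtain ⟨a, ha⟩ : ∃ a : ℤ, res n a = i.1 := ⟨_, res_coe i.1⟩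
  obtain ⟨h1, h2, h3, h4, h5, h6⟩ := hat_adjacent hj hn ha
  rw [(desc_adjacent hj ha _).1, (desc_adjacent hj ha _).2]
  simp only [hat_inv_simpleRefl_mul, *]

theorem desc_mul_mul_adjacent' (w : Weyl n) :
    Desc i (simpleRefl n j * (simpleRefl n i * w)) ↔ Desc j w := by
  rw [desc_swap_adjacent hj hn, simpleRefl_mul_cancel]

/-- If `w⁻¹` is decreasing on the three neighbours moved by `s_i` and `s_{i+1}`, then `s_{i+1}` is
also a descent of `s_i w`. -/
theorem desc_mul_of_desc_adjacent {w : Weyl n} (hi : Desc i w) (hj' : Desc j w) :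
    Desc j (simpleRefl n i * w) := by
  obtain ⟨a, ha⟩ : ∃ a : ℤ, res n a = i.1 := ⟨_, res_coe i.1⟩
  obtain ⟨h1, h2, h3, h4, h5, h6⟩ := hat_adjacent hj hn ha
  rw [(desc_adjacent hj ha _).1] at hi
  rw [(desc_adjacent hj ha _).2] at hj' ⊢
  simp only [hat_inv_simpleRefl_mul, *]
  exact hj'.trans hi

/-- If `w⁻¹` is increasing on the three neighbours moved by `s_i` and `s_{i+1}`, then `s_{i+1}` is
not a descent of `s_i w`. -/
theorem not_desc_mul_of_not_desc_adjacent {w : Weyl n} (hi : ¬ Desc i w) (hj' : ¬ Desc j w) :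
    ¬ Desc j (simpleRefl n i * w) := by
  obtain ⟨a, ha⟩ : ∃ a : ℤ, res n a = i.1 := ⟨_, res_coe i.1⟩
  obtain ⟨h1, h2, h3, h4, h5, h6⟩ := hat_adjacent hj hn ha
  rw [(desc_adjacent hj ha _).1] at hi
  rw [(desc_adjacent hj ha _).2] at hj' ⊢
  simp only [hat_inv_simpleRefl_mul, *]
  rw [not_lt] at *
  exact hi.trans hj'

theorem simpleRefl_braid : simpleRefl n i * simpleRefl n j * simpleRefl n i =
    simpleRefl n j * simpleRefl n i * simpleRefl n j := by
  refine hat_ext fun b => ?_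
  simp only [hat_mul]
  by_cases hb1 : res n b = i.1
  · obtain ⟨h1, h2, h3, h4, h5, h6⟩ := hat_adjacent hj hn hb1
    simp only [*]
  by_cases hb2 : res n (b + 1) = i.1
  · obtain ⟨h1, h2, h3, h4, h5, h6⟩ := hat_adjacent hj hn hb2
    simp only [add_sub_cancel_right] at *
    simp only [*]
  by_cases hb3 : res n (b - 1) = i.1
  · obtain ⟨h1, h2, h3, h4, h5, h6⟩ := hat_adjacent hj hn hb3
    simp only [sub_add_cancel] at *
    simp only [*]
  have hi : hat (simpleRefl n i) b = b := hat_simpleRefl_fix hb1 hb2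
  have hj : hat (simpleRefl n j) b = b := by
    refine hat_simpleRefl_fix ?_ ?_
    · rw [hj]; intro h; apply hb3; rw [res_sub_one, h]; simp
    · rw [hj, res_add_one]; intro h; exact hb1 (add_right_cancel h)
  simp only [hi, hj]

end adjacent

/-- For `n = 2` the roots `α_0`, `α_1` add up to the constant function `1`, so that `w⁻¹` cannot
make both of them negative. -/
theorem not_desc_of_two (hn : n = 2) {i j : SimpleIdx n} (hij : i ≠ j) {w : Weyl n}
    (hi : Desc i w) : ¬ Desc j w := by
  obtain ⟨a, ha⟩ : ∃ a : ℤ, res n a = i.1 := ⟨_, res_coe i.1⟩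
  have ha' : res n (a + 1) = j.1 := by
    have h1 := res_ne_succ hn.ge a
    subst hn
    have h2 : i.1 ≠ j.1 := fun h => hij (Subtype.ext h)
    omega
  rw [desc_iff ha] at hi
  rw [desc_iff ha', add_sub_cancel_right]
  have := hat_periodic w⁻¹ (a - 1) 1
  have e : a - 1 + n * 1 = a + 1 := by rw [hn]; push_cast; ring
  rw [e] at this
  rw [this]
  have : (n : ℤ) = 2 := by omega
  have := hat_injective w⁻¹ (a₁ := a) (a₂ := a - 1)
  omega

theorem hat_inv_omegaW_mul (w : Weyl n) (a : ℤ) : hat (omegaW n * w)⁻¹ a = hat w⁻¹ (a + 1) := by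
  rw [mul_inv_rev, hat_mul, hat_omegaW_inv]

theorem desc_omegaW_mul {i j : SimpleIdx n} (h : j.1 = i.1 - 1) (w : Weyl n) :
    Desc j (omegaW n * w) ↔ Desc i w := by
  rw [desc_iff (a := (i.1 : ℕ) - 1) (by rw [res_sub_one, res_coe, h]), Desc,
    hat_inv_omegaW_mul, hat_inv_omegaW_mul]
  simp

/-! ### The length function -/

theorem affRoot_injective {n : ℕ} {i j i' j' : Fin n} {k k' : ℤ} (hij : i ≠ j)
    (h : affRoot i j k = affRoot i' j' k') : i = i' ∧ j = j' ∧ k = k' := by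
  have h0 := congrFun h 0
  have h1 := congrFun h (Pi.single i 1)
  have h2 := congrFun h (Pi.single j 1)
  simp only [affRoot, Pi.zero_apply, sub_self, zero_add] at h0 h1 h2
  subst h0
  simp only [Pi.single_eq_same, Pi.single_eq_of_ne hij, Pi.single_eq_of_ne hij.symm] at h1 h2
  refine ⟨?_, ?_, rfl⟩
  · by_contra h3
    rw [Pi.single_eq_of_ne (Ne.symm h3)] at h1
    by_cases h4 : j' = i
    · rw [h4, Pi.single_eq_same] at h1; omega
    · rw [Pi.single_eq_of_ne h4] at h1; omega
  · by_contra h3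
    rw [Pi.single_eq_of_ne (Ne.symm h3)] at h2
    by_cases h4 : i' = j
    · rw [h4, Pi.single_eq_same] at h2; omega
    · rw [Pi.single_eq_of_ne h4] at h2; omega

/-- The affine function `τ_i - τ_j + k` corresponds to the pair of integers `i`, `j + n k`, and it
is positive if and only if this pair is in increasing order. -/
theorem affRoot_mem_posRoots {i j : Fin n} {k : ℤ} (hij : i ≠ j) :
    affRoot i j k ∈ posRoots n ↔ ((i : ℕ) : ℤ) < (j : ℕ) + n * k := by
  have hn := val_pos (n := n)
  have hi := i.2
  have hj := j.2
  have : (0 < k ∨ (k = 0 ∧ i < j)) ↔ ((i : ℕ) : ℤ) < (j : ℕ) + n * k := by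
    rcases lt_trichotomy k 0 with h | h | h
    · have : (n : ℤ) * k ≤ -n := by nlinarith
      constructor
      · rintro (h | h) <;> omega
      · intro; omega
    · subst h
      simp
    · have : (n : ℤ) ≤ n * k := by nlinarith
      constructor
      · intro; omega
      · intro; exact Or.inl h
  rw [← this]
  constructor
  · rintro ⟨i', j', k', h1, h2, h3⟩
    obtain ⟨rfl, rfl, rfl⟩ := affRoot_injective hij h3
    exact h2
  · intro h
    exact ⟨i, j, k, hij, h, rfl⟩

theorem neg_act_affRoot {n : ℕ} (w : Weyl n) (i j : Fin n) (k : ℤ) :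
    (-fun τ => affRoot i j k (act w⁻¹ τ)) = affRoot (w.right j) (w.right i)
      (w.left.toAdd (w.right i) - w.left.toAdd (w.right j) - k) := by
  funext τ
  have h : ∀ i, w⁻¹.left.toAdd i = -w.left.toAdd (w.right i) := fun _ => rfl
  simp only [affRoot, act, Pi.neg_apply, SemidirectProduct.inv_right, inv_inv, h]
  ring

/-- The inversions of an affine permutation, as pairs of integers modulo simultaneous shift. -/
def inversions (w : Weyl n) : Set (ℤ × ℤ) :=
  {p | 0 ≤ p.1 ∧ p.1 < n ∧ p.1 < p.2 ∧ hat w p.2 < hat w p.1}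

theorem res_ne_of_mem_inversions {w : Weyl n} {p : ℤ × ℤ} (h : p ∈ inversions w) :
    res n p.1 ≠ res n p.2 := by
  intro h'
  obtain ⟨h0, h1, h2, h3⟩ := h
  obtain ⟨m, hm⟩ := eq_add_of_res_eq h'
  rw [hm, hat_periodic] at h3
  omega

theorem affRoot_mem_iff (w : Weyl n) (i j : Fin n) (hij : i ≠ j) (k : ℤ) :
    (affRoot i j k ∈ posRoots n ∧ (-fun τ => affRoot i j k (act w⁻¹ τ)) ∈ posRoots n) ↔
      (((i : ℕ) : ℤ), ((j : ℕ) : ℤ) + n * k) ∈ inversions w := by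
  rw [affRoot_mem_posRoots hij, neg_act_affRoot,
    affRoot_mem_posRoots fun h => hij (w.right.injective h).symm]
  unfold inversions
  simp only [Set.mem_ofPred_eq, hat, res_coe_add, coe_add_div]
  have h1 := res_coe i
  have h2 := coe_add_div i 0
  rw [mul_zero, add_zero] at h2
  rw [h1, h2]
  have := i.2
  constructor
  · rintro ⟨h3, h4⟩
    refine ⟨by omega, by omega, h3, ?_⟩
    linarith
  · rintro ⟨-, -, h3, h4⟩
    exact ⟨h3, by linarith⟩

theorem len_eq_ncard_inversions (w : Weyl n) : len w = (inversions w).ncard := by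
  unfold len
  symm
  have hco : ∀ p ∈ inversions w, (((res n p.1 : ℕ) : ℤ),
      ((res n p.2 : ℕ) : ℤ) + n * (p.2 / n)) = p := by
    intro p hp
    refine Prod.ext ?_ (res_add_div p.2)
    dsimp only
    rw [coe_res]
    exact Int.emod_eq_of_lt hp.1 hp.2.1
  refine Set.ncard_congr (fun p _ => affRoot (res n p.1) (res n p.2) (p.2 / n)) ?_ ?_ ?_
  · intro p hp
    rw [Set.mem_ofPred_eq, affRoot_mem_iff w _ _ (res_ne_of_mem_inversions hp), hco p hp]
    exact hp
  · intro p q hp hq h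
    obtain ⟨h1, h2, h3⟩ := affRoot_injective (res_ne_of_mem_inversions hp) h
    rw [← hco p hp, ← hco q hq, h1, h2, h3]
  · rintro α ⟨⟨i, j, k, hij, h1, rfl⟩, h2⟩
    refine ⟨(((i : ℕ) : ℤ), ((j : ℕ) : ℤ) + n * k), ?_, ?_⟩
    · rw [← affRoot_mem_iff w i j hij]
      exact ⟨⟨i, j, k, hij, h1, rfl⟩, h2⟩
    · simp only [res_coe, res_coe_add, coe_add_div]

/-- Affine permutations move all integers by a bounded distance; hence they have finitely many
inversions. -/
theorem abs_hat_sub_le (w : Weyl n) (a : ℤ) : |hat w a - a| ≤ n + n * ∑ i, |w.left.toAdd i| := by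
  have h := res_add_div (n := n) a
  unfold hat
  generalize res n a = r at *
  have h1 : |w.left.toAdd (w.right r)| ≤ ∑ i, |w.left.toAdd i| :=
    Finset.single_le_sum (f := fun i => |w.left.toAdd i|) (fun i _ => abs_nonneg _)
      (Finset.mem_univ _)
  have hn := val_pos (n := n)
  have h2 : |(n : ℤ) * w.left.toAdd (w.right r)| ≤ n * ∑ i, |w.left.toAdd i| := by
    rw [abs_mul, abs_of_pos hn]
    exact mul_le_mul_of_nonneg_left h1 hn.le
  have h3 : |(((w.right r : Fin n) : ℕ) : ℤ) - (r : ℕ)| ≤ n := by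
    have := r.2
    have := (w.right r).2
    rw [abs_le]; constructor <;> omega
  calc _ = |((((w.right r : Fin n) : ℕ) : ℤ) - (r : ℕ)) + n * w.left.toAdd (w.right r)| := by
        congr 1; rw [mul_add]; linarith
    _ ≤ _ := (abs_add_le _ _).trans (add_le_add h3 h2)

theorem inversions_finite (w : Weyl n) : (inversions w).Finite := by
  set C := (n : ℤ) + n * ∑ i, |w.left.toAdd i| with hC
  refine ((Set.finite_Ico 0 (n : ℤ)).prod (Set.finite_Ico 0 (n + 2 * C))).subset ?_
  rintro ⟨x, y⟩ ⟨h0, h1, h2, h3⟩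
  have hx := abs_le.1 (abs_hat_sub_le w x)
  have hy := abs_le.1 (abs_hat_sub_le w y)
  dsimp only at *
  rw [← hC] at hx hy
  refine ⟨⟨h0, h1⟩, ?_, ?_⟩ <;> dsimp only <;> omega

/-- `s_i` preserves the order of `x` and `y` unless they are the two neighbours it interchanges. -/
theorem hat_simpleRefl_lt (i : SimpleIdx n) {x y : ℤ} (hxy : x ≠ y) :
    (hat (simpleRefl n i) y < hat (simpleRefl n i) x ↔ y < x) ∨
      (res n (x + 1) = i.1 ∧ y = x + 1) ∨ (res n x = i.1 ∧ y = x - 1) := by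
  have up : ∀ c, res n c ≠ i.1 → c ≤ hat (simpleRefl n i) c := by
    intro c hc; rw [hat_simpleRefl, if_neg hc]; split_ifs <;> omega
  have down : ∀ c, res n (c + 1) ≠ i.1 → hat (simpleRefl n i) c ≤ c := by
    intro c hc; rw [hat_simpleRefl, if_neg hc]; split_ifs <;> omega
  by_cases h1 : y = x + 1
  · subst h1
    by_cases h : res n (x + 1) = i.1
    · exact Or.inr (Or.inl ⟨h, rfl⟩)
    · have := up _ h; have := down _ h; left; omega
  by_cases h2 : y = x - 1
  · subst h2
    by_cases h : res n x = i.1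
    · exact Or.inr (Or.inr ⟨h, rfl⟩)
    · have := up _ h; have := down (x - 1) (by rwa [sub_add_cancel]); left; omega
  left
  rw [hat_simpleRefl, hat_simpleRefl]
  have hne : hat (simpleRefl n i) x ≠ hat (simpleRefl n i) y := fun h => hxy (hat_injective _ h)
  rw [hat_simpleRefl, hat_simpleRefl] at hne
  split_ifs at hne ⊢ <;> omega

/-- Multiplication by `s_i` on the left creates one inversion, the pair of positions which `w` sends
to neighbours interchanged by `s_i`. -/
theorem inversions_simpleRefl_mul {i : SimpleIdx n} {w : Weyl n} (h : ¬ Desc i w) :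
    ∃ p, p ∉ inversions w ∧ inversions (simpleRefl n i * w) = insert p (inversions w) := by
  obtain ⟨a, ha⟩ : ∃ a : ℤ, res n a = i.1 := ⟨_, res_coe i.1⟩
  rw [not_desc_iff ha] at h
  -- the new inversion is the pair `p < q` which `w` sends to `a - 1 < a`, shifted by a multiple of
  -- `n` such that its first entry lies in `{0, …, n-1}`
  set p := hat w⁻¹ (a - 1) with hp
  set q := hat w⁻¹ a with hq
  have hwp : hat w p = a - 1 := hat_hat_inv _ _
  have hwq : hat w q = a := hat_hat_inv _ _
  have hpn := Int.emod_add_mul_ediv p n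
  have hp0 := Int.emod_nonneg p (val_pos (n := n)).ne'
  have hp1 := Int.emod_lt_of_pos p (val_pos (n := n))
  have e1 : p % n = p + n * (-(p / n)) := by linarith
  have e2 : q - n * (p / n) = q + n * (-(p / n)) := by ring
  have f1 : hat w (p % n) = a - 1 + n * (-(p / n)) := by rw [e1, hat_periodic, hwp]
  have f2 : hat w (q - n * (p / n)) = a + n * (-(p / n)) := by rw [e2, hat_periodic, hwq]
  refine ⟨(p % n, q - n * (p / n)), ?_, ?_⟩
  · rintro ⟨-, -, -, h3⟩
    dsimp only at h3
    rw [f1, f2] at h3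
    omega
  · ext ⟨x, y⟩
    simp only [inversions, Set.mem_ofPred_eq, Set.mem_insert_iff, Prod.mk.injEq, hat_mul]
    constructor
    · rintro ⟨h0, h1, h2, h3⟩
      rcases hat_simpleRefl_lt i (x := hat w x) (y := hat w y)
        (fun e => h2.ne (hat_injective _ e)) with h4 | ⟨h4, h5⟩ | ⟨h4, h5⟩
      · exact Or.inr ⟨h0, h1, h2, h4.1 h3⟩
      · left
        rw [← ha] at h4
        obtain ⟨m, hm⟩ := eq_add_of_res_eq h4
        have hx : x = p + n * m := by
          apply hat_injective w; rw [hat_periodic, hwp]; linarith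
        have hy : y = q + n * m := by
          apply hat_injective w; rw [hat_periodic, hwq]; linarith
        have hm' : m = -(p / n) := by
          have : (p % n : ℤ) = p % n + n * (p / n + m) := by
            have h6 : (x : ℤ) % n = p % n := by rw [hx, Int.add_mul_emod_self_left]
            rw [Int.emod_eq_of_lt h0 h1] at h6
            rw [← h6, hx]; linarith
          have : (n : ℤ) * (p / n + m) = 0 := by linarith
          rcases mul_eq_zero.1 this with h | h
          · exact absurd h (val_pos (n := n)).ne'
          · linarith
        subst hm'
        exact ⟨by rw [hx, e1], by rw [hy, e2]⟩
      · exfalso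
        rw [← ha] at h4
        obtain ⟨m, hm⟩ := eq_add_of_res_eq h4
        have hx : x = q + n * m := by
          apply hat_injective w; rw [hat_periodic, hwq]; linarith
        have hy : y = p + n * m := by
          apply hat_injective w; rw [hat_periodic, hwp]; linarith
        omega
    · rintro (⟨rfl, rfl⟩ | ⟨h0, h1, h2, h3⟩)
      · refine ⟨hp0, hp1, by omega, ?_⟩
        rw [f1, f2, hat_periodic, hat_periodic, hat_simpleRefl_self ha, hat_simpleRefl_pred ha]
        omega
      · refine ⟨h0, h1, h2, ?_⟩
        rcases hat_simpleRefl_lt i (x := hat w x) (y := hat w y)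
          (fun e => h2.ne (hat_injective _ e)) with h4 | ⟨h4, h5⟩ | ⟨h4, h5⟩
        · exact h4.2 h3
        · omega
        · exfalso
          rw [← ha] at h4
          obtain ⟨m, hm⟩ := eq_add_of_res_eq h4
          have hx : x = q + n * m := by
            apply hat_injective w; rw [hat_periodic, hwq]; linarith
          have hy : y = p + n * m := by
            apply hat_injective w; rw [hat_periodic, hwp]; linarith
          omega

theorem len_simpleRefl_mul {i : SimpleIdx n} {w : Weyl n} (h : ¬ Desc i w) :
    len (simpleRefl n i * w) = len w + 1 := by
  obtain ⟨p, hp, e⟩ := inversions_simpleRefl_mul h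
  rw [len_eq_ncard_inversions, len_eq_ncard_inversions, e,
    Set.ncard_insert_of_notMem hp (inversions_finite w)]

theorem len_simpleRefl_mul_of_desc {i : SimpleIdx n} {w : Weyl n} (h : Desc i w) :
    len w = len (simpleRefl n i * w) + 1 := by
  rw [← len_simpleRefl_mul, simpleRefl_mul_cancel]
  rw [desc_simpleRefl_mul]; exact not_not_intro h

theorem len_omegaW_mul (w : Weyl n) : len (omegaW n * w) = len w := by
  rw [len_eq_ncard_inversions, len_eq_ncard_inversions]
  congr 1
  refine Set.ext fun p => ?_
  simp [inversions, hat_mul, hat_omegaW]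

theorem len_omegaW_zpow (k : ℤ) : len (omegaW n ^ k) = 0 := by
  rw [len_eq_ncard_inversions, ← Set.ncard_empty (ℤ × ℤ)]
  congr 1
  refine Set.ext fun p => ?_
  simp only [inversions, hat_omegaW_zpow, Set.mem_ofPred_eq, Set.mem_empty_iff_false, iff_false]
  omega

/-- An element without descents is a strictly increasing affine permutation, that is, a shift. -/
theorem eq_omegaW_zpow_of_forall_not_desc {w : Weyl n} (h : ∀ i, ¬ Desc i w) :
    ∃ k : ℤ, w = omegaW n ^ k := by
  have hmono : ∀ a, hat w⁻¹ a < hat w⁻¹ (a + 1) := by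
    intro a
    rcases Nat.lt_or_ge n 2 with hn | hn
    -- for `n = 1` there are no simple reflections, and periodicity alone gives monotonicity
    · have h1 : n = 1 := by have := NeZero.pos n; omega
      have := hat_periodic w⁻¹ a 1
      have h2 : (n : ℤ) = 1 := by omega
      have h3 : a + n * 1 = a + 1 := by omega
      rw [h3] at this
      omega
    · have := (not_desc_iff (i := ⟨res n (a + 1), hn⟩) rfl w).1 (h _)
      rwa [add_sub_cancel_right] at this
  have hs : StrictMono (hat w⁻¹) := strictMono_int_of_lt_succ hmono
  have hstep : ∀ a, hat w⁻¹ (a + 1) = hat w⁻¹ a + 1 := by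
    intro a
    have h1 := hmono a
    by_contra h2
    have h3 := hat_inv_hat w (hat w⁻¹ a + 1)
    have h4 : a < hat w (hat w⁻¹ a + 1) := by rw [← hs.lt_iff_lt]; omega
    have h5 : hat w (hat w⁻¹ a + 1) < a + 1 := by rw [← hs.lt_iff_lt]; omega
    omega
  have hshift : ∀ a, hat w⁻¹ a = hat w⁻¹ 0 + a := by
    intro a
    induction a using Int.induction_on with
    | zero => simp
    | succ k ih => rw [hstep, ih]; ring
    | pred k ih => have := hstep (-k - 1); rw [sub_add_cancel, ih] at this; linarith
  refine ⟨hat w⁻¹ 0, hat_ext fun a => ?_⟩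
  rw [hat_omegaW_zpow]
  have := hshift (hat w a)
  rw [hat_inv_hat] at this
  linarith

/-! ### Relations between the generators of the Hecke algebra -/

theorem HU_mul_self (i : SimpleIdx n) :
    (HU n i : Hecke n) * HU n i = 1 + (vinv - v) • (HU n i : Hecke n) := by
  have h := quad_aux n i
  change (HU n i : Hecke n) * HU n i + (v - vinv) • (HU n i : Hecke n) = 1 at h
  rw [← h, ← neg_sub v vinv, neg_smul]
  abel

/-- Distinct cyclically non-adjacent indices are at distance strictly between `1` and `n - 1`. -/
theorem dist_of_not_adjacent {i j : Fin n} (h0 : i ≠ j) (h1 : j ≠ i + 1) (h2 : i ≠ j + 1) :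
    ((i : ℕ) + 1 < j ∧ (j : ℕ) - i < n - 1) ∨ ((j : ℕ) + 1 < i ∧ (i : ℕ) - j < n - 1) := by
  have key : ∀ {i j : Fin n}, (i : ℕ) < j → j ≠ i + 1 → i ≠ j + 1 →
      (i : ℕ) + 1 < j ∧ (j : ℕ) - i < n - 1 := by
    intro i j hij h1 h2
    have hj := j.2
    have e1 : (j : ℕ) ≠ i + 1 := by
      intro h; apply h1; apply Fin.ext
      rw [Fin.val_add, Fin.val_one', Nat.add_mod_mod, Nat.mod_eq_of_lt (by omega), h]
    have e2 : ¬ ((i : ℕ) = 0 ∧ (j : ℕ) + 1 = n) := by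
      rintro ⟨h3, h4⟩; apply h2; apply Fin.ext
      rw [Fin.val_add, Fin.val_one', Nat.add_mod_mod, h4, Nat.mod_self, h3]
    omega
  rcases lt_or_gt_of_ne fun h => h0 (Fin.ext h) with h | h
  · exact Or.inl (key h h1 h2)
  · exact Or.inr (key h h2 h1)

theorem HU_comm_far {i j : SimpleIdx n} (h0 : i.1 ≠ j.1) (h1 : j.1 ≠ i.1 + 1)
    (h2 : i.1 ≠ j.1 + 1) : HU n i * HU n j = HU n j * HU n i := by
  apply Units.ext
  rcases dist_of_not_adjacent h0 h1 h2 with ⟨h3, h4⟩ | ⟨h3, h4⟩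
  · have := hq_rel n (HRel.comm i j h3 h4)
    rw [map_mul, map_mul] at this
    exact this
  · have := hq_rel n (HRel.comm j i h3 h4)
    rw [map_mul, map_mul] at this
    exact this.symm

theorem HU_braid (hn : 3 ≤ n) {i j : SimpleIdx n} (hj : j.1 = i.1 + 1) :
    HU n i * HU n j * HU n i = HU n j * HU n i * HU n j := by
  apply Units.ext
  have := hq_rel n (HRel.braid hn i j hj)
  rw [map_mul, map_mul, map_mul, map_mul] at this
  exact this

theorem omU_mul_HU {i j : SimpleIdx n} (hj : j.1 = i.1 - 1) :
    omU n * HU n i = HU n j * omU n := by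
  rw [← mul_inv_eq_iff_eq_mul]
  apply Units.ext
  have := hq_rel n (HRel.conj i j hj)
  rw [map_mul, map_mul] at this
  exact this

/-! ### Reduced expressions and Matsumoto's theorem -/

theorem wordU_cons (i : SimpleIdx n) (l : List (SimpleIdx n)) (k : ℤ) :
    wordU n (i :: l) k = HU n i * wordU n l k := by
  simp [wordU, mul_assoc]

theorem len_simpleRefl_mul_le (i : SimpleIdx n) (w : Weyl n) :
    len (simpleRefl n i * w) ≤ len w + 1 := by
  by_cases h : Desc i w
  · have := len_simpleRefl_mul_of_desc h; omega
  · exact (len_simpleRefl_mul h).le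

theorem len_word_le (l : List (SimpleIdx n)) (k : ℤ) :
    len ((l.map (simpleRefl n)).prod * omegaW n ^ k) ≤ l.length := by
  induction l with
  | nil => simp [len_omegaW_zpow]
  | cons i l ih =>
    rw [List.map_cons, List.prod_cons, mul_assoc, List.length_cons]
    exact (len_simpleRefl_mul_le _ _).trans (by omega)

theorem IsReducedExpr.cons {w : Weyl n} {l : List (SimpleIdx n)} {k : ℤ} {i : SimpleIdx n}
    (h : IsReducedExpr n w l k) (hd : ¬ Desc i w) :
    IsReducedExpr n (simpleRefl n i * w) (i :: l) k := by
  refine ⟨?_, ?_⟩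
  · rw [List.map_cons, List.prod_cons, mul_assoc, ← h.1]
  · rw [len_simpleRefl_mul hd, List.length_cons, h.2]

theorem IsReducedExpr.cons_of_desc {w : Weyl n} {l : List (SimpleIdx n)} {k : ℤ} {i : SimpleIdx n}
    (h : IsReducedExpr n (simpleRefl n i * w) l k) (hd : Desc i w) :
    IsReducedExpr n w (i :: l) k := by
  have := h.cons (i := i) (by rw [desc_simpleRefl_mul]; exact not_not_intro hd)
  rwa [simpleRefl_mul_cancel] at this

theorem IsReducedExpr.of_cons {w : Weyl n} {l : List (SimpleIdx n)} {k : ℤ} {i : SimpleIdx n}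
    (h : IsReducedExpr n w (i :: l) k) :
    Desc i w ∧ IsReducedExpr n (simpleRefl n i * w) l k := by
  obtain ⟨h1, h2⟩ := h
  rw [List.map_cons, List.prod_cons, mul_assoc] at h1
  rw [List.length_cons] at h2
  have h3 : simpleRefl n i * w = (l.map (simpleRefl n)).prod * omegaW n ^ k := by
    rw [h1, simpleRefl_mul_cancel]
  have h4 := len_word_le l k
  rw [← h3] at h4
  have hd : Desc i w := by
    by_contra hd
    rw [len_simpleRefl_mul hd] at h4
    omega
  refine ⟨hd, h3, ?_⟩
  have := len_simpleRefl_mul_of_desc hd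
  omega

theorem exists_isReducedExpr (w : Weyl n) : ∃ l k, IsReducedExpr n w l k := by
  induction h : len w using Nat.strong_induction_on generalizing w with
  | _ m ih =>
    subst h
    by_cases hd : ∃ i, Desc i w
    · obtain ⟨i, hi⟩ := hd
      obtain ⟨l, k, hl⟩ := ih _ (by have := len_simpleRefl_mul_of_desc hi; omega)
        (simpleRefl n i * w) rfl
      exact ⟨i :: l, k, hl.cons_of_desc hi⟩
    · obtain ⟨k, rfl⟩ := eq_omegaW_zpow_of_forall_not_desc (not_exists.1 hd)
      exact ⟨[], k, by simp, by rw [len_omegaW_zpow]; rfl⟩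

/-- The step of Matsumoto's theorem for two reduced expressions which start with `s_i` and
`s_{i+1}`: both can be replaced by expressions which start with the two sides of the braid
relation. -/
theorem wordU_eq_of_adjacent (hn : 3 ≤ n) {i j : SimpleIdx n} (hj : j.1 = i.1 + 1) {w : Weyl n}
    (ih : ∀ w' : Weyl n, len w' < len w → ∀ l k l' k', IsReducedExpr n w' l k →
      IsReducedExpr n w' l' k' → wordU n l k = wordU n l' k')
    {l l' : List (SimpleIdx n)} {k k' : ℤ} (h : IsReducedExpr n w (i :: l) k)
    (h' : IsReducedExpr n w (j :: l') k') : wordU n (i :: l) k = wordU n (j :: l') k' := by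
  obtain ⟨d1, r1⟩ := h.of_cons
  obtain ⟨d2, r2⟩ := h'.of_cons
  have d3 := desc_mul_of_desc_adjacent hj hn d1 d2
  have d4 := (desc_mul_mul_adjacent' hj hn w).2 d2
  have d5 := (desc_swap_adjacent hj hn w).2 d3
  have d6 := (desc_mul_mul_adjacent hj hn w).2 d1
  obtain ⟨m, q, r3⟩ := exists_isReducedExpr
    (simpleRefl n i * (simpleRefl n j * (simpleRefl n i * w)))
  have r4 : IsReducedExpr n (simpleRefl n j * (simpleRefl n i * (simpleRefl n j * w))) m q := by
    have := simpleRefl_braid hj hn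
    simp only [← mul_assoc] at r3 ⊢
    rwa [← this]
  have r5 := (r3.cons_of_desc d4).cons_of_desc d3
  have r6 := (r4.cons_of_desc d6).cons_of_desc d5
  have l1 := len_simpleRefl_mul_of_desc d1
  have l2 := len_simpleRefl_mul_of_desc d2
  rw [wordU_cons, wordU_cons, ih _ (by omega) _ _ _ _ r1 r5, ih _ (by omega) _ _ _ _ r2 r6]
  simp only [wordU_cons, ← mul_assoc]
  rw [HU_braid hn hj]

/-- Matsumoto's theorem: all reduced expressions of `w` give the same element. -/
theorem wordU_eq_of_isReducedExpr {w : Weyl n} {l l' : List (SimpleIdx n)} {k k' : ℤ}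
    (h : IsReducedExpr n w l k) (h' : IsReducedExpr n w l' k') :
    wordU n l k = wordU n l' k' := by
  induction hm : len w using Nat.strong_induction_on generalizing w l k l' k' with
  | _ m ih =>
    subst hm
    match l, l', h, h' with
    | [], [], h, h' =>
      have h1 := h.1.symm.trans h'.1
      have h2 := congrArg (fun x => hat x 0) h1
      simp [hat_omegaW_zpow] at h2
      rw [h2]
    | [], j :: l', h, h' => have := h.2.trans h'.2.symm; simp at this
    | i :: l, [], h, h' => have := h.2.trans h'.2.symm; simp at this
    | i :: l, j :: l', h, h' =>
      obtain ⟨d1, r1⟩ := h.of_cons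
      obtain ⟨d2, r2⟩ := h'.of_cons
      have l1 := len_simpleRefl_mul_of_desc d1
      have l2 := len_simpleRefl_mul_of_desc d2
      by_cases hij : i = j
      · subst hij
        rw [wordU_cons, wordU_cons, ih _ (by omega) r1 r2 rfl]
      have hij' : i.1 ≠ j.1 := fun h => hij (Subtype.ext h)
      have hn : 3 ≤ n := by
        by_contra hn
        exact not_desc_of_two (by have := i.2; omega) hij d1 d2
      by_cases h1 : j.1 = i.1 + 1
      · exact wordU_eq_of_adjacent hn h1 (fun w' hw' _ _ _ _ h h' => ih _ hw' h h' rfl) h h'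
      by_cases h2 : i.1 = j.1 + 1
      · exact (wordU_eq_of_adjacent hn h2
          (fun w' hw' _ _ _ _ h h' => ih _ hw' h h' rfl) h' h).symm
      have d3 := (desc_simpleRefl_mul_far hij' h1 h2 w).2 d2
      have d4 := (desc_simpleRefl_mul_far hij'.symm h2 h1 w).2 d1
      obtain ⟨m, q, r3⟩ := exists_isReducedExpr (simpleRefl n j * (simpleRefl n i * w))
      have r4 : IsReducedExpr n (simpleRefl n i * (simpleRefl n j * w)) m q := by
        rw [← mul_assoc] at r3 ⊢
        rwa [simpleRefl_comm_far hij' h1 h2]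
      rw [wordU_cons, wordU_cons, ih _ (by omega) r1 (r3.cons_of_desc d3) rfl,
        ih _ (by omega) r2 (r4.cons_of_desc d4) rfl, wordU_cons, wordU_cons,
        ← mul_assoc, ← mul_assoc, HU_comm_far hij' h1 h2]

/-! ### The elements `H_w` -/

theorem HwU_eq_wordU {w : Weyl n} {l : List (SimpleIdx n)} {k : ℤ}
    (h : IsReducedExpr n w l k) : HwU n w = wordU n l k := by
  have hex : ∃ p : List (SimpleIdx n) × ℤ, IsReducedExpr n w p.1 p.2 := ⟨(l, k), h⟩
  rw [HwU, dif_pos hex]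
  exact wordU_eq_of_isReducedExpr hex.choose_spec h

theorem HwU_simpleRefl_mul {i : SimpleIdx n} {w : Weyl n} (hd : ¬ Desc i w) :
    HwU n (simpleRefl n i * w) = HU n i * HwU n w := by
  obtain ⟨l, k, h⟩ := exists_isReducedExpr w
  rw [HwU_eq_wordU h, HwU_eq_wordU (h.cons hd), wordU_cons]

theorem HwU_of_desc {i : SimpleIdx n} {w : Weyl n} (hd : Desc i w) :
    HwU n w = HU n i * HwU n (simpleRefl n i * w) := by
  rw [← HwU_simpleRefl_mul, simpleRefl_mul_cancel]
  rw [desc_simpleRefl_mul]; exact not_not_intro hd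

theorem HU_mul_HwU_of_desc {i : SimpleIdx n} {w : Weyl n} (hd : Desc i w) :
    (HU n i * HwU n w : Hecke n) =
      HwU n (simpleRefl n i * w) + (vinv - v) • (HwU n w : Hecke n) := by
  rw [HwU_of_desc hd, Units.val_mul, ← mul_assoc, HU_mul_self, add_mul, one_mul, smul_mul_assoc]

theorem HwU_omegaW_zpow (k : ℤ) : HwU n (omegaW n ^ k) = omU n ^ k := by
  rw [HwU_eq_wordU (l := []) (k := k) ⟨by simp, by rw [len_omegaW_zpow]; rfl⟩]
  simp [wordU]

theorem HwU_one : HwU n (1 : Weyl n) = 1 := by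
  simpa using HwU_omegaW_zpow (n := n) 0

/-- Conjugation by `ω` shifts the indices of a reduced expression, in `W` as well as in the Hecke
algebra. -/
theorem HwU_omegaW_mul (w : Weyl n) : HwU n (omegaW n * w) = omU n * HwU n w := by
  let sh : SimpleIdx n → SimpleIdx n := fun i => ⟨i.1 - 1, i.2⟩
  obtain ⟨l, k, h⟩ := exists_isReducedExpr w
  have h1 : omegaW n * (l.map (simpleRefl n)).prod =
      ((l.map sh).map (simpleRefl n)).prod * omegaW n := by
    clear h
    induction l with
    | nil => simp
    | cons i l ih =>
      simp only [List.map_cons, List.prod_cons]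
      rw [← mul_assoc, omega_mul_simpleRefl (j := sh i) rfl, mul_assoc, ih, mul_assoc]
  have h2 : omU n * (l.map (HU n)).prod = ((l.map sh).map (HU n)).prod * omU n := by
    clear h h1
    induction l with
    | nil => simp
    | cons i l ih =>
      simp only [List.map_cons, List.prod_cons]
      rw [← mul_assoc, omU_mul_HU (j := sh i) rfl, mul_assoc, ih, mul_assoc]
  have h3 : IsReducedExpr n (omegaW n * w) (l.map sh) (1 + k) := by
    refine ⟨?_, ?_⟩
    · rw [h.1, ← mul_assoc, h1, zpow_one_add, mul_assoc]
    · rw [len_omegaW_mul, List.length_map, h.2]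
  rw [HwU_eq_wordU h, HwU_eq_wordU h3, wordU, wordU, ← mul_assoc, h2, zpow_one_add, mul_assoc]

/-! ### The regular representation and linear independence -/

/-- The free module with basis `(δ_w)_{w ∈ W}`, on which the Hecke algebra acts as it does on itself
by left multiplication, `δ_w` standing for `H_w`. -/
abbrev RegMod (n : ℕ) : Type := Weyl n →₀ LL

open Classical in
/-- The operator of left multiplication by `H_i`: `H_i δ_w = δ_{s_i w}` if `ℓ(s_i w) > ℓ(w)`, and
`H_i δ_w = δ_{s_i w} + (v⁻¹ - v) δ_w` otherwise. -/
noncomputable def opH (i : SimpleIdx n) : Module.End LL (RegMod n) :=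
  Finsupp.linearCombination LL fun w => Finsupp.single (simpleRefl n i * w) 1 +
    if Desc i w then Finsupp.single w (vinv - v) else 0

/-- The operator of left multiplication by a length zero element. -/
noncomputable def opShift (x : Weyl n) : Module.End LL (RegMod n) :=
  Finsupp.linearCombination LL fun w => Finsupp.single (x * w) 1

theorem opH_of_desc {i : SimpleIdx n} {w : Weyl n} (h : Desc i w) :
    opH i (Finsupp.single w 1) =
      Finsupp.single (simpleRefl n i * w) 1 + (vinv - v) • Finsupp.single w 1 := by
  simp [opH, h]

theorem opH_of_not_desc {i : SimpleIdx n} {w : Weyl n} (h : ¬ Desc i w) :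
    opH i (Finsupp.single w 1) = Finsupp.single (simpleRefl n i * w) 1 := by
  simp [opH, h]

theorem opShift_single {n : ℕ} (x w : Weyl n) :
    opShift x (Finsupp.single w 1) = Finsupp.single (x * w) 1 := by
  simp [opShift]

theorem end_ext {n : ℕ} {f g : Module.End LL (RegMod n)}
    (h : ∀ w, f (Finsupp.single w 1) = g (Finsupp.single w 1)) : f = g :=
  Finsupp.lhom_ext' fun w => LinearMap.ext_ring (h w)

theorem opH_quad (i : SimpleIdx n) : opH i * opH i = 1 + (vinv - v) • opH i := by
  refine end_ext fun w => ?_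
  simp only [Module.End.mul_apply, LinearMap.add_apply, Module.End.one_apply, LinearMap.smul_apply]
  have hd := desc_simpleRefl_mul i w
  by_cases h : Desc i w
  · have h1 : ¬ Desc i (simpleRefl n i * w) := by rw [hd]; exact not_not_intro h
    rw [opH_of_desc h, map_add, map_smul, opH_of_desc h, opH_of_not_desc h1, simpleRefl_mul_cancel]
  · rw [opH_of_not_desc h, opH_of_desc (hd.2 h), simpleRefl_mul_cancel]

theorem opH_comm {i j : SimpleIdx n} (h0 : i.1 ≠ j.1) (h1 : j.1 ≠ i.1 + 1) (h2 : i.1 ≠ j.1 + 1) :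
    opH i * opH j = opH j * opH i := by
  refine end_ext fun w => ?_
  simp only [Module.End.mul_apply]
  have hd := desc_simpleRefl_mul_far h0 h1 h2 w
  have hd' := desc_simpleRefl_mul_far h0.symm h2 h1 w
  have hs := simpleRefl_comm_far h0 h1 h2
  by_cases hi : Desc i w <;> by_cases hj : Desc j w <;>
  simp only [hi, hj, iff_true, iff_false] at hd hd' <;>
  simp only [opH_of_desc, opH_of_not_desc, hi, hj, hd, hd', map_add, map_smul,
    not_false_eq_true] <;>
  simp only [← mul_assoc, hs]
  module

/-- The braid relation is checked on each `δ_w`. The order in which `w⁻¹` arranges the three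
neighbours moved by `s_i` and `s_{i+1}` determines all descents which occur. -/
theorem opH_braid (hn : 3 ≤ n) {i j : SimpleIdx n} (hj : j.1 = i.1 + 1) :
    opH i * opH j * opH i = opH j * opH i * opH j := by
  refine end_ext fun w => ?_
  simp only [Module.End.mul_apply]
  have hs := simpleRefl_braid hj hn
  have d1 := desc_simpleRefl_mul i w
  have d2 := desc_simpleRefl_mul j w
  have d3 := desc_swap_adjacent hj hn w
  have d4 := desc_mul_mul_adjacent hj hn w
  have d5 := desc_mul_mul_adjacent' hj hn w
  have d6 := @desc_mul_of_desc_adjacent n _ i j hj hn w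
  have d7 := @not_desc_mul_of_not_desc_adjacent n _ i j hj hn w
  have hii := simpleRefl_mul_cancel i w
  have hjj := simpleRefl_mul_cancel j w
  have hs' : simpleRefl n i * (simpleRefl n j * (simpleRefl n i * w)) =
      simpleRefl n j * (simpleRefl n i * (simpleRefl n j * w)) := by
    simp only [← mul_assoc, hs]
  by_cases hi : Desc i w <;> by_cases hj : Desc j w <;>
  by_cases hk : Desc j (simpleRefl n i * w) <;>
  simp only [hi, hj, hk, iff_true, iff_false, not_true_eq_false, not_false_eq_true,
    true_implies, false_implies] at d1 d2 d3 d4 d5 d6 d7 <;>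
  simp only [opH_of_desc, opH_of_not_desc, hi, hj, hk, d1, d2, d3, d4, d5, map_add, map_smul,
    not_false_eq_true, hs', hii, hjj, smul_add, smul_smul] <;>
  module

theorem opShift_mul {n : ℕ} (x y : Weyl n) : opShift x * opShift y = opShift (x * y) := by
  refine end_ext fun w => ?_
  simp only [Module.End.mul_apply, opShift_single, mul_assoc]

theorem opShift_one {n : ℕ} : opShift (1 : Weyl n) = 1 := by
  refine end_ext fun w => ?_
  simp only [opShift_single, one_mul, Module.End.one_apply]

theorem opShift_mul_opH {i j : SimpleIdx n} (hj : j.1 = i.1 - 1) :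
    opShift (omegaW n) * opH i = opH j * opShift (omegaW n) := by
  refine end_ext fun w => ?_
  have hd := desc_omegaW_mul hj w
  have hs := omega_mul_simpleRefl hj
  simp only [Module.End.mul_apply]
  by_cases h : Desc i w
  · rw [opH_of_desc h, map_add, map_smul, opShift_single, opShift_single, opH_of_desc (hd.2 h),
      ← mul_assoc, ← mul_assoc, hs]
  · rw [opH_of_not_desc h, opShift_single, opShift_single, opH_of_not_desc (by rwa [hd]),
      ← mul_assoc, ← mul_assoc, hs]

/-- The images of the generators in the regular representation. -/
noncomputable def opGen : HGen n → Module.End LL (RegMod n)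
  | .H i => opH i
  | .om => opShift (omegaW n)
  | .omInv => opShift (omegaW n)⁻¹

/-- The operators satisfy the defining relations of the Hecke algebra. -/
theorem opGen_rel {a b : HFree n} (h : HRel n a b) :
    FreeAlgebra.lift LL opGen a = FreeAlgebra.lift LL opGen b := by
  cases h with
  | om_omInv => simp [fOm, fOmInv, opGen, opShift_mul, opShift_one]
  | omInv_om => simp [fOm, fOmInv, opGen, opShift_mul, opShift_one]
  | comm i j h1 h2 =>
    simp only [fH, map_mul, FreeAlgebra.lift_ι_apply, opGen]
    refine opH_comm (fun h => ?_) (fun h => ?_) (fun h => ?_)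
    · rw [h] at h1; omega
    · have h3 := congrArg Fin.val h
      rw [Fin.val_add, Fin.val_one', Nat.add_mod_mod, Nat.mod_eq_of_lt (h1.trans j.1.2)] at h3
      omega
    · have h3 := congrArg Fin.val h
      rw [Fin.val_add, Fin.val_one', Nat.add_mod_mod] at h3
      have hj := j.1.2
      rcases Nat.lt_or_ge ((j.1 : ℕ) + 1) n with h4 | h4
      · rw [Nat.mod_eq_of_lt h4] at h3; omega
      · rw [Nat.mod_eq_sub_mod h4, Nat.mod_eq_of_lt (by omega)] at h3; omega
  | braid hn i j hj =>
    simp only [fH, map_mul, FreeAlgebra.lift_ι_apply, opGen]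
    exact opH_braid hn hj
  | conj i j hj =>
    simp only [fH, fOm, fOmInv, map_mul, FreeAlgebra.lift_ι_apply, opGen]
    rw [opShift_mul_opH hj, mul_assoc, opShift_mul, mul_inv_cancel, opShift_one, mul_one]
  | quad i =>
    simp only [fH, map_mul, map_add, map_sub, AlgHom.commutes, FreeAlgebra.lift_ι_apply, opGen,
      map_zero]
    refine end_ext fun w => ?_
    have h := LinearMap.congr_fun (opH_quad i) (Finsupp.single w 1)
    simp only [Module.End.mul_apply, LinearMap.add_apply, Module.End.one_apply,
      LinearMap.smul_apply, LinearMap.sub_apply, Module.algebraMap_end_apply, map_sub, map_smul,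
      LinearMap.zero_apply] at h ⊢
    rw [h, smul_add, smul_smul, mul_comm vinv, v_mul_vinv]
    module

/-- The regular representation. -/
noncomputable def regRep (n : ℕ) [NeZero n] : Hecke n →ₐ[LL] Module.End LL (RegMod n) :=
  RingQuot.liftAlgHom LL ⟨FreeAlgebra.lift LL opGen, fun _ _ h => opGen_rel h⟩

theorem regRep_HU (i : SimpleIdx n) : regRep n (HU n i) = opH i := by
  change RingQuot.liftAlgHom LL _ (RingQuot.mkAlgHom LL (HRel n) (fH i)) = _
  rw [RingQuot.liftAlgHom_mkAlgHom_apply, fH, FreeAlgebra.lift_ι_apply]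
  rfl

theorem regRep_omU : regRep n (omU n) = opShift (omegaW n) := by
  change RingQuot.liftAlgHom LL _ (RingQuot.mkAlgHom LL (HRel n) (fOm n)) = _
  rw [RingQuot.liftAlgHom_mkAlgHom_apply, fOm, FreeAlgebra.lift_ι_apply]
  rfl

theorem regRep_omU_zpow (k : ℤ) : regRep n (omU n ^ k : (Hecke n)ˣ) = opShift (omegaW n ^ k) := by
  have hinv : regRep n ((omU n)⁻¹ : (Hecke n)ˣ) = opShift (omegaW n)⁻¹ := by
    change RingQuot.liftAlgHom LL _ (RingQuot.mkAlgHom LL (HRel n) (fOmInv n)) = _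
    rw [RingQuot.liftAlgHom_mkAlgHom_apply, fOmInv, FreeAlgebra.lift_ι_apply]
    rfl
  induction k using Int.induction_on with
  | zero => simp [opShift_one]
  | succ k ih =>
    rw [zpow_add_one, Units.val_mul, map_mul, ih, regRep_omU, opShift_mul, zpow_add_one]
  | pred k ih => rw [zpow_sub_one, Units.val_mul, map_mul, ih, hinv, opShift_mul, zpow_sub_one]

/-- `H_w` maps `δ_1` to `δ_w`. -/
theorem regRep_HwU (w : Weyl n) :
    regRep n (HwU n w) (Finsupp.single 1 1) = Finsupp.single w 1 := by
  induction h : len w using Nat.strong_induction_on generalizing w with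
  | _ m ih =>
    subst h
    by_cases hd : ∃ i, Desc i w
    · obtain ⟨i, hi⟩ := hd
      rw [HwU_of_desc hi, Units.val_mul, map_mul, Module.End.mul_apply,
        ih _ (by have := len_simpleRefl_mul_of_desc hi; omega) _ rfl, regRep_HU,
        opH_of_not_desc (by rw [desc_simpleRefl_mul]; exact not_not_intro hi),
        simpleRefl_mul_cancel]
    · obtain ⟨k, rfl⟩ := eq_omegaW_zpow_of_forall_not_desc (not_exists.1 hd)
      rw [HwU_omegaW_zpow, regRep_omU_zpow, opShift_single, mul_one]

theorem linearIndependent_HwU : LinearIndependent LL fun w : Weyl n => (HwU n w : Hecke n) := by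
  have h : LinearIndependent LL fun w : Weyl n => (Finsupp.single w 1 : RegMod n) :=
    Finsupp.linearIndependent_single_one LL _
  refine LinearIndependent.of_comp
    ((LinearMap.applyₗ (Finsupp.single 1 1 : RegMod n)) ∘ₗ (regRep n).toLinearMap) ?_
  convert h using 2 with w
  exact regRep_HwU w

/-! ### The bases of `H_f` and of `H^pol` -/

theorem mul_mem_of_mem_adjoin {R A : Type*} [CommSemiring R] [Semiring A] [Algebra R A] {s : Set A}
    {M : Submodule R A} (hs : ∀ g ∈ s, ∀ x ∈ M, g * x ∈ M) {a : A}
    (ha : a ∈ Algebra.adjoin R s) : ∀ x ∈ M, a * x ∈ M := by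
  induction ha using Algebra.adjoin_induction with
  | mem g hg => exact hs g hg
  | algebraMap r => intro x hx; rw [← Algebra.smul_def]; exact M.smul_mem r hx
  | add a b _ _ h1 h2 => intro x hx; rw [add_mul]; exact M.add_mem (h1 x hx) (h2 x hx)
  | mul a b _ _ h1 h2 => intro x hx; rw [mul_assoc]; exact h1 _ (h2 x hx)

/-- The degree `-(τ_1 + ⋯ + τ_n)` of `t_τ π`, the homomorphism to `ℤ` which sends `ω` to `1` and
`s_1, …, s_{n-1}` to `0`. -/
def deg (w : Weyl n) : ℤ := -∑ i, w.left.toAdd i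

theorem deg_mul {n : ℕ} (w w' : Weyl n) : deg (w * w') = deg w + deg w' := by
  have h : ∀ i, (w * w').left.toAdd i = w.left.toAdd i + w'.left.toAdd (w.right⁻¹ i) := fun _ => rfl
  simp only [deg, h, Finset.sum_add_distrib]
  rw [Equiv.sum_comp w.right⁻¹ fun i => w'.left.toAdd i]
  ring

theorem deg_omegaW : deg (omegaW n) = 1 := by
  have h : ∀ i, (omegaW n).left.toAdd i = -(Pi.single (-1) 1 : Lattice n) i := by
    intro i
    simp [omegaW, transl, ofPerm]
  simp [deg, h]

theorem deg_omegaW_inv_mul (w : Weyl n) : deg ((omegaW n)⁻¹ * w) = deg w - 1 := by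
  have := deg_mul (omegaW n) ((omegaW n)⁻¹ * w)
  rw [mul_inv_cancel_left, deg_omegaW] at this
  omega

theorem simpleRefl_of_ne_zero {i : SimpleIdx n} (hi : i.1 ≠ 0) :
    simpleRefl n i = ofPerm (Equiv.swap (i.1 - 1) i.1) := by
  rw [simpleRefl, if_neg hi]

theorem ofPerm_mul {n : ℕ} (π π' : Equiv.Perm (Fin n)) :
    ofPerm π * ofPerm π' = ofPerm (π * π') := by
  simp [ofPerm]

theorem deg_simpleRefl {i : SimpleIdx n} (hi : i.1 ≠ 0) : deg (simpleRefl n i) = 0 := by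
  rw [simpleRefl_of_ne_zero hi]
  simp [deg, ofPerm]

theorem hat_inv_coe (w : Weyl n) (r : Fin n) :
    hat w⁻¹ (r : ℕ) = ((w.right⁻¹ r : Fin n) : ℕ) - n * w.left.toAdd r := by
  have h : ∀ i, w⁻¹.left.toAdd i = -w.left.toAdd (w.right i) := fun _ => rfl
  have h2 := coe_add_div r 0
  rw [mul_zero, add_zero] at h2
  rw [hat, res_coe, h, h2, SemidirectProduct.inv_right]
  simp
  ring

/-- `w` lies in `W^pol` if and only if `w⁻¹`, as an affine permutation, preserves the set of
nonnegative integers. -/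
theorem mem_Wpol_iff {w : Weyl n} : w ∈ Wpol n ↔ ∀ a : ℤ, 0 ≤ a → 0 ≤ hat w⁻¹ a := by
  have hn := val_pos (n := n)
  have h1 : w ∈ Wpol n ↔ ∀ r : Fin n, 0 ≤ hat w⁻¹ (r : ℕ) := by
    refine forall_congr' fun r => ?_
    rw [hat_inv_coe]
    have h := (w.right⁻¹ r).2
    constructor
    · intro h1; nlinarith
    · intro h1; by_contra h2; push Not at h2; nlinarith
  rw [h1]
  constructor
  · intro h a ha
    rw [← res_add_div (n := n) a, hat_periodic]
    have := h (res n a)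
    have : 0 ≤ a / n := Int.ediv_nonneg ha hn.le
    positivity
  · intro h r; exact h _ (by omega)

theorem ofPerm_mem_Wpol {n : ℕ} (π : Equiv.Perm (Fin n)) : ofPerm π ∈ Wpol n := fun _ => le_refl 0

theorem omegaW_mem_Wpol : omegaW n ∈ Wpol n := by
  rw [mem_Wpol_iff]
  intro a ha
  rw [hat_omegaW_inv]
  omega

/-- An element of `W^pol` which is shortest in its coset `W_f w`, and is not divisible by `ω`
from the left in `W^pol`, is trivial. -/
theorem eq_one_of_forall_not_desc {w : Weyl n} (hw : w ∈ Wpol n) (hw' : hat w⁻¹ (-1) < 0)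
    (hd : ∀ i : SimpleIdx n, i.1 ≠ 0 → ¬ Desc i w) : w = 1 := by
  rw [mem_Wpol_iff] at hw
  have h0 := hw 0 le_rfl
  have hd' : ∀ i, ¬ Desc i w := by
    intro i
    by_cases hi : i.1 = 0
    · rw [not_desc_iff (a := 0) (by simpa [hi] using res_coe i.1)]
      simp
      omega
    · exact hd i hi
  obtain ⟨k, rfl⟩ := eq_omegaW_zpow_of_forall_not_desc hd'
  rw [← zpow_neg, hat_omegaW_zpow] at hw' h0
  have : k = 0 := by omega
  rw [this, zpow_zero]

theorem HU_mem_Hf {i : SimpleIdx n} (hi : i.1 ≠ 0) : (HU n i : Hecke n) ∈ Hf n :=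
  Algebra.subset_adjoin ⟨i, hi, rfl⟩

theorem HwU_ofPerm_mem (π : Equiv.Perm (Fin n)) : (HwU n (ofPerm π) : Hecke n) ∈ Hf n := by
  induction h : len (ofPerm π) using Nat.strong_induction_on generalizing π with
  | _ m ih =>
    subst h
    by_cases hd : ∃ i : SimpleIdx n, i.1 ≠ 0 ∧ Desc i (ofPerm π)
    · obtain ⟨i, hi, hd⟩ := hd
      have hlen := len_simpleRefl_mul_of_desc hd
      rw [HwU_of_desc hd, Units.val_mul]
      rw [simpleRefl_of_ne_zero hi, ofPerm_mul] at hlen ⊢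
      exact Subalgebra.mul_mem _ (HU_mem_Hf hi) (ih _ (by omega) _ rfl)
    · push Not at hd
      have hneg : hat (ofPerm π)⁻¹ (-1) < 0 := by
        have h1 := hat_periodic (ofPerm π)⁻¹ (-1) 1
        have h2 := hat_inv_coe (ofPerm π) (-1)
        have h3 : ∀ i, (ofPerm π).left.toAdd i = 0 := fun _ => rfl
        rw [coe_neg_one, h3] at h2
        have e : (-1 + n * 1 : ℤ) = n - 1 := by ring
        rw [e, h2] at h1
        have := ((ofPerm π).right⁻¹ (-1)).2
        omega
      rw [eq_one_of_forall_not_desc (ofPerm_mem_Wpol π) hneg hd, HwU_one]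
      exact Subalgebra.one_mem _

/-- A set of `w` which is stable under left multiplication by `s_i` spans a submodule which is
stable under left multiplication by `H_i`. -/
theorem HU_mul_mem_span {ι : Type*} {f : ι → Weyl n} {i : SimpleIdx n}
    (hf : ∀ a, simpleRefl n i * f a ∈ Set.range f) {x : Hecke n}
    (hx : x ∈ Submodule.span LL (Set.range fun a => (HwU n (f a) : Hecke n))) :
    HU n i * x ∈ Submodule.span LL (Set.range fun a => (HwU n (f a) : Hecke n)) := by
  induction hx using Submodule.span_induction with
  | mem x hx =>
    obtain ⟨a, rfl⟩ := hx
    obtain ⟨b, hb⟩ := hf a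
    have hb' : (HwU n (simpleRefl n i * f a) : Hecke n) ∈
        Submodule.span LL (Set.range fun a => (HwU n (f a) : Hecke n)) := by
      rw [← hb]; exact Submodule.subset_span ⟨b, rfl⟩
    by_cases hd : Desc i (f a)
    · dsimp only
      rw [HU_mul_HwU_of_desc hd]
      exact add_mem hb' (Submodule.smul_mem _ _ (Submodule.subset_span ⟨a, rfl⟩))
    · dsimp only
      rw [← Units.val_mul, ← HwU_simpleRefl_mul hd]
      exact hb'
  | zero => rw [mul_zero]; exact zero_mem _
  | add x y _ _ h1 h2 => rw [mul_add]; exact add_mem h1 h2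
  | smul r x _ h => rw [mul_smul_comm]; exact Submodule.smul_mem _ _ h

theorem toSubmodule_Hf : Subalgebra.toSubmodule (Hf n) =
    Submodule.span LL (Set.range fun π : Equiv.Perm (Fin n) => (HwU n (ofPerm π) : Hecke n)) := by
  apply le_antisymm
  · intro x hx
    rw [← mul_one x]
    refine mul_mem_of_mem_adjoin ?_ hx 1 (Submodule.subset_span ⟨1, ?_⟩)
    · rintro _ ⟨i, hi, rfl⟩ x hx
      refine HU_mul_mem_span (fun π => ?_) hx
      rw [simpleRefl_of_ne_zero hi, ofPerm_mul]
      exact ⟨_, rfl⟩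
    · have : ofPerm (1 : Equiv.Perm (Fin n)) = 1 := map_one _
      simp only [this, HwU_one, Units.val_one]
  · rw [Submodule.span_le]
    rintro _ ⟨π, rfl⟩
    exact HwU_ofPerm_mem π

theorem Hf_le_Hpol : Hf n ≤ Hpol n := fun _ hx => Algebra.subset_adjoin (Or.inl hx)

theorem omU_mem_Hpol : (omU n : Hecke n) ∈ Hpol n := Algebra.subset_adjoin (Or.inr rfl)

theorem mem_Wpol_simpleRefl_mul {i : SimpleIdx n} (hi : i.1 ≠ 0) {w : Weyl n} (hw : w ∈ Wpol n) :
    simpleRefl n i * w ∈ Wpol n := by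
  rw [simpleRefl_of_ne_zero hi]
  exact (Wpol n).mul_mem (ofPerm_mem_Wpol _) hw

/-- The induction removes factors `s_1, …, s_{n-1}` and `ω` from the left, which decreases the
length resp. the degree and does not lead out of `W^pol`. -/
theorem HwU_mem_Hpol {w : Weyl n} (hw : w ∈ Wpol n) : (HwU n w : Hecke n) ∈ Hpol n := by
  induction h : (deg w).toNat + len w using Nat.strong_induction_on generalizing w with
  | _ m ih =>
    subst h
    by_cases hd : ∃ i : SimpleIdx n, i.1 ≠ 0 ∧ Desc i w
    · obtain ⟨i, hi, hd⟩ := hd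
      have hlen := len_simpleRefl_mul_of_desc hd
      rw [HwU_of_desc hd, Units.val_mul]
      refine Subalgebra.mul_mem _ (Hf_le_Hpol (HU_mem_Hf hi))
        (ih _ ?_ (mem_Wpol_simpleRefl_mul hi hw) rfl)
      rw [deg_mul, deg_simpleRefl hi]
      omega
    · push Not at hd
      by_cases h1 : hat w⁻¹ (-1) < 0
      · rw [eq_one_of_forall_not_desc hw h1 hd, HwU_one]
        exact Subalgebra.one_mem _
      have hw' : (omegaW n)⁻¹ * w ∈ Wpol n := by
        rw [mem_Wpol_iff] at hw ⊢
        intro a ha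
        rw [mul_inv_rev, inv_inv, hat_mul, hat_omegaW]
        rcases eq_or_lt_of_le ha with rfl | ha
        · simpa using h1
        · exact hw _ (by omega)
      have hlen : len ((omegaW n)⁻¹ * w) = len w := by
        rw [← len_omegaW_mul, mul_inv_cancel_left]
      have hdeg := deg_omegaW_inv_mul w
      have hpos : 0 ≤ deg ((omegaW n)⁻¹ * w) :=
        neg_nonneg.2 (Finset.sum_nonpos fun i _ => hw' i)
      have := HwU_omegaW_mul ((omegaW n)⁻¹ * w)
      rw [mul_inv_cancel_left] at this
      rw [this, Units.val_mul]
      exact Subalgebra.mul_mem _ omU_mem_Hpol (ih _ (by omega) hw' rfl)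

theorem Hpol_le_span : Subalgebra.toSubmodule (Hpol n) ≤
    Submodule.span LL (Set.range fun w : Wpol n => (HwU n (w : Weyl n) : Hecke n)) := by
  intro x hx
  rw [← mul_one x]
  refine mul_mem_of_mem_adjoin ?_ hx 1 (Submodule.subset_span ⟨1, ?_⟩)
  · rintro g (hg | rfl)
    · refine mul_mem_of_mem_adjoin ?_ hg
      rintro _ ⟨i, hi, rfl⟩ x hx
      exact HU_mul_mem_span (fun w => ⟨⟨_, mem_Wpol_simpleRefl_mul hi w.2⟩, rfl⟩) hx
    · intro x hx
      induction hx using Submodule.span_induction with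
      | mem x hx =>
        obtain ⟨w, rfl⟩ := hx
        dsimp only
        rw [← Units.val_mul, ← HwU_omegaW_mul]
        exact Submodule.subset_span ⟨⟨_, (Wpol n).mul_mem omegaW_mem_Wpol w.2⟩, rfl⟩
      | zero => rw [mul_zero]; exact zero_mem _
      | add x y _ _ h1 h2 => rw [mul_add]; exact add_mem h1 h2
      | smul r x _ h => rw [mul_smul_comm]; exact Submodule.smul_mem _ _ h
  · simp [HwU_one]

/-- A linearly independent family of elements of a subalgebra which spans it, as a basis. -/
theorem exists_basis_subalgebra {R A ι : Type*} [CommRing R] [Ring A] [Algebra R A]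
    (S : Subalgebra R A) {f : ι → A} (hf : LinearIndependent R f) (hmem : ∀ i, f i ∈ S)
    (hspan : Subalgebra.toSubmodule S ≤ Submodule.span R (Set.range f)) :
    ∃ b : Module.Basis ι R S, ∀ i, (b i : A) = f i := by
  let g : ι → S := fun i => ⟨f i, hmem i⟩
  have hg : LinearIndependent R g := LinearIndependent.of_comp S.val.toLinearMap hf
  have hs : ⊤ ≤ Submodule.span R (Set.range g) := by
    rintro ⟨x, hx⟩ -
    have h1 := hspan hx
    have h2 : Set.range f = S.val.toLinearMap '' Set.range g := by
      rw [← Set.range_comp]; rfl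
    rw [h2, ← Submodule.map_span] at h1
    obtain ⟨y, hy, hxy⟩ := h1
    have : y = ⟨x, hx⟩ := Subtype.ext hxy
    rwa [← this]
  refine ⟨Module.Basis.mk hg hs, fun i => ?_⟩
  rw [Module.Basis.mk_apply]

theorem exists_basis_Hpol : ∃ b : Module.Basis (Wpol n) LL (Hpol n),
    ∀ w : Wpol n, (b w : Hecke n) = HwU n (w : Weyl n) :=
  exists_basis_subalgebra _ (linearIndependent_HwU.comp _ Subtype.val_injective)
    (fun w => HwU_mem_Hpol w.2) Hpol_le_span

theorem ofPerm_injective {n : ℕ} : Function.Injective (ofPerm : Equiv.Perm (Fin n) → Weyl n) :=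
  SemidirectProduct.inr_injective

theorem exists_basis_Hf : ∃ b : Module.Basis (Equiv.Perm (Fin n)) LL (Hf n),
    ∀ π, (b π : Hecke n) = HwU n (ofPerm π) :=
  exists_basis_subalgebra _ (linearIndependent_HwU.comp _ ofPerm_injective)
    HwU_ofPerm_mem toSubmodule_Hf.le

end AffineHecke

namespace AffineHecke

/-! ### The elements `Z_i` as words in the generators -/

/-- The product `h_a h_{a+1} ⋯ h_{a+m-1}`. -/
def ascProd {G : Type*} [Monoid G] (h : ℕ → G) (a m : ℕ) : G :=
  ((List.range m).map fun j => h (a + j)).prod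

section
variable {G : Type*} [Monoid G] (h : ℕ → G) (a m : ℕ)

@[simp]
theorem ascProd_zero : ascProd h a 0 = 1 := rfl

theorem ascProd_succ : ascProd h a (m + 1) = ascProd h a m * h (a + m) := by
  simp [ascProd, List.range_succ]

theorem ascProd_succ' : ascProd h a (m + 1) = h a * ascProd h (a + 1) m := by
  simp only [ascProd, List.range_succ_eq_map, List.map_cons, List.prod_cons, List.map_map, add_zero]
  congr 3
  funext j
  simp only [Function.comp_apply]
  congr 1
  omega

end

variable {n : ℕ} [NeZero n]

/-- The index of the simple reflection which interchanges the coordinates `k` and `k + 1`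
(counted from `0`). -/
def sIdx (k : ℕ) (hk : k + 1 < n) : SimpleIdx n := ⟨⟨k + 1, hk⟩, by omega⟩

theorem sIdx_ne_zero (k : ℕ) (hk : k + 1 < n) : (sIdx k hk).1 ≠ 0 :=
  fun h => absurd (congrArg Fin.val h) (by simp [sIdx])

theorem res_sIdx (k : ℕ) (hk : k + 1 < n) : res n ((k : ℤ) + 1) = (sIdx k hk).1 := by
  rw [← res_coe (sIdx k hk).1]; rfl

/-- The simple reflection `s_{k+1}`; by convention it is `1` if `k + 1 ≥ n`. -/
def sN (n : ℕ) [NeZero n] (k : ℕ) : Weyl n :=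
  if hk : k + 1 < n then simpleRefl n (sIdx k hk) else 1

/-- The generator `H_{k+1}`, as a unit; by convention it is `1` if `k + 1 ≥ n`. -/
noncomputable def hN (n : ℕ) [NeZero n] (k : ℕ) : (Hecke n)ˣ :=
  if hk : k + 1 < n then HU n (sIdx k hk) else 1

/-- The length of `s_{k+1} w` exceeds that of `w` if `w⁻¹ k < w⁻¹ (k + 1)`. -/
theorem HwU_sN_mul {k : ℕ} (hk : k + 1 < n) {w : Weyl n} (hw : hat w⁻¹ k < hat w⁻¹ (k + 1)) :
    HwU n (sN n k * w) = hN n k * HwU n w := by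
  rw [sN, hN, dif_pos hk, dif_pos hk, HwU_simpleRefl_mul]
  rw [not_desc_iff (res_sIdx k hk), add_sub_cancel_right]
  exact hw

theorem sN_mul_self (k : ℕ) : sN n k * sN n k = 1 := by
  unfold sN
  split_ifs with hk
  · exact simpleRefl_sq _
  · exact mul_one 1

theorem hat_sN_self {k : ℕ} (hk : k + 1 < n) : hat (sN n k) k = k + 1 := by
  rw [sN, dif_pos hk]
  simpa using hat_simpleRefl_pred (res_sIdx k hk)

theorem hat_sN_succ {k : ℕ} (hk : k + 1 < n) : hat (sN n k) (k + 1) = k := by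
  rw [sN, dif_pos hk]
  simpa using hat_simpleRefl_self (res_sIdx k hk)

theorem hat_sN_of_ne {k j : ℕ} (hk : k + 1 < n) (hj : j < n) (h1 : j ≠ k) (h2 : j ≠ k + 1) :
    hat (sN n k) j = j := by
  rw [sN, dif_pos hk]
  apply hat_simpleRefl_fix
  · rw [← res_sIdx, Ne, res_eq_iff]
    rintro h
    have := Int.eq_zero_of_abs_lt_dvd h (by rw [abs_lt]; constructor <;> omega)
    omega
  · rw [← res_sIdx, Ne, res_eq_iff]
    rintro h
    have := Int.eq_zero_of_abs_lt_dvd h (by rw [abs_lt]; constructor <;> omega)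
    omega

theorem hat_inv_sN_mul (k : ℕ) (w : Weyl n) (a : ℤ) :
    hat (sN n k * w)⁻¹ a = hat w⁻¹ (hat (sN n k) a) := by
  rw [mul_inv_rev, hat_mul, inv_eq_of_mul_eq_one_left (sN_mul_self k)]

/-- The lengths add up in `(s_1 ⋯ s_i) w` if `w⁻¹` takes its largest value on `{0, …, i}` at `i`. -/
theorem HwU_ascProd_mul {i : ℕ} (hi : i < n) {w : Weyl n}
    (hw : ∀ j : ℕ, j < i → hat w⁻¹ j < hat w⁻¹ i) :
    HwU n (ascProd (sN n) 0 i * w) = ascProd (hN n) 0 i * HwU n w := by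
  induction i generalizing w with
  | zero => simp
  | succ i ih =>
    have h1 := hw i (by omega)
    push_cast at h1
    rw [ascProd_succ, ascProd_succ, zero_add, mul_assoc, mul_assoc, ← HwU_sN_mul hi h1,
      ih (by omega)]
    intro j hj
    rw [hat_inv_sN_mul, hat_inv_sN_mul, hat_sN_self hi, hat_sN_of_ne hi (by omega) (by omega)
      (by omega)]
    have := hw j (by omega)
    push_cast at this
    exact this

/-- The lengths add up in `(s_{a+m} ⋯ s_{a+1}) w` if `w⁻¹` takes its smallest value on
`{a, …, n-1}` at `a`. -/
theorem HwU_ascProd_inv_mul {a m : ℕ} (ham : a + m < n) {w : Weyl n}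
    (hw : ∀ j : ℕ, a < j → j < n → hat w⁻¹ a < hat w⁻¹ j) :
    HwU n ((ascProd (fun k => (sN n k)⁻¹) a m)⁻¹ * w) =
      (ascProd (fun k => (hN n k)⁻¹) a m)⁻¹ * HwU n w := by
  induction m generalizing a w with
  | zero => simp
  | succ m ih =>
    have h1 := hw (a + 1) (by omega) (by omega)
    push_cast at h1
    rw [ascProd_succ', ascProd_succ', mul_inv_rev, mul_inv_rev, inv_inv, inv_inv, mul_assoc,
      mul_assoc, ← HwU_sN_mul (by omega) h1, ih (by omega)]
    intro j hj hj'
    rw [hat_inv_sN_mul, hat_inv_sN_mul]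
    push_cast
    rw [hat_sN_succ (by omega), hat_sN_of_ne (by omega) hj' (by omega) (by omega)]
    exact hw j (by omega) hj'

theorem sN_eq_ofPerm {k : ℕ} (hk : k + 1 < n) :
    sN n k = ofPerm (Equiv.swap ⟨k, by omega⟩ ⟨k + 1, hk⟩) := by
  rw [sN, dif_pos hk, simpleRefl_of_ne_zero (sIdx_ne_zero k hk)]
  congr 2
  apply Fin.ext
  have := coe_sub_one (sIdx_ne_zero k hk)
  have h : ((sIdx k hk).1 : ℕ) = k + 1 := rfl
  rw [h] at this
  dsimp only
  omega

theorem coe_cycleRange {n : ℕ} (i j : Fin n) : (Fin.cycleRange i j : ℕ) =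
    if (j : ℕ) < i then (j : ℕ) + 1 else if (j : ℕ) = i then 0 else j := by
  rcases lt_trichotomy j i with h | h | h
  · rw [Fin.coe_cycleRange_of_lt h, if_pos (Fin.lt_def.1 h)]
  · subst h
    rw [Fin.coe_cycleRange_of_le le_rfl]
    simp
  · rw [Fin.cycleRange_of_gt h, if_neg (by rw [← Fin.lt_def]; exact h.not_gt),
      if_neg fun h' => h.ne' (Fin.ext h')]

theorem cycleRange_pred {n : ℕ} (h : n - 1 < n) : Fin.cycleRange ⟨n - 1, h⟩ = finRotate n := by
  cases n with
  | zero => exact absurd h (by omega)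
  | succ n => exact Fin.cycleRange_last n

theorem ascProd_sN {i : ℕ} (hi : i < n) : ascProd (sN n) 0 i = ofPerm (Fin.cycleRange ⟨i, hi⟩) := by
  induction i with
  | zero =>
    rw [ascProd_zero, Fin.cycleRange_mk_zero]
    exact (map_one _).symm
  | succ i ih =>
    rw [ascProd_succ, ih (by omega), zero_add, sN_eq_ofPerm hi, ofPerm_mul]
    congr 1
    refine Equiv.ext fun j => Fin.ext ?_
    rw [Equiv.Perm.mul_apply, coe_cycleRange, coe_cycleRange, Equiv.swap_apply_def]
    simp only [Fin.ext_iff]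
    split_ifs <;> simp_all <;> omega

theorem ofPerm_mul_transl {n : ℕ} (π : Equiv.Perm (Fin n)) (τ : Lattice n) :
    ofPerm π * transl τ = transl (fun i => τ (π⁻¹ i)) * ofPerm π := by
  refine SemidirectProduct.ext ?_ ?_
  · simp only [ofPerm, transl, SemidirectProduct.mul_left, SemidirectProduct.left_inl,
      SemidirectProduct.left_inr, SemidirectProduct.right_inl, SemidirectProduct.right_inr, map_one,
      mul_one, one_mul]
    rfl
  · simp [ofPerm, transl]

theorem transl_mul {n : ℕ} (σ τ : Lattice n) : transl σ * transl τ = transl (σ + τ) := by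
  simp [transl]

/-- The analogue in `W` of the word formula for `Z_i`. -/
theorem weyl_Z_eq (i : Fin n) : ascProd (fun k => (sN n k)⁻¹) i (n - 1 - i) * omegaW n *
    ascProd (sN n) 0 i = transl (-Pi.single i 1) := by
  obtain ⟨i, hi⟩ := i
  dsimp only
  induction hm : n - 1 - i generalizing i with
  | zero =>
    have : i = n - 1 := by omega
    subst this
    rw [ascProd_zero, one_mul, ascProd_sN hi, omegaW, mul_assoc, ofPerm_mul,
      cycleRange_pred, inv_mul_cancel]
    have h1 : (-1 : Fin n) = ⟨n - 1, hi⟩ := by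
      apply Fin.ext
      have := coe_neg_one (n := n)
      dsimp only
      omega
    rw [h1]
    exact mul_one _
  | succ m ih =>
    have hi' : i + 1 < n := by omega
    have h := ih (i + 1) hi' (by omega)
    rw [ascProd_succ, zero_add, ← mul_assoc] at h
    have hs : (sN n i)⁻¹ = sN n i := inv_eq_of_mul_eq_one_left (sN_mul_self i)
    rw [ascProd_succ', mul_assoc _ _ (omegaW n), mul_assoc, eq_mul_inv_of_mul_eq h, hs]
    have h2 : transl (-Pi.single ⟨i + 1, hi'⟩ 1 : Lattice n) * sN n i =
        sN n i * transl (-Pi.single ⟨i, hi⟩ 1) := by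
      rw [sN_eq_ofPerm hi', ofPerm_mul_transl]
      congr 2
      funext j
      simp only [Pi.neg_apply, Pi.single_apply, Equiv.swap_inv, Equiv.swap_apply_def]
      split_ifs <;> simp_all
    rw [h2, ← mul_assoc, sN_mul_self, one_mul]

theorem transl_inv_hat (τ : Lattice n) (r : Fin n) :
    hat (transl τ)⁻¹ (r : ℕ) = (r : ℕ) - n * τ r := by
  rw [hat_inv_coe]; simp [transl]

/-- The word formula for `Z_i`, where `i` counts from `0`. Both `ω s_1 ⋯ s_i t_{τ'}` and
`s_{n-1} ⋯ s_{i+1} t_{τ''}` denote the same element of `W`, and in both products the lengths add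
up. -/
theorem XU_inv_eq (i : Fin n) : (XU n i)⁻¹ =
    ascProd (fun k => (hN n k)⁻¹) i (n - 1 - i) * omU n * ascProd (hN n) 0 i := by
  set t' : Lattice n := fun j => if j ≤ i then 1 else 0 with ht'
  set t'' : Lattice n := fun j => if j < i then 1 else 0 with ht''
  have h1 : HwU n (ascProd (sN n) 0 i * transl t') = ascProd (hN n) 0 i * HwU n (transl t') := by
    refine HwU_ascProd_mul i.2 fun j hj => ?_
    have e1 := transl_inv_hat t' ⟨j, hj.trans i.2⟩
    have e2 := transl_inv_hat t' i
    rw [ht'] at e1 e2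
    dsimp only at e1 e2
    rw [if_pos (Fin.le_def.2 hj.le)] at e1
    rw [if_pos le_rfl] at e2
    rw [e1, e2]
    omega
  have h2 : HwU n ((ascProd (fun k => (sN n k)⁻¹) i (n - 1 - i))⁻¹ * transl t'') =
      (ascProd (fun k => (hN n k)⁻¹) i (n - 1 - i))⁻¹ * HwU n (transl t'') := by
    refine HwU_ascProd_inv_mul (by have := i.2; omega) fun j hj hjn => ?_
    have e1 := transl_inv_hat t'' ⟨j, hjn⟩
    have e2 := transl_inv_hat t'' i
    rw [ht''] at e1 e2
    dsimp only at e1 e2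
    rw [if_neg (by rw [Fin.lt_def]; dsimp only; omega)] at e1
    rw [if_neg (lt_irrefl i)] at e2
    rw [e1, e2]
    omega
  have h3 : omegaW n * (ascProd (sN n) 0 i * transl t') =
      (ascProd (fun k => (sN n k)⁻¹) i (n - 1 - i))⁻¹ * transl t'' := by
    rw [eq_inv_mul_iff_mul_eq, ← mul_assoc, ← mul_assoc, weyl_Z_eq, transl_mul]
    congr 1
    funext j
    rcases lt_trichotomy j i with h | h | h
    · simp [ht', ht'', h, h.le, h.ne]
    · simp [ht', ht'', h]
    · simp [ht', ht'', h.not_ge, h.not_gt, h.ne']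
  have h4 := HwU_omegaW_mul (ascProd (sN n) 0 i * transl t')
  rw [h3, h2, h1, inv_mul_eq_iff_eq_mul] at h4
  rw [XU, mul_inv_rev, inv_inv, ← ht', ← ht'', h4]
  group

end AffineHecke

namespace AffineHecke

/-! ### Specialization at `v = 1` -/

/-- The evaluation `ℤ[v, v⁻¹] → ℤ` at `v = 1`. -/
noncomputable def evalOne : LL →+* ℤ := LaurentPolynomial.eval₂ (RingHom.id ℤ) 1

theorem evalOne_T (k : ℤ) : evalOne (LaurentPolynomial.T k) = 1 := by
  obtain ⟨m, rfl | rfl⟩ := k.eq_nat_or_neg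
  · simp [evalOne]
  · simp [evalOne]

theorem v_sub_one_dvd_T_sub_one (k : ℤ) : v - 1 ∣ LaurentPolynomial.T k - 1 := by
  have h : ∀ m : ℕ, v - 1 ∣ LaurentPolynomial.T (m : ℤ) - 1 := by
    intro m
    have : LaurentPolynomial.T (m : ℤ) = v ^ m := by rw [v, LaurentPolynomial.T_pow]; simp
    rw [this]
    exact sub_one_dvd_pow_sub_one v m
  obtain ⟨m, rfl | rfl⟩ := k.eq_nat_or_neg
  · exact h m
  · have e : (LaurentPolynomial.T (-(m : ℤ)) - 1 : LL) =
        -(LaurentPolynomial.T (-(m : ℤ)) * (LaurentPolynomial.T (m : ℤ) - 1)) := by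
      rw [mul_sub, ← LaurentPolynomial.T_add]
      simp
    rw [e]
    exact (dvd_neg).2 ((h m).mul_left _)

theorem v_sub_one_dvd_sub (c : LL) : v - 1 ∣ c - LaurentPolynomial.C (evalOne c) := by
  induction c using LaurentPolynomial.induction_on' with
  | add p q hp hq =>
    rw [map_add, map_add, add_sub_add_comm]
    exact dvd_add hp hq
  | C_mul_T k a =>
    have : evalOne (LaurentPolynomial.C a) = a := by simp [evalOne]
    rw [map_mul, this, evalOne_T, mul_one]
    have e : (LaurentPolynomial.C a * LaurentPolynomial.T k - LaurentPolynomial.C a : LL) =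
        LaurentPolynomial.C a * (LaurentPolynomial.T k - 1) := by ring
    rw [e]
    exact (v_sub_one_dvd_T_sub_one k).mul_left _

theorem v_sub_one_dvd_of_evalOne_eq_zero {c : LL} (h : evalOne c = 0) : v - 1 ∣ c := by
  simpa [h] using v_sub_one_dvd_sub c

theorem evalOne_v : evalOne v = 1 := evalOne_T 1

theorem evalOne_vinv : evalOne vinv = 1 := evalOne_T (-1)

theorem v_sub_one_ne_zero : v - 1 ≠ 0 := by
  intro h
  have h1 : (LaurentPolynomial.T ((1 : ℕ) : ℤ) : LL) = 1 := sub_eq_zero.1 h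
  -- evaluation at `v = -1` distinguishes `v` from `1`
  have h2 := congrArg (LaurentPolynomial.eval₂ (RingHom.id ℤ) (-1)) h1
  rw [LaurentPolynomial.eval₂_T_n, map_one] at h2
  simp at h2

/-- Krull's intersection theorem for the non-unit `v - 1` of the noetherian domain `ℤ[v, v⁻¹]`. -/
theorem eq_zero_of_forall_pow_dvd {c : LL} (h : ∀ m : ℕ, (v - 1) ^ m ∣ c) : c = 0 := by
  have : IsNoetherianRing LL :=
    IsLocalization.isNoetherianRing (Submonoid.powers (Polynomial.X : Polynomial ℤ)) LL
      inferInstance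
  by_contra hc
  have hu : ¬ IsUnit (v - 1) := by
    intro hu
    have := hu.map evalOne
    rw [map_sub, evalOne_v, map_one, sub_self] at this
    exact not_isUnit_zero this
  obtain ⟨m, hm⟩ := FiniteMultiplicity.of_not_isUnit hu hc
  exact hm (h _)

/-- A family in a free module over `ℤ[v, v⁻¹]` is linearly independent if it is so after
specialization at `v = 1`: otherwise the coefficients of a relation would be divisible by `v - 1`,
and, after division by `v - 1`, would again be divisible by `v - 1`, and so on. -/
theorem linearIndependent_of_evalOne {ι κ : Type*} {F : ι → κ →₀ LL}
    (hF : LinearIndependent ℤ fun i => Finsupp.mapRange.addMonoidHom evalOne.toAddMonoidHom (F i)) :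
    LinearIndependent LL F := by
  set ev := Finsupp.mapRange.addMonoidHom (ι := κ) evalOne.toAddMonoidHom with hev
  have hev_smul : ∀ (c : LL) (x : κ →₀ LL), ev (c • x) = evalOne c • ev x := by
    intro c x
    ext k
    simp [hev]
  rw [linearIndependent_iff'] at hF ⊢
  intro s g hg
  have key : ∀ (m : ℕ), ∃ g' : ι → LL, (∀ i ∈ s, g i = (v - 1) ^ m * g' i) ∧
      ∑ i ∈ s, g' i • F i = 0 := by
    intro m
    induction m with
    | zero => exact ⟨g, by simp, hg⟩
    | succ m ih =>
      obtain ⟨g', h1, h2⟩ := ih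
      have h3 := hF s (fun i => evalOne (g' i)) (by
        have := congrArg ev h2
        rwa [map_sum, map_zero, Finset.sum_congr rfl fun i _ => hev_smul _ _] at this)
      have h4 : ∀ i, ∃ c, i ∈ s → g' i = (v - 1) * c := by
        intro i
        by_cases hi : i ∈ s
        · obtain ⟨c, hc⟩ := v_sub_one_dvd_of_evalOne_eq_zero (h3 i hi)
          exact ⟨c, fun _ => hc⟩
        · exact ⟨0, fun h => absurd h hi⟩
      choose g'' h5 using h4
      refine ⟨g'', fun i hi => ?_, ?_⟩
      · rw [h1 i hi, h5 i hi, pow_succ, mul_assoc]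
      · rw [Finset.sum_congr rfl fun i hi => by rw [h5 i hi, mul_smul], ← Finset.smul_sum] at h2
        exact (smul_eq_zero.1 h2).resolve_left v_sub_one_ne_zero
  intro i hi
  refine eq_zero_of_forall_pow_dvd fun m => ?_
  obtain ⟨g', h1, -⟩ := key m
  exact ⟨_, h1 i hi⟩

variable {n : ℕ} [NeZero n]

/-- Specialization of the space of the regular representation at `v = 1`. -/
noncomputable def evMod (n : ℕ) : RegMod n →+ (Weyl n →₀ ℤ) :=
  Finsupp.mapRange.addMonoidHom evalOne.toAddMonoidHom

/-- Left translation by `w` in the group ring of `W`. -/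
noncomputable def leftTransl (w : Weyl n) : (Weyl n →₀ ℤ) →+ (Weyl n →₀ ℤ) :=
  Finsupp.mapDomain.addMonoidHom (w * ·)

/-- `h` specializes to `w` at `v = 1`: on the regular representation, specialized at `v = 1`, the
element `h` acts as the left translation by `w`. -/
def SpecializesTo (h : Hecke n) (w : Weyl n) : Prop :=
  ∀ m, evMod n (regRep n h m) = leftTransl w (evMod n m)

theorem leftTransl_mul {n : ℕ} (x y : Weyl n) (m : Weyl n →₀ ℤ) :
    leftTransl (x * y) m = leftTransl x (leftTransl y m) := by
  simp only [leftTransl, Finsupp.mapDomain.addMonoidHom_apply, ← Finsupp.mapDomain_comp]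
  congr 1
  funext z
  exact mul_assoc x y z

theorem leftTransl_one {n : ℕ} (m : Weyl n →₀ ℤ) : leftTransl 1 m = m := by
  have h : ((1 : Weyl n) * ·) = id := funext one_mul
  rw [leftTransl, Finsupp.mapDomain.addMonoidHom_apply, h, Finsupp.mapDomain_id]

theorem evMod_smul {n : ℕ} (c : LL) (x : RegMod n) : evMod n (c • x) = evalOne c • evMod n x := by
  ext k
  simp [evMod]

theorem SpecializesTo.mul {h h' : Hecke n} {w w' : Weyl n} (hh : SpecializesTo h w)
    (hh' : SpecializesTo h' w') : SpecializesTo (h * h') (w * w') := by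
  intro m
  rw [map_mul, Module.End.mul_apply, hh, hh', leftTransl_mul]

theorem SpecializesTo.one : SpecializesTo (1 : Hecke n) 1 := by
  intro m
  rw [map_one, Module.End.one_apply, leftTransl_one]

theorem SpecializesTo.inv {h : (Hecke n)ˣ} {w : Weyl n} (hh : SpecializesTo (h : Hecke n) w) :
    SpecializesTo ((h⁻¹ : (Hecke n)ˣ) : Hecke n) w⁻¹ := by
  intro m
  have := hh (regRep n ((h⁻¹ : (Hecke n)ˣ) : Hecke n) m)
  rw [← Module.End.mul_apply, ← map_mul, Units.mul_inv, map_one, Module.End.one_apply] at this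
  rw [this, ← leftTransl_mul, inv_mul_cancel, leftTransl_one]

theorem SpecializesTo.pow {h : Hecke n} {w : Weyl n} (hh : SpecializesTo h w) (k : ℕ) :
    SpecializesTo (h ^ k) (w ^ k) := by
  induction k with
  | zero => simpa using SpecializesTo.one
  | succ k ih => rw [pow_succ, pow_succ]; exact ih.mul hh

theorem specializesTo_of_single {h : Hecke n} {w : Weyl n}
    (hh : ∀ x, evMod n (regRep n h (Finsupp.single x 1)) = Finsupp.single (w * x) 1) :
    SpecializesTo h w := by
  intro m
  induction m using Finsupp.induction_linear with
  | zero => simp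
  | add f g hf hg => rw [map_add, map_add, hf, hg, map_add, map_add]
  | single x c =>
    have e : (Finsupp.single x c : RegMod n) = c • Finsupp.single x 1 := by simp
    rw [e, map_smul, evMod_smul, evMod_smul, hh]
    simp [leftTransl, evMod, Finsupp.mapDomain.addMonoidHom_apply, Finsupp.mapDomain_single]

theorem specializesTo_HU (i : SimpleIdx n) : SpecializesTo (HU n i : Hecke n) (simpleRefl n i) := by
  refine specializesTo_of_single fun x => ?_
  rw [regRep_HU]
  by_cases hd : Desc i x
  · rw [opH_of_desc hd, map_add, evMod_smul, map_sub, evalOne_v, evalOne_vinv, sub_self, zero_smul,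
      add_zero]
    simp [evMod]
  · rw [opH_of_not_desc hd]
    simp [evMod]

theorem specializesTo_omU : SpecializesTo (omU n : Hecke n) (omegaW n) := by
  refine specializesTo_of_single fun x => ?_
  rw [regRep_omU, opShift_single]
  simp [evMod]

theorem specializesTo_HwU (w : Weyl n) : SpecializesTo (HwU n w : Hecke n) w := by
  induction h : len w using Nat.strong_induction_on generalizing w with
  | _ m ih =>
    subst h
    by_cases hd : ∃ i, Desc i w
    · obtain ⟨i, hi⟩ := hd
      have h1 := (specializesTo_HU i).mul
        (ih _ (by have := len_simpleRefl_mul_of_desc hi; omega) (simpleRefl n i * w) rfl)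
      rwa [simpleRefl_mul_cancel, ← Units.val_mul, ← HwU_of_desc hi] at h1
    · obtain ⟨k, rfl⟩ := eq_omegaW_zpow_of_forall_not_desc (not_exists.1 hd)
      rw [HwU_omegaW_zpow]
      obtain ⟨k, rfl | rfl⟩ := k.eq_nat_or_neg
      · simpa using specializesTo_omU.pow k
      · rw [zpow_neg, zpow_neg]
        apply SpecializesTo.inv
        simpa using specializesTo_omU.pow k

theorem specializesTo_Z (i : Fin n) : SpecializesTo (Z n i) (transl (-Pi.single i 1)) := by
  have h := ((specializesTo_HwU (transl fun j : Fin n => if j ≤ i then (1 : ℤ) else 0)).mul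
    (specializesTo_HwU (transl fun j : Fin n => if j < i then (1 : ℤ) else 0)).inv)
  rw [← Units.val_mul] at h
  have h2 := SpecializesTo.inv (h := XU n i) h
  suffices e : transl (-Pi.single i 1 : Lattice n) =
      ((transl fun j => if j ≤ i then 1 else 0) * (transl fun j => if j < i then 1 else 0)⁻¹)⁻¹ by
    rw [e]; exact h2
  rw [mul_inv_rev, inv_inv, eq_mul_inv_iff_mul_eq, transl_mul]
  congr 1
  funext j
  rcases lt_trichotomy j i with h | h | h
  · simp [h, h.le, h.ne]
  · simp [h]
  · simp [h.not_ge, h.not_gt, h.ne']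

end AffineHecke

namespace AffineHecke

/-! ### Passing between the sets of relations -/

/-- The first `N` members of the sequence `h` satisfy the braid relations of type `A_N`. -/
structure BraidSeq {M : Type*} [Monoid M] (h : ℕ → M) (N : ℕ) : Prop where
  braid : ∀ k, k + 1 < N → h k * h (k + 1) * h k = h (k + 1) * h k * h (k + 1)
  comm : ∀ i j, i + 1 < j → j < N → Commute (h i) (h j)

section monoid
variable {M : Type*} [Monoid M] {g : ℕ → M} {N : ℕ}

theorem BraidSeq.commute_ascProd (hg : BraidSeq g N) {a m j : ℕ} (hj : a + m < j) (hjN : j < N) :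
    Commute (g j) (ascProd g a m) := by
  induction m with
  | zero => exact Commute.one_right _
  | succ m ih =>
    rw [ascProd_succ]
    exact (ih (by omega)).mul_right (hg.comm _ _ (by omega) hjN).symm

/-- Conjugation by `g_0 g_1 ⋯ g_{m-1}` shifts the indices of the generators. -/
theorem BraidSeq.semiconjBy_ascProd (hg : BraidSeq g N) {m k : ℕ} (hk : k + 1 < m) (hm : m ≤ N) :
    SemiconjBy (ascProd g 0 m) (g k) (g (k + 1)) := by
  induction m with
  | zero => omega
  | succ m ih =>
    rw [ascProd_succ, zero_add]
    rcases Nat.lt_or_ge (k + 1) m with h | h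
    · exact (ih h (by omega)).mul_left (hg.comm _ _ h (by omega)).symm
    · obtain rfl : m = k + 1 := by omega
      rw [ascProd_succ, zero_add]
      have h1 : SemiconjBy (ascProd g 0 k) (g (k + 1)) (g (k + 1)) :=
        (hg.commute_ascProd (by omega) (by omega)).symm
      have h2 : SemiconjBy (g k * g (k + 1)) (g k) (g (k + 1)) := by
        have := hg.braid k (by omega)
        rw [SemiconjBy, this, mul_assoc]
      rw [mul_assoc]
      exact h1.mul_left h2

/-- Conjugation by `(g_1 ⋯ g_m) (g_0 ⋯ g_{m-1})` sends `g_m` to `g_0`. -/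
theorem BraidSeq.semiconjBy_ascProd_mul (hg : BraidSeq g N) {m : ℕ} (hm : m < N) :
    SemiconjBy (ascProd g 1 m * ascProd g 0 m) (g m) (g 0) := by
  induction m with
  | zero => simp
  | succ m ih =>
    have h1 : ascProd g 1 (m + 1) * ascProd g 0 (m + 1) =
        (ascProd g 1 m * ascProd g 0 m) * (g (m + 1) * g m) := by
      have h2 := (hg.commute_ascProd (a := 0) (m := m) (j := m + 1) (by omega) hm).eq
      rw [ascProd_succ, ascProd_succ, zero_add, add_comm 1 m, mul_assoc, ← mul_assoc (g (m + 1)),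
        h2]
      simp only [mul_assoc]
    rw [h1]
    refine (ih (by omega)).mul_left ?_
    have := hg.braid m hm
    rw [SemiconjBy, ← this, mul_assoc]

/-- The relations of the third presentation, for `Z_1 = H_1⁻¹ ⋯ H_{n-1}⁻¹ ω`, follow from those of
the fourth: commutation with `H_2, …, H_{n-1}`. Here `g_k` stands for `H_{k+1}⁻¹`. -/
theorem BraidSeq.commute_ascProd_mul (hg : BraidSeq g N) {om : M}
    (hom : ∀ k, k + 1 < N → SemiconjBy om (g (k + 1)) (g k)) {k : ℕ} (hk : k + 1 < N) :
    Commute (ascProd g 0 N * om) (g (k + 1)) :=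
  (hg.semiconjBy_ascProd hk le_rfl).mul_left (hom k hk)

/-- The relations of the third presentation, for `Z_1 = H_1⁻¹ ⋯ H_{n-1}⁻¹ ω`, follow from those of
the fourth: the relation of length four. -/
theorem BraidSeq.four_of_square (hg : BraidSeq g N) {om h : M}
    (hom : ∀ k, k + 1 < N → SemiconjBy om (g (k + 1)) (g k)) (hN : 0 < N)
    (hsq : SemiconjBy (om ^ 2) (g 0) (g (N - 1))) (h1 : h * g 0 = 1) (h2 : g 0 * h = 1) :
    h * (ascProd g 0 N * om) * h * (ascProd g 0 N * om) =
      ascProd g 0 N * om * h * (ascProd g 0 N * om) * h := by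
  obtain ⟨N, rfl⟩ : ∃ m, N = m + 1 := ⟨N - 1, by omega⟩
  rw [Nat.add_sub_cancel] at hsq
  have hshift : ∀ m, m ≤ N → om * ascProd g 1 m = ascProd g 0 m * om := by
    intro m hm
    induction m with
    | zero => simp
    | succ m ih =>
      have := (hom m (by omega)).eq
      rw [ascProd_succ, ascProd_succ, ← mul_assoc, ih (by omega), zero_add, mul_assoc, add_comm 1 m,
        this, mul_assoc]
  set c := ascProd g 1 N with hc
  have e : ascProd g 0 (N + 1) = g 0 * c := ascProd_succ' g 0 N
  have e1 : h * (g 0 * c * om) = c * om := by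
    rw [mul_assoc, ← mul_assoc h, h1, one_mul]
  have hcom : Commute (c * om * (c * om)) (g 0) := by
    have : c * om * (c * om) = c * ascProd g 0 N * om ^ 2 := by
      rw [mul_assoc, ← mul_assoc om, hshift N le_rfl, sq]
      simp only [mul_assoc]
    rw [this]
    exact (hg.semiconjBy_ascProd_mul (by omega)).mul_left hsq
  have hcom' : c * om * (c * om) * h = h * (c * om * (c * om)) := by
    calc c * om * (c * om) * h = h * g 0 * (c * om * (c * om)) * h := by rw [h1, one_mul]
      _ = h * (c * om * (c * om)) * (g 0 * h) := by
          rw [mul_assoc h, ← hcom.eq]; simp only [mul_assoc]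
      _ = _ := by rw [h2, mul_one]
  rw [e]
  calc h * (g 0 * c * om) * h * (g 0 * c * om) = g 0 * h * (c * om * (c * om)) := by
        rw [mul_assoc, e1, h2, one_mul]
    _ = g 0 * (c * om * (c * om) * h) := by rw [hcom', mul_assoc]
    _ = g 0 * c * om * (h * (g 0 * c * om)) * h := by rw [e1]; simp only [mul_assoc]
    _ = _ := by simp only [mul_assoc]

/-- The elements `Z_i`, starting from `Z_1 = ζ`: `Z_{i+1} = H_i Z_i H_i`. -/
def zSeq (h : ℕ → M) (ζ : M) : ℕ → M
  | 0 => ζ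
  | i + 1 => h i * zSeq h ζ i * h i

variable {h : ℕ → M} {ζ : M}

theorem BraidSeq.commute_zSeq_of_lt (hh : BraidSeq h N)
    (hζ : ∀ k, 1 ≤ k → k < N → Commute (h k) ζ) {i j : ℕ} (hij : i < j) (hj : j < N) :
    Commute (h j) (zSeq h ζ i) := by
  induction i with
  | zero => exact hζ j hij hj
  | succ i ih =>
    have h1 := (hh.comm i j hij hj).symm
    exact (h1.mul_right (ih (by omega))).mul_right h1

/-- If `a` and `b` satisfy the braid relation, then `a` commutes with `(b a) y (a b)` for each `y`
which commutes with `b`. -/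
theorem commute_of_braid {a b y : M} (hab : a * b * a = b * a * b) (hy : b * y = y * b) :
    Commute a (b * (a * y * a) * b) :=
  calc a * (b * (a * y * a) * b) = (a * b * a) * y * a * b := by simp only [mul_assoc]
    _ = b * a * (b * y) * a * b := by rw [hab]; simp only [mul_assoc]
    _ = b * a * y * (b * a * b) := by rw [hy]; simp only [mul_assoc]
    _ = b * (a * y * a) * b * a := by rw [← hab]; simp only [mul_assoc]

theorem BraidSeq.commute_zSeq_of_gt (hh : BraidSeq h N)
    (hζ : ∀ k, 1 ≤ k → k < N → Commute (h k) ζ) {i j : ℕ} (hij : j + 1 < i) (hi : i ≤ N) :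
    Commute (h j) (zSeq h ζ i) := by
  induction i with
  | zero => omega
  | succ i ih =>
    rcases Nat.lt_or_ge (j + 1) i with h1 | h1
    · have h2 := hh.comm j i h1 hi
      exact (h2.mul_right (ih h1 (by omega))).mul_right h2
    · obtain rfl : i = j + 1 := by omega
      exact commute_of_braid (hh.braid j hi) (hh.commute_zSeq_of_lt hζ (by omega) hi).eq

/-- The relation of length four passes from `(a, y)` to `(b, a y a)` if `a` and `b`
satisfy the braid relation and `b` commutes with `y`. -/
theorem four_of_braid {a b y : M} (hab : a * b * a = b * a * b) (hy : b * y = y * b)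
    (h4 : a * y * a * y = y * a * y * a) :
    b * (a * y * a) * b * (a * y * a) = (a * y * a) * b * (a * y * a) * b := by
  symm
  calc (a * y * a) * b * (a * y * a) * b = a * y * (a * b * a) * y * a * b := by
        simp only [mul_assoc]
    _ = a * (y * b) * a * (b * y) * a * b := by rw [hab]; simp only [mul_assoc]
    _ = a * (b * y) * a * (b * y) * a * b := by rw [hy]
    _ = (a * b * y * a) * (b * y) * (a * b) := by simp only [mul_assoc]
    _ = a * b * y * a * y * (b * a * b) := by rw [hy]; simp only [mul_assoc]
    _ = a * b * (y * a * y * a) * b * a := by rw [← hab]; simp only [mul_assoc]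
    _ = (a * b * a) * y * a * y * b * a := by rw [← h4]; simp only [mul_assoc]
    _ = b * a * (b * y) * a * (y * b) * a := by rw [hab]; simp only [mul_assoc]
    _ = b * a * (b * y) * a * (b * y) * a := by rw [hy]
    _ = (b * a) * (b * y) * (a * b * y * a) := by simp only [mul_assoc]
    _ = b * a * y * (b * a * b) * y * a := by rw [hy]; simp only [mul_assoc]
    _ = _ := by rw [← hab]; simp only [mul_assoc]

/-- The relation of length four propagates from `Z_1` to all `Z_i`. -/
theorem BraidSeq.four_zSeq (hh : BraidSeq h N)
    (hζ : ∀ k, 1 ≤ k → k < N → Commute (h k) ζ)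
    (h4 : 0 < N → h 0 * ζ * h 0 * ζ = ζ * h 0 * ζ * h 0) {i : ℕ} (hi : i < N) :
    h i * zSeq h ζ i * h i * zSeq h ζ i = zSeq h ζ i * h i * zSeq h ζ i * h i := by
  induction i with
  | zero => exact h4 hi
  | succ i ih =>
    exact four_of_braid (hh.braid i hi) (hh.commute_zSeq_of_lt hζ (by omega) hi).eq (ih (by omega))

/-- The members of `zSeq` commute: this is the relation of length four for neighbours, and
propagates to the others. -/
theorem BraidSeq.commute_zSeq (hh : BraidSeq h N)
    (hζ : ∀ k, 1 ≤ k → k < N → Commute (h k) ζ)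
    (h4 : 0 < N → h 0 * ζ * h 0 * ζ = ζ * h 0 * ζ * h 0) {i j : ℕ} (hi : i ≤ N) (hj : j ≤ N) :
    Commute (zSeq h ζ i) (zSeq h ζ j) := by
  have key : ∀ i j, i < j → j ≤ N → Commute (zSeq h ζ i) (zSeq h ζ j) := by
    intro i j hij hj
    induction j with
    | zero => omega
    | succ j ih =>
      rcases Nat.lt_or_ge i j with h1 | h1
      · have h2 := (hh.commute_zSeq_of_lt hζ h1 (by omega)).symm
        exact (h2.mul_right (ih h1 (by omega))).mul_right h2
      · obtain rfl : i = j := by omega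
        have := hh.four_zSeq hζ h4 (i := i) (by omega)
        rw [Commute, SemiconjBy, zSeq, this]
        simp only [mul_assoc]
  rcases lt_trichotomy i j with hij | rfl | hij
  · exact key i j hij hj
  · exact Commute.refl _
  · exact (key j i hij hi).symm

end monoid

section bernstein
variable {n : ℕ} {A : Type*} [Ring A] [Algebra LL A]

open scoped IsMulCommutative in
/-- An algebra homomorphism from the polynomial ring which sends the variables to given commuting
elements of a noncommutative algebra. -/
theorem exists_algHom_of_commute (z : Fin n → A) (hz : ∀ i j, z i * z j = z j * z i) :
    ∃ Φ : PolyZ n →ₐ[LL] A, ∀ i, Φ (MvPolynomial.X i) = z i := by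
  let S := Algebra.adjoin LL (Set.range z)
  have : IsMulCommutative S := Algebra.isMulCommutative_adjoin LL (by
    rintro _ ⟨i, rfl⟩ _ ⟨j, rfl⟩; exact hz i j)
  let f : Fin n → S := fun i => ⟨z i, Algebra.subset_adjoin ⟨i, rfl⟩⟩
  refine ⟨S.val.comp (MvPolynomial.aeval f), fun i => ?_⟩
  simp [f]

/-- The Bernstein relation for all polynomials follows from the relations for the variables, since
the divided difference `q = (p - s p) / (x - y)` satisfies a twisted Leibniz rule. -/
theorem bernstein_of_relations {k : ℕ} (hk : k + 1 < n) {Φ : PolyZ n →ₐ[LL] A} {h : A}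
    (hq : h * h = 1 + (vinv - v) • h)
    (hstep : h * Φ (MvPolynomial.X ⟨k, by omega⟩) * h = Φ (MvPolynomial.X ⟨k + 1, hk⟩))
    (hcomm : ∀ i : Fin n, (i : ℕ) ≠ k → (i : ℕ) ≠ k + 1 →
      h * Φ (MvPolynomial.X i) = Φ (MvPolynomial.X i) * h) (p q : PolyZ n)
    (hpq : q * (MvPolynomial.X ⟨k, by omega⟩ - MvPolynomial.X ⟨k + 1, hk⟩) = p - swapVar n k hk p) :
    h * Φ p - Φ (swapVar n k hk p) * h = Φ ((v - vinv) • (MvPolynomial.X ⟨k + 1, hk⟩ * q)) := by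
  set x : PolyZ n := MvPolynomial.X ⟨k, by omega⟩ with hx
  set y : PolyZ n := MvPolynomial.X ⟨k + 1, hk⟩ with hy
  have hne : x - y ≠ 0 := by
    rw [sub_ne_zero, hx, hy]
    intro h
    have := MvPolynomial.X_injective h
    simp at this
  -- the divided difference is unique, so that it may be constructed along with the relation
  suffices H : ∃ q', q' * (x - y) = p - swapVar n k hk p ∧
      h * Φ p = Φ (swapVar n k hk p) * h + (v - vinv) • (Φ y * Φ q') by
    obtain ⟨q', h1, h2⟩ := H
    have : q = q' := mul_right_cancel₀ hne (hpq.trans h1.symm)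
    rw [this, h2, map_smul, map_mul]
    abel
  clear hpq
  have hX : ∀ i : Fin n, ∃ q', q' * (x - y) =
      MvPolynomial.X i - swapVar n k hk (MvPolynomial.X i) ∧ h * Φ (MvPolynomial.X i) =
        Φ (swapVar n k hk (MvPolynomial.X i)) * h + (v - vinv) • (Φ y * Φ q') := by
    intro i
    have hs : swapVar n k hk (MvPolynomial.X i) = MvPolynomial.X
        (Equiv.swap (⟨k, by omega⟩ : Fin n) ⟨k + 1, hk⟩ i) := MvPolynomial.rename_X _ _
    rw [hs]
    by_cases h1 : i = ⟨k, by omega⟩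
    · subst h1
      rw [Equiv.swap_apply_left]
      refine ⟨1, by rw [one_mul], ?_⟩
      rw [← hx, ← hy, map_one, mul_one, ← hstep, mul_assoc _ h h, hq, mul_add, mul_one,
        mul_smul_comm]
      module
    by_cases h2 : i = ⟨k + 1, hk⟩
    · subst h2
      rw [Equiv.swap_apply_right]
      refine ⟨-1, by rw [← hx, ← hy]; ring, ?_⟩
      rw [← hx, ← hy, map_neg, map_one, mul_neg, mul_one, ← hstep, ← mul_assoc, ← mul_assoc, hq,
        add_mul, add_mul, one_mul, smul_mul_assoc, smul_mul_assoc]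
      module
    · rw [Equiv.swap_apply_of_ne_of_ne h1 h2]
      refine ⟨0, by ring, ?_⟩
      rw [hcomm i (fun h => h1 (Fin.ext h)) fun h => h2 (Fin.ext h)]
      simp
  induction p using MvPolynomial.induction_on with
  | C a =>
    refine ⟨0, ?_, ?_⟩
    · simp [swapVar]
    · have e : swapVar n k hk (MvPolynomial.C a) = MvPolynomial.C a := MvPolynomial.rename_C _ _
      have e2 : (MvPolynomial.C a : PolyZ n) = algebraMap LL _ a := rfl
      rw [e, e2, AlgHom.commutes, Algebra.commutes]
      simp
  | add p p' hp hp' =>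
    obtain ⟨q, h1, h2⟩ := hp
    obtain ⟨q', h3, h4⟩ := hp'
    refine ⟨q + q', ?_, ?_⟩
    · rw [add_mul, h1, h3, map_add]; ring
    · simp only [map_add, mul_add, add_mul, h2, h4, smul_add]; abel
  | mul_X p i hp =>
    obtain ⟨q, h1, h2⟩ := hp
    obtain ⟨q', h3, h4⟩ := hX i
    refine ⟨swapVar n k hk p * q' + q * MvPolynomial.X i, ?_, ?_⟩
    · rw [add_mul, mul_assoc, h3, mul_assoc, mul_comm (MvPolynomial.X i), ← mul_assoc, h1, map_mul]
      ring
    · have hc : ∀ a b : PolyZ n, Φ a * (Φ y * Φ b) = Φ y * (Φ a * Φ b) := fun a b => by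
        simp only [← map_mul]; congr 1; ring
      rw [map_mul, ← mul_assoc, h2, add_mul, mul_assoc, h4, smul_mul_assoc]
      simp only [map_mul, map_add, mul_add, smul_add, mul_smul_comm, mul_assoc, hc]
      abel

end bernstein

end AffineHecke

namespace AffineHecke

/-! ### Algebras generated by two algebras -/

namespace GenAlg

variable {B C : Type} [Ring B] [Algebra LL B] [Ring C] [Algebra LL C]
  (rel : FreeAlgebra LL (B ⊕ C) → FreeAlgebra LL (B ⊕ C) → Prop)

/-- `GenAlg.left` as an algebra homomorphism. -/
noncomputable def leftHom : B →ₐ[LL] GenAlg B C rel where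
  toFun := GenAlg.left rel
  map_one' := by
    have := RingQuot.mkAlgHom_rel LL (GenRel.scalarB (rel := rel) 1)
    simpa [GenAlg.left] using this
  map_mul' x y := by
    have := RingQuot.mkAlgHom_rel LL (GenRel.mulB (rel := rel) x y)
    simpa [GenAlg.left] using this
  map_zero' := by
    have := RingQuot.mkAlgHom_rel LL (GenRel.scalarB (rel := rel) 0)
    simpa [GenAlg.left] using this
  map_add' x y := by
    have := RingQuot.mkAlgHom_rel LL (GenRel.addB (rel := rel) x y)
    simpa [GenAlg.left] using this
  commutes' r := by
    have := RingQuot.mkAlgHom_rel LL (GenRel.scalarB (rel := rel) r)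
    rw [AlgHom.commutes] at this
    exact this

/-- `GenAlg.right` as an algebra homomorphism. -/
noncomputable def rightHom : C →ₐ[LL] GenAlg B C rel where
  toFun := GenAlg.right rel
  map_one' := by
    have := RingQuot.mkAlgHom_rel LL (GenRel.scalarC (rel := rel) 1)
    simpa [GenAlg.right] using this
  map_mul' x y := by
    have := RingQuot.mkAlgHom_rel LL (GenRel.mulC (rel := rel) x y)
    simpa [GenAlg.right] using this
  map_zero' := by
    have := RingQuot.mkAlgHom_rel LL (GenRel.scalarC (rel := rel) 0)
    simpa [GenAlg.right] using this
  map_add' x y := by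
    have := RingQuot.mkAlgHom_rel LL (GenRel.addC (rel := rel) x y)
    simpa [GenAlg.right] using this
  commutes' r := by
    have := RingQuot.mkAlgHom_rel LL (GenRel.scalarC (rel := rel) r)
    rw [AlgHom.commutes] at this
    exact this

variable {rel}

theorem mkAlgHom_rel {a b : FreeAlgebra LL (B ⊕ C)} (h : rel a b) :
    RingQuot.mkAlgHom LL (GenRel B C rel) a = RingQuot.mkAlgHom LL (GenRel B C rel) b :=
  RingQuot.mkAlgHom_rel LL (GenRel.of a b h)

/-- The algebra is generated by the images of `B` and `C`. -/
theorem mem_of_left_right (S : Subalgebra LL (GenAlg B C rel)) (hl : ∀ b, leftHom rel b ∈ S)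
    (hr : ∀ c, rightHom rel c ∈ S) (x : GenAlg B C rel) : x ∈ S := by
  obtain ⟨x, rfl⟩ := RingQuot.mkAlgHom_surjective LL (GenRel B C rel) x
  induction x using FreeAlgebra.induction with
  | grade0 r => rw [AlgHom.commutes]; exact S.algebraMap_mem r
  | grade1 x =>
    rcases x with b | c
    · exact hl b
    · exact hr c
  | mul a b ha hb => rw [map_mul]; exact S.mul_mem ha hb
  | add a b ha hb => rw [map_add]; exact S.add_mem ha hb

variable {A : Type*} [Ring A] [Algebra LL A]

/-- The universal property: two homomorphisms which respect the relations extend to the algebra. -/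
theorem exists_lift (φ : B →ₐ[LL] A) (ψ : C →ₐ[LL] A)
    (h : ∀ a b, rel a b →
      FreeAlgebra.lift LL (Sum.elim φ ψ) a = FreeAlgebra.lift LL (Sum.elim φ ψ) b) :
    ∃ f : GenAlg B C rel →ₐ[LL] A, (∀ b, f (leftHom rel b) = φ b) ∧
      ∀ c, f (rightHom rel c) = ψ c := by
  refine ⟨RingQuot.liftAlgHom LL ⟨FreeAlgebra.lift LL (Sum.elim φ ψ), ?_⟩, fun b => ?_, fun c => ?_⟩
  · intro a b hab
    cases hab with
    | of a b hab => exact h a b hab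
    | _ => simp
  · change RingQuot.liftAlgHom LL _ (RingQuot.mkAlgHom LL _ _) = _
    rw [RingQuot.liftAlgHom_mkAlgHom_apply, FreeAlgebra.lift_ι_apply, Sum.elim_inl]
  · change RingQuot.liftAlgHom LL _ (RingQuot.mkAlgHom LL _ _) = _
    rw [RingQuot.liftAlgHom_mkAlgHom_apply, FreeAlgebra.lift_ι_apply, Sum.elim_inr]

theorem hom_ext {f g : GenAlg B C rel →ₐ[LL] A}
    (hl : ∀ b, f (leftHom rel b) = g (leftHom rel b))
    (hr : ∀ c, f (rightHom rel c) = g (rightHom rel c)) : f = g := by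
  exact AlgHom.ext fun x => mem_of_left_right (AlgHom.equalizer f g) hl hr x

/-- If `C` is free, it suffices to consider its generators. -/
theorem rightHom_mem {X : Type} {rel : FreeAlgebra LL (B ⊕ FreeAlgebra LL X) →
    FreeAlgebra LL (B ⊕ FreeAlgebra LL X) → Prop}
    {S : Subalgebra LL (GenAlg B (FreeAlgebra LL X) rel)}
    (h : ∀ x, rightHom rel (FreeAlgebra.ι LL x) ∈ S) (c : FreeAlgebra LL X) :
    rightHom rel c ∈ S := by
  induction c using FreeAlgebra.induction with
  | grade0 r => rw [AlgHom.commutes]; exact S.algebraMap_mem r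
  | grade1 x => exact h x
  | mul a b ha hb => rw [map_mul]; exact S.mul_mem ha hb
  | add a b ha hb => rw [map_add]; exact S.add_mem ha hb

end GenAlg

/-! ### The generators of `H_f` -/

variable {n : ℕ} [NeZero n]

theorem hf_mul_self (k : ℕ) (hk : k + 1 < n) :
    hf n k hk * hf n k hk = 1 + (vinv - v) • hf n k hk :=
  Subtype.ext (HU_mul_self _)

/-- The generator `H_{k+1}` of `H_f` as a unit; by convention it is `1` if `k + 1 ≥ n`. -/
noncomputable def hfU (n : ℕ) [NeZero n] (k : ℕ) : (Hf n)ˣ :=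
  if hk : k + 1 < n then
    { val := hf n k hk
      inv := hf n k hk + algebraMap LL (Hf n) (v - vinv)
      val_inv := by
        rw [mul_add, ← Algebra.commutes, ← Algebra.smul_def, hf_mul_self]; module
      inv_val := by
        rw [add_mul, ← Algebra.smul_def, hf_mul_self]; module }
  else 1

theorem coe_hfU {k : ℕ} (hk : k + 1 < n) : (hfU n k : Hf n) = hf n k hk := by
  rw [hfU, dif_pos hk]

theorem map_hfU (k : ℕ) : Units.map ((Hf n).val : Hf n →* Hecke n) (hfU n k) = hN n k := by
  apply Units.ext
  unfold hfU hN
  split_ifs with hk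
  · rfl
  · rfl

theorem map_ascProd {G G' : Type*} [Monoid G] [Monoid G'] (f : G →* G') (h : ℕ → G) (a m : ℕ) :
    f (ascProd h a m) = ascProd (fun k => f (h k)) a m := by
  simp [ascProd, map_list_prod, Function.comp_def]

theorem BraidSeq.map {G G' : Type*} [Monoid G] [Monoid G'] (f : G →* G') {h : ℕ → G} {N : ℕ}
    (hh : BraidSeq h N) : BraidSeq (fun k => f (h k)) N where
  braid k hk := by simp only [← map_mul, hh.braid k hk]
  comm i j hij hj := (hh.comm i j hij hj).map f

theorem BraidSeq.inv {G : Type*} [Group G] {h : ℕ → G} {N : ℕ} (hh : BraidSeq h N) :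
    BraidSeq (fun k => (h k)⁻¹) N where
  braid k hk := by
    have := congrArg (·⁻¹) (hh.braid k hk)
    simpa only [mul_inv_rev, mul_assoc] using this
  comm i j hij hj := (hh.comm i j hij hj).inv_inv

theorem braidSeq_hfU : BraidSeq (hfU n) (n - 1) := by
  constructor
  · intro k hk
    apply Units.ext
    simp only [Units.val_mul]
    rw [coe_hfU (by omega : k + 1 < n), coe_hfU (by omega : k + 1 + 1 < n)]
    apply Subtype.ext
    have := HU_braid (by omega) (i := sIdx k (by omega : k + 1 < n))
      (j := sIdx (k + 1) (by omega : k + 1 + 1 < n)) (by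
        rw [← res_sIdx, ← res_sIdx, ← res_add_one]; push_cast; rfl)
    exact congrArg Units.val this
  · intro i j hij hj
    apply Units.ext
    simp only [Units.val_mul]
    rw [coe_hfU (by omega : i + 1 < n), coe_hfU (by omega : j + 1 < n)]
    apply Subtype.ext
    have := hq_rel n (HRel.comm (sIdx i (by omega : i + 1 < n)) (sIdx j (by omega : j + 1 < n))
      (by simp only [sIdx]; omega) (by simp only [sIdx]; omega))
    rw [map_mul, map_mul] at this
    exact this

theorem exists_eq_sIdx {i : SimpleIdx n} (hi : i.1 ≠ 0) : ∃ k, ∃ hk : k + 1 < n, i = sIdx k hk := by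
  have h0 : (i.1 : ℕ) ≠ 0 := fun h => hi (Fin.ext (by simpa using h))
  have := i.1.2
  refine ⟨i.1 - 1, by omega, ?_⟩
  apply Subtype.ext
  apply Fin.ext
  simp only [sIdx]
  omega

/-- `H_f` is generated by the `H_i`. -/
theorem mem_of_hf_mem (S : Subalgebra LL (Hf n)) (hS : ∀ k hk, hf n k hk ∈ S) (u : Hf n) :
    u ∈ S := by
  obtain ⟨u, hu⟩ := u
  induction hu using Algebra.adjoin_induction with
  | mem x hx =>
    obtain ⟨i, hi, rfl⟩ := id hx
    obtain ⟨k, hk, rfl⟩ := exists_eq_sIdx hi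
    exact hS k hk
  | algebraMap r => exact S.algebraMap_mem r
  | add x y hx hy h1 h2 => exact S.add_mem h1 h2
  | mul x y hx hy h1 h2 => exact S.mul_mem h1 h2

theorem semiconjBy_map_inv {G M : Type*} [Group G] [Monoid M] (f : G →* M) {a : M} {x y : G}
    (h : SemiconjBy a (f x) (f y)) : SemiconjBy a (f x⁻¹) (f y⁻¹) :=
  calc a * f x⁻¹ = f (y⁻¹ * y) * a * f x⁻¹ := by rw [inv_mul_cancel, map_one, one_mul]
    _ = f y⁻¹ * (f y * a) * f x⁻¹ := by rw [map_mul]; simp only [mul_assoc]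
    _ = f y⁻¹ * a * f (x * x⁻¹) := by rw [← h.eq, map_mul]; simp only [mul_assoc]
    _ = f y⁻¹ * a := by rw [mul_inv_cancel, map_one, mul_one]

/-! ### The four sets of relations in an algebra -/

section sat
variable {A : Type*} [Ring A] [Algebra LL A]

/-- The relations of the first presentation in an algebra `A`. -/
def Sat1 (φ : Hf n →ₐ[LL] A) (Φ : PolyZ n →ₐ[LL] A) : Prop :=
  ∀ (k : ℕ) (hk : k + 1 < n) (p q : PolyZ n),
    q * (MvPolynomial.X ⟨k, by omega⟩ - MvPolynomial.X ⟨k + 1, hk⟩) = p - swapVar n k hk p →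
    φ (hf n k hk) * Φ p - Φ (swapVar n k hk p) * φ (hf n k hk) =
      Φ ((v - vinv) • (MvPolynomial.X ⟨k + 1, hk⟩ * q))

/-- The relations of the second presentation in an algebra `A`. -/
structure Sat2 (φ : Hf n →ₐ[LL] A) (z : Fin n → A) : Prop where
  step : ∀ (k : ℕ) (hk : k + 1 < n),
    φ (hf n k hk) * z ⟨k, by omega⟩ * φ (hf n k hk) = z ⟨k + 1, hk⟩
  comm : ∀ (i : Fin n) (j : ℕ) (hj : j + 1 < n), (i : ℕ) ≠ j → (i : ℕ) ≠ j + 1 →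
    φ (hf n j hj) * z i = z i * φ (hf n j hj)
  commZ : ∀ i j, z i * z j = z j * z i

/-- The relations of the third presentation in an algebra `A`. -/
structure Sat3 (φ : Hf n →ₐ[LL] A) (ζ : A) : Prop where
  four : ∀ hn : 0 + 1 < n,
    φ (hf n 0 hn) * ζ * φ (hf n 0 hn) * ζ = ζ * φ (hf n 0 hn) * ζ * φ (hf n 0 hn)
  comm : ∀ (k : ℕ) (hk : k + 1 < n), 1 ≤ k → φ (hf n k hk) * ζ = ζ * φ (hf n k hk)

/-- The relations of the fourth presentation in an algebra `A`. -/
structure Sat4 (φ : Hf n →ₐ[LL] A) (om : A) : Prop where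
  shift : ∀ (k : ℕ) (hk : k + 1 + 1 < n),
    φ (hf n k (by omega)) * om = om * φ (hf n (k + 1) hk)
  square : ∀ hn : 2 ≤ n,
    φ (hf n (n - 2) (by omega)) * om ^ 2 = om ^ 2 * φ (hf n 0 (by omega))

/-- `H_1⁻¹ ⋯ H_{n-1}⁻¹`, the unit of `H_f` with `Z_1 = H_1⁻¹ ⋯ H_{n-1}⁻¹ ω`. -/
noncomputable def cU (n : ℕ) [NeZero n] : (Hf n)ˣ := ascProd (fun k => (hfU n k)⁻¹) 0 (n - 1)

theorem Sat4.sat3 {φ : Hf n →ₐ[LL] A} {om : A} (h : Sat4 φ om) : Sat3 φ (φ (cU n) * om) := by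
  let f : (Hf n)ˣ →* A := (φ : Hf n →* A).comp (Units.coeHom (Hf n))
  have hg : BraidSeq (fun k => f (hfU n k)⁻¹) (n - 1) := braidSeq_hfU.inv.map f
  have hc : φ (cU n) = ascProd (fun k => f (hfU n k)⁻¹) 0 (n - 1) := map_ascProd f _ _ _
  have hfφ : ∀ k (hk : k + 1 < n), φ (hf n k hk) = f (hfU n k) := fun k hk => by
    rw [← coe_hfU hk]; rfl
  have hom : ∀ k, k + 1 < n - 1 → SemiconjBy om (f (hfU n (k + 1))⁻¹) (f (hfU n k)⁻¹) := by
    intro k hk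
    have := h.shift k (by omega)
    rw [hfφ, hfφ] at this
    exact semiconjBy_map_inv f this.symm
  have hinv : ∀ k, f (hfU n k) * f (hfU n k)⁻¹ = 1 := fun k => by
    rw [← map_mul, mul_inv_cancel, map_one]
  have hinv' : ∀ k, f (hfU n k)⁻¹ * f (hfU n k) = 1 := fun k => by
    rw [← map_mul, inv_mul_cancel, map_one]
  rw [hc]
  constructor
  · intro hn
    rw [hfφ]
    refine hg.four_of_square hom (by omega) ?_ (hinv 0) (hinv' 0)
    have := h.square (by omega)
    rw [hfφ, hfφ] at this
    exact semiconjBy_map_inv f this.symm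
  · intro k hk h1
    obtain ⟨k, rfl⟩ : ∃ m, k = m + 1 := ⟨k - 1, by omega⟩
    have := hg.commute_ascProd_mul hom (k := k) (by omega)
    rw [hfφ]
    have h2 := semiconjBy_map_inv f this
    rw [inv_inv] at h2
    exact h2.eq.symm

theorem Sat3.sat2 {φ : Hf n →ₐ[LL] A} {ζ : A} (h : Sat3 φ ζ) :
    Sat2 φ fun i : Fin n => zSeq (fun k => φ (hfU n k)) ζ i := by
  have hh : BraidSeq (fun k => φ (hfU n k)) (n - 1) :=
    braidSeq_hfU.map ((φ : Hf n →* A).comp (Units.coeHom (Hf n)))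
  have hζ : ∀ k, 1 ≤ k → k < n - 1 → Commute (φ (hfU n k)) ζ := by
    intro k hk hk'
    rw [coe_hfU (by omega)]
    exact h.comm k _ hk
  have h4 : 0 < n - 1 → φ (hfU n 0) * ζ * φ (hfU n 0) * ζ = ζ * φ (hfU n 0) * ζ * φ (hfU n 0) := by
    intro hn
    rw [coe_hfU (by omega)]
    exact h.four _
  constructor
  · intro k hk
    rw [← coe_hfU]
    rfl
  · intro i j hj h0 h1
    rw [← coe_hfU]
    have := i.2
    rcases lt_or_gt_of_ne h0 with h2 | h2
    · exact hh.commute_zSeq_of_lt hζ h2 (by omega)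
    · exact hh.commute_zSeq_of_gt hζ (by omega) (by omega)
  · intro i j
    have := i.2
    have := j.2
    exact hh.commute_zSeq hζ h4 (by omega) (by omega)

theorem Sat2.sat1 {φ : Hf n →ₐ[LL] A} {Φ : PolyZ n →ₐ[LL] A}
    (h : Sat2 φ fun i => Φ (MvPolynomial.X i)) : Sat1 φ Φ := by
  intro k hk p q hpq
  refine bernstein_of_relations hk ?_ (h.step k hk) (fun i h0 h1 => h.comm i k hk h0 h1) p q hpq
  rw [← map_mul, hf_mul_self, map_add, map_one, map_smul]

end sat

/-! ### The relations in `H^pol` -/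

/-- The embedding of `H_f` into `H^pol`. -/
noncomputable def inclHf (n : ℕ) [NeZero n] : Hf n →ₐ[LL] Hpol n := Subalgebra.inclusion Hf_le_Hpol

/-- `ω` as an element of `H^pol`. -/
noncomputable def omPol (n : ℕ) [NeZero n] : Hpol n := ⟨omU n, omU_mem_Hpol⟩

theorem sat4_Hpol : Sat4 (inclHf n) (omPol n) := by
  constructor
  · intro k hk
    apply Subtype.ext
    have := omU_mul_HU (i := sIdx (k + 1) hk) (j := sIdx k (by omega)) (by
      rw [← res_sIdx, ← res_sIdx, ← res_sub_one]; push_cast; congr 1; ring)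
    exact (congrArg Units.val this).symm
  · intro hn
    apply Subtype.ext
    have h1 := omU_mul_HU (i := sIdx 0 (by omega : 0 + 1 < n)) (j := ⟨0, hn⟩) (by
      rw [← res_sIdx, ← res_sub_one]; simpa using (res_coe (0 : Fin n)).symm)
    have h2 := omU_mul_HU (i := (⟨0, hn⟩ : SimpleIdx n)) (j := sIdx (n - 2) (by omega)) (by
      apply Fin.ext
      have := coe_neg_one (n := n)
      simp only [sIdx, zero_sub]
      omega)
    have h3 : HU n (sIdx (n - 2) (by omega)) * omU n ^ 2 =
        omU n ^ 2 * HU n (sIdx 0 (by omega)) := by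
      rw [sq, ← mul_assoc, ← h2, mul_assoc, ← h1, mul_assoc]
    exact congrArg Units.val h3

theorem coe_Z (i : Fin n) : Z n i = ((XU n i)⁻¹ : (Hecke n)ˣ) := rfl

/-- The relation `Z_{i+1} = H_i Z_i H_i`. -/
theorem hN_mul_Z_mul_hN {k : ℕ} (hk : k + 1 < n) :
    (hN n k : Hecke n) * Z n ⟨k, by omega⟩ * hN n k = Z n ⟨k + 1, hk⟩ := by
  rw [coe_Z, coe_Z, ← Units.val_mul, ← Units.val_mul, XU_inv_eq, XU_inv_eq]
  congr 1
  dsimp only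
  obtain ⟨m, hm⟩ : ∃ m, n - 1 - k = m + 1 := ⟨n - 1 - k - 1, by omega⟩
  have hm' : n - 1 - (k + 1) = m := by omega
  rw [hm, hm', ascProd_succ', ascProd_succ, zero_add]
  simp only [mul_assoc, mul_inv_cancel_left]

/-- The formula `Z_1 = H_1⁻¹ ⋯ H_{n-1}⁻¹ ω`. -/
theorem Z_zero : Z n 0 = (inclHf n (cU n) * omPol n : Hpol n) := by
  have h1 : Units.map ((Hf n).val : Hf n →* Hecke n) (cU n) =
      ascProd (fun k => (hN n k)⁻¹) 0 (n - 1) := by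
    rw [cU, map_ascProd]
    simp only [map_inv, map_hfU]
  rw [coe_Z, XU_inv_eq]
  simp only [Fin.val_zero, ascProd_zero, mul_one, Nat.sub_zero]
  rw [← h1]
  rfl

theorem coe_zSeq (i : Fin n) :
    ((zSeq (fun k => inclHf n (hfU n k)) (inclHf n (cU n) * omPol n) i : Hpol n) : Hecke n) =
      Z n i := by
  obtain ⟨i, hi⟩ := i
  induction i with
  | zero => exact Z_zero.symm
  | succ i ih =>
    rw [← hN_mul_Z_mul_hN hi, ← ih, ← map_hfU]
    rfl

theorem Z_mem_Hpol (i : Fin n) : Z n i ∈ Hpol n := by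
  rw [← coe_zSeq]
  exact Subtype.property _

/-- `Z_i` as an element of `H^pol`. -/
noncomputable def zPol (n : ℕ) [NeZero n] (i : Fin n) : Hpol n := ⟨Z n i, Z_mem_Hpol i⟩

theorem zPol_eq : zPol n =
    fun i : Fin n => zSeq (fun k => inclHf n (hfU n k)) (inclHf n (cU n) * omPol n) i :=
  funext fun i => Subtype.ext (coe_zSeq i).symm

theorem zPol_zero : zPol n 0 = inclHf n (cU n) * omPol n := Subtype.ext Z_zero

theorem sat2_Hpol : Sat2 (inclHf n) (zPol n) := by
  rw [zPol_eq]; exact sat4_Hpol.sat3.sat2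

theorem sat3_Hpol : Sat3 (inclHf n) (zPol n 0) := by
  rw [zPol_zero]; exact sat4_Hpol.sat3

/-- `H^pol` is generated by `H_f` and `ω`. -/
theorem mem_Hpol_of_gen {S : Subalgebra LL (Hpol n)} (h1 : ∀ u, inclHf n u ∈ S)
    (h2 : omPol n ∈ S) (x : Hpol n) : x ∈ S := by
  obtain ⟨x, hx⟩ := x
  induction hx using Algebra.adjoin_induction with
  | mem x hx =>
    rcases id hx with h | rfl
    · exact h1 ⟨x, h⟩
    · exact h2
  | algebraMap r => exact S.algebraMap_mem r
  | add x y hx hy h1 h2 => exact S.add_mem h1 h2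
  | mul x y hx hy h1 h2 => exact S.mul_mem h1 h2

/-! ### The factorization of `H^pol` -/

section
variable {A : Type*} [Ring A] [Algebra LL A]

/-- The linear map `p ⊗ u ↦ Φ(p) φ(u)`. -/
noncomputable def tensorMap (φ : Hf n →ₐ[LL] A) (Φ : PolyZ n →ₐ[LL] A) :
    PolyZ n ⊗[LL] Hf n →ₗ[LL] A :=
  LinearMap.mul' LL A ∘ₗ TensorProduct.map Φ.toLinearMap φ.toLinearMap

theorem tensorMap_tmul (φ : Hf n →ₐ[LL] A) (Φ : PolyZ n →ₐ[LL] A) (p : PolyZ n) (u : Hf n) :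
    tensorMap φ Φ (p ⊗ₜ u) = Φ p * φ u := by
  simp [tensorMap]

/-- `p - s p` vanishes modulo `x - y`, where `s` interchanges `x` and `y`. -/
theorem exists_divided_difference {n : ℕ} (k : ℕ) (hk : k + 1 < n) (p : PolyZ n) :
    ∃ q, q * (MvPolynomial.X ⟨k, by omega⟩ - MvPolynomial.X ⟨k + 1, hk⟩) =
      p - swapVar n k hk p := by
  set x : PolyZ n := MvPolynomial.X ⟨k, by omega⟩ with hx
  set y : PolyZ n := MvPolynomial.X ⟨k + 1, hk⟩ with hy
  let I : Ideal (PolyZ n) := Ideal.span {x - y}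
  have hxy : Ideal.Quotient.mkₐ LL I x = Ideal.Quotient.mkₐ LL I y :=
    Ideal.Quotient.eq.2 (Ideal.subset_span rfl)
  have h : Ideal.Quotient.mkₐ LL I = (Ideal.Quotient.mkₐ LL I).comp (swapVar n k hk) := by
    refine MvPolynomial.algHom_ext fun i => ?_
    have hs : swapVar n k hk (MvPolynomial.X i) = MvPolynomial.X
        (Equiv.swap (⟨k, by omega⟩ : Fin n) ⟨k + 1, hk⟩ i) := MvPolynomial.rename_X _ _
    rw [AlgHom.comp_apply, hs, Equiv.swap_apply_def]
    split_ifs with h1 h2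
    · rw [h1]; exact hxy
    · rw [h2]; exact hxy.symm
    · rfl
  have h2 := Ideal.Quotient.eq.1 (AlgHom.congr_fun h p)
  obtain ⟨q, hq⟩ := Ideal.mem_span_singleton'.1 h2
  exact ⟨q, hq⟩

/-- If the Bernstein relations hold, the products `Φ(p) φ(u)` span a submodule which is stable under
left multiplication by `φ(H_f)` and by all `Φ(p)`, as the relations allow one to move the `H_i` to
the right. -/
theorem mul_mem_range_tensorMap {φ : Hf n →ₐ[LL] A} {Φ : PolyZ n →ₐ[LL] A} (h : Sat1 φ Φ) :
    (∀ u, ∀ x ∈ LinearMap.range (tensorMap φ Φ), φ u * x ∈ LinearMap.range (tensorMap φ Φ)) ∧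
    ∀ p, ∀ x ∈ LinearMap.range (tensorMap φ Φ), Φ p * x ∈ LinearMap.range (tensorMap φ Φ) := by
  set M := LinearMap.range (tensorMap φ Φ) with hM
  have hmem : ∀ p u, Φ p * φ u ∈ M := fun p u => ⟨p ⊗ₜ u, tensorMap_tmul φ Φ p u⟩
  have hind : ∀ a : A, (∀ p u, a * (Φ p * φ u) ∈ M) → ∀ x ∈ M, a * x ∈ M := by
    rintro a ha _ ⟨t, rfl⟩
    induction t using TensorProduct.induction_on with
    | zero => simp
    | tmul p u => rw [tensorMap_tmul]; exact ha p u
    | add s t hs ht => rw [map_add, mul_add]; exact M.add_mem hs ht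
  let S : Subalgebra LL A :=
    { carrier := {a | ∀ x ∈ M, a * x ∈ M}
      mul_mem' := fun {a b} ha hb x hx => by rw [mul_assoc]; exact ha _ (hb x hx)
      add_mem' := fun {a b} ha hb x hx => by rw [add_mul]; exact M.add_mem (ha x hx) (hb x hx)
      algebraMap_mem' := fun r x hx => by rw [← Algebra.smul_def]; exact M.smul_mem r hx }
  refine ⟨fun u => ?_, fun p => hind _ fun p' u => ?_⟩
  · refine mem_of_hf_mem (S.comap φ) (fun k hk => ?_) u
    change ∀ x ∈ M, φ (hf n k hk) * x ∈ M
    refine hind _ fun p u => ?_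
    obtain ⟨q, hq⟩ := exists_divided_difference k hk p
    have h1 := h k hk p q hq
    rw [sub_eq_iff_eq_add] at h1
    rw [← mul_assoc, h1, add_mul, mul_assoc, ← map_mul]
    exact M.add_mem (hmem _ _) (hmem _ _)
  · rw [← mul_assoc, ← map_mul]
    exact hmem _ _

end

/-- At `v = 1`, the monomial `Z^a` becomes the translation `t_{-a}`. -/
theorem specializesTo_monomial {Φ : PolyZ n →ₐ[LL] Hpol n}
    (hΦ : ∀ i, (Φ (MvPolynomial.X i) : Hecke n) = Z n i) (a : Fin n →₀ ℕ) :
    SpecializesTo (Φ (MvPolynomial.monomial a 1) : Hecke n) (transl fun i => -(a i : ℤ)) := by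
  induction a using Finsupp.induction_linear with
  | zero =>
    have h1 : (MvPolynomial.monomial 0 1 : PolyZ n) = 1 := rfl
    have h2 : (transl fun i => -(((0 : Fin n →₀ ℕ) i : ℕ) : ℤ) : Weyl n) = 1 := by
      simp [transl]
      rfl
    rw [h1, map_one, h2]
    exact SpecializesTo.one
  | add a b ha hb =>
    have h1 : (MvPolynomial.monomial (a + b) 1 : PolyZ n) =
        MvPolynomial.monomial a 1 * MvPolynomial.monomial b 1 := by
      rw [MvPolynomial.monomial_mul, one_mul]
    have h2 : (transl fun i => -(((a + b : Fin n →₀ ℕ) i : ℕ) : ℤ) : Weyl n) =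
        (transl fun i => -(a i : ℤ)) * transl fun i => -(b i : ℤ) := by
      rw [transl_mul]
      congr 1
      funext i
      simp
      ring
    rw [h1, map_mul, h2]
    exact ha.mul hb
  | single i k =>
    have h1 : (MvPolynomial.monomial (Finsupp.single i k) 1 : PolyZ n) = MvPolynomial.X i ^ k := by
      rw [MvPolynomial.X_pow_eq_monomial]
    have h2 : (transl fun j => -((Finsupp.single i k j : ℕ) : ℤ) : Weyl n) =
        transl (-Pi.single i 1) ^ k := by
      rw [transl, transl, ← map_pow, ← ofAdd_nsmul]
      congr 2
      funext j
      by_cases hj : j = i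
      · subst hj; simp
      · simp [hj]
    rw [h1, map_pow, h2]
    have := (specializesTo_Z i).pow k
    rw [← hΦ i] at this
    exact this

theorem injective_of_linearIndependent_comp {R ι V V' : Type*} [Semiring R] [AddCommMonoid V]
    [AddCommMonoid V'] [Module R V] [Module R V'] (b : Module.Basis ι R V) (f : V →ₗ[R] V')
    (h : LinearIndependent R fun i => f (b i)) : Function.Injective f := by
  intro x y hxy
  rw [← b.linearCombination_repr x, ← b.linearCombination_repr y, Finsupp.apply_linearCombination,
    Finsupp.apply_linearCombination] at hxy
  exact b.repr.injective (h hxy)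

/-- The products `Z^a H_π` are linearly independent, because they specialize to the pairwise
different elements `t_{-a} π` of `W` at `v = 1`. -/
theorem injective_tensorMap {Φ : PolyZ n →ₐ[LL] Hpol n}
    (hΦ : ∀ i, (Φ (MvPolynomial.X i) : Hecke n) = Z n i) :
    Function.Injective (tensorMap (inclHf n) Φ) := by
  obtain ⟨b, hb⟩ := exists_basis_Hf (n := n)
  let B := (MvPolynomial.basisMonomials (Fin n) LL).tensorProduct b
  let act1 : Hpol n →ₗ[LL] RegMod n :=
    (LinearMap.applyₗ (Finsupp.single 1 1 : RegMod n)) ∘ₗ (regRep n).toLinearMap ∘ₗ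
      (Hpol n).val.toLinearMap
  refine injective_of_linearIndependent_comp B _ (LinearIndependent.of_comp act1 ?_)
  refine linearIndependent_of_evalOne ?_
  let wt : (Fin n →₀ ℕ) × Equiv.Perm (Fin n) → Weyl n :=
    fun x => (transl fun i => -(x.1 i : ℤ)) * ofPerm x.2
  have hwt : Function.Injective wt := by
    rintro ⟨a, π⟩ ⟨a', π'⟩ h
    have h1 := congrArg SemidirectProduct.right h
    have h2 := congrArg (fun w => w.left.toAdd) h
    simp only [wt, transl, ofPerm, SemidirectProduct.mul_right, SemidirectProduct.right_inl,
      SemidirectProduct.right_inr, one_mul, SemidirectProduct.mul_left, SemidirectProduct.left_inl,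
      SemidirectProduct.left_inr, map_one, mul_one, toAdd_ofAdd] at h1 h2
    refine Prod.ext (Finsupp.ext fun i => ?_) h1
    have := congrFun h2 i
    dsimp only at this ⊢
    omega
  have key : ∀ x, evMod n (act1 (tensorMap (inclHf n) Φ (B x))) = Finsupp.single (wt x) 1 := by
    rintro ⟨a, π⟩
    have h1 : B (a, π) = MvPolynomial.monomial a 1 ⊗ₜ b π := by
      simp [B, Module.Basis.tensorProduct_apply]
    rw [h1, tensorMap_tmul]
    have h2 := (specializesTo_monomial hΦ a).mul (specializesTo_HwU (ofPerm π))
    rw [← hb] at h2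
    have h3 := h2 (Finsupp.single 1 1)
    refine h3.trans ?_
    simp [leftTransl, evMod, wt, Finsupp.mapDomain.addMonoidHom_apply, Finsupp.mapDomain_single]
  have hlin : LinearIndependent ℤ fun x => (Finsupp.single (wt x) 1 : Weyl n →₀ ℤ) :=
    (Finsupp.linearIndependent_single_one ℤ (Weyl n)).comp wt hwt
  convert hlin using 2 with x
  exact key x

/-! ### The four presentations -/

section lift
variable {A : Type*} [Ring A] [Algebra LL A] {φ : Hf n →ₐ[LL] A}

theorem Sat1.exists_lift {Φ : PolyZ n →ₐ[LL] A} (h : Sat1 φ Φ) :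
    ∃ f : GenAlg (Hf n) (PolyZ n) (Rel1 n) →ₐ[LL] A,
      (∀ u, f (GenAlg.leftHom _ u) = φ u) ∧ ∀ p, f (GenAlg.rightHom _ p) = Φ p := by
  refine GenAlg.exists_lift φ Φ fun a b hab => ?_
  cases hab with
  | bernstein k hk p q hq =>
    simpa only [gB, gC, map_sub, map_mul, FreeAlgebra.lift_ι_apply, Sum.elim_inl, Sum.elim_inr]
      using h k hk p q hq

theorem Sat2.exists_lift {z : Fin n → A} (h : Sat2 φ z) :
    ∃ f : GenAlg (Hf n) (FreeAlgebra LL (Fin n)) (Rel2 n) →ₐ[LL] A,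
      (∀ u, f (GenAlg.leftHom _ u) = φ u) ∧
        ∀ i, f (GenAlg.rightHom _ (FreeAlgebra.ι LL i)) = z i := by
  obtain ⟨f, h1, h2⟩ := GenAlg.exists_lift (rel := Rel2 n) φ (FreeAlgebra.lift LL z)
    fun a b hab => by
      cases hab with
      | step k hk => simpa [gB, gC, gZ] using h.step k hk
      | comm i j hj h0 h1 => simpa [gB, gC, gZ] using h.comm i j hj h0 h1
      | commZ i j => simpa [gB, gC, gZ] using h.commZ i j
  exact ⟨f, h1, fun i => by rw [h2, FreeAlgebra.lift_ι_apply]⟩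

theorem Sat3.exists_lift {ζ : A} (h : Sat3 φ ζ) :
    ∃ f : GenAlg (Hf n) (FreeAlgebra LL Unit) (Rel3 n) →ₐ[LL] A,
      (∀ u, f (GenAlg.leftHom _ u) = φ u) ∧
        f (GenAlg.rightHom _ (FreeAlgebra.ι LL ())) = ζ := by
  obtain ⟨f, h1, h2⟩ := GenAlg.exists_lift (rel := Rel3 n) φ (FreeAlgebra.lift LL fun _ => ζ)
    fun a b hab => by
      cases hab with
      | four hn => simpa [gB, gC, gOne] using h.four hn
      | comm k hk h1 => simpa [gB, gC, gOne] using h.comm k hk h1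
  exact ⟨f, h1, by rw [h2, FreeAlgebra.lift_ι_apply]⟩

theorem Sat4.exists_lift {om : A} (h : Sat4 φ om) :
    ∃ f : GenAlg (Hf n) (FreeAlgebra LL Unit) (Rel4 n) →ₐ[LL] A,
      (∀ u, f (GenAlg.leftHom _ u) = φ u) ∧
        f (GenAlg.rightHom _ (FreeAlgebra.ι LL ())) = om := by
  obtain ⟨f, h1, h2⟩ := GenAlg.exists_lift (rel := Rel4 n) φ (FreeAlgebra.lift LL fun _ => om)
    fun a b hab => by
      cases hab with
      | shift k hk => simpa [gB, gC, gOne] using h.shift k hk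
      | square hn => simpa [gB, gC, gOne] using h.square hn
  exact ⟨f, h1, by rw [h2, FreeAlgebra.lift_ι_apply]⟩

end lift

/-- The homomorphism from the polynomial ring to the algebra of the first presentation, with its
source written as `PolyZ n`. -/
noncomputable def polyHom (n : ℕ) [NeZero n] :
    PolyZ n →ₐ[LL] GenAlg (Hf n) (PolyZ n) (Rel1 n) := GenAlg.rightHom (Rel1 n)

theorem sat1_genAlg : Sat1 (A := GenAlg (Hf n) (PolyZ n) (Rel1 n)) (GenAlg.leftHom (Rel1 n))
    (polyHom n) := by
  intro k hk p q hq
  have := GenAlg.mkAlgHom_rel (Rel1.bernstein k hk p q hq)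
  rw [map_sub, map_mul, map_mul] at this
  exact this

theorem sat2_genAlg : Sat2 (GenAlg.leftHom (Rel2 n))
    fun i => GenAlg.rightHom (Rel2 n) (FreeAlgebra.ι LL i) := by
  constructor
  · intro k hk
    have := GenAlg.mkAlgHom_rel (Rel2.step k hk)
    rw [map_mul, map_mul] at this
    exact this
  · intro i j hj h0 h1
    have := GenAlg.mkAlgHom_rel (Rel2.comm i j hj h0 h1)
    rw [map_mul, map_mul] at this
    exact this
  · intro i j
    have := GenAlg.mkAlgHom_rel (Rel2.commZ i j)
    rw [map_mul, map_mul] at this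
    exact this

theorem sat3_genAlg : Sat3 (GenAlg.leftHom (Rel3 n))
    (GenAlg.rightHom (Rel3 n) (FreeAlgebra.ι LL ())) := by
  constructor
  · intro hn
    have := GenAlg.mkAlgHom_rel (Rel3.four hn)
    simp only [map_mul] at this
    exact this
  · intro k hk h1
    have := GenAlg.mkAlgHom_rel (Rel3.comm k hk h1)
    simp only [map_mul] at this
    exact this

theorem sat4_genAlg : Sat4 (GenAlg.leftHom (Rel4 n))
    (GenAlg.rightHom (Rel4 n) (FreeAlgebra.ι LL ())) := by
  constructor
  · intro k hk
    have := GenAlg.mkAlgHom_rel (Rel4.shift k hk)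
    simp only [map_mul] at this
    exact this
  · intro hn
    have := GenAlg.mkAlgHom_rel (Rel4.square hn)
    simp only [map_mul, map_pow] at this
    exact this

/-- The products `p u` span the algebra of the first presentation. -/
theorem surjective_tensorMap_genAlg :
    Function.Surjective (tensorMap (A := GenAlg (Hf n) (PolyZ n) (Rel1 n))
      (GenAlg.leftHom (Rel1 n)) (polyHom n)) := by
  obtain ⟨hl, hr⟩ := mul_mem_range_tensorMap (sat1_genAlg (n := n))
  set M := LinearMap.range (tensorMap (A := GenAlg (Hf n) (PolyZ n) (Rel1 n))
    (GenAlg.leftHom (Rel1 n)) (polyHom n)) with hM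
  let S : Subalgebra LL (GenAlg (Hf n) (PolyZ n) (Rel1 n)) :=
    { carrier := {a | ∀ x ∈ M, a * x ∈ M}
      mul_mem' := fun {a b} ha hb x hx => by rw [mul_assoc]; exact ha _ (hb x hx)
      add_mem' := fun {a b} ha hb x hx => by rw [add_mul]; exact M.add_mem (ha x hx) (hb x hx)
      algebraMap_mem' := fun r x hx => by rw [← Algebra.smul_def]; exact M.smul_mem r hx }
  intro x
  have h1 : x ∈ S := GenAlg.mem_of_left_right S hl hr x
  have h2 : (1 : GenAlg (Hf n) (PolyZ n) (Rel1 n)) ∈ M :=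
    ⟨1 ⊗ₜ 1, by rw [tensorMap_tmul, map_one, map_one, one_mul]⟩
  have h3 := h1 1 h2
  rwa [mul_one] at h3

theorem bijective_of_comp {X Y T : Type*} {e : X → T} {f : X → Y} {e' : Y → T}
    (he : Function.Bijective e) (hf : Function.Surjective f) (h : ∀ x, e' (f x) = e x) :
    Function.Bijective e' := by
  obtain rfl : e' ∘ f = e := funext h
  exact ⟨(he.1.of_comp_right hf), he.2.of_comp⟩

theorem map_zSeq {M M' : Type*} [Monoid M] [Monoid M'] {F : Type*} [FunLike F M M']
    [MonoidHomClass F M M'] (f : F) (h : ℕ → M) (ζ : M) (i : ℕ) :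
    f (zSeq h ζ i) = zSeq (fun k => f (h k)) (f ζ) i := by
  induction i with
  | zero => rfl
  | succ i ih => simp only [zSeq, map_mul, ih]

theorem zSeq_zPol (i : Fin n) :
    zSeq (fun k => inclHf n (hfU n k)) (zPol n 0) i = zPol n i := by
  rw [zPol_zero, zPol_eq]

theorem map_cU_inv_mul {A : Type*} [Ring A] [Algebra LL A] (φ : Hf n →ₐ[LL] A) (a : A) :
    φ ((cU n)⁻¹ : (Hf n)ˣ) * (φ (cU n) * a) = a := by
  rw [← mul_assoc, ← map_mul, Units.inv_mul, map_one, one_mul]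

end AffineHecke

theorem theorem7p1 (n : ℕ) [NeZero n] :
    -- the elements `H_w` are well defined, and those with `w ∈ W_f` span `H_f`
    (∀ w : Weyl n, (∃ l k, IsReducedExpr n w l k) ∧
      ∀ l k, IsReducedExpr n w l k → HwU n w = wordU n l k) ∧
    Subalgebra.toSubmodule (Hf n) =
      Submodule.span LL (Set.range fun π : Equiv.Perm (Fin n) => (HwU n (ofPerm π) : Hecke n)) ∧
    -- the basis
    (∃ b : Module.Basis (Wpol n) LL (Hpol n), ∀ w : Wpol n, (b w : Hecke n) = HwU n (w : Weyl n)) ∧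
    -- the elements `Z_i`, and the factorization
    (∀ i, Z n i ∈ Hpol n) ∧
    ∃ Φ : PolyZ n →ₐ[LL] Hpol n,
      (∀ i, (Φ (MvPolynomial.X i) : Hecke n) = Z n i) ∧
      (∃ m : PolyZ n ⊗[LL] Hf n ≃ₗ[LL] Hpol n,
        ∀ (p : PolyZ n) (u : Hf n), (m (p ⊗ₜ u) : Hecke n) = Φ p * u) ∧
      -- the four presentations
      (∃ e : GenAlg (Hf n) (PolyZ n) (Rel1 n) ≃ₐ[LL] Hpol n,
        (∀ u, (e (GenAlg.left (Rel1 n) u) : Hecke n) = u) ∧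
        ∀ p, e (GenAlg.right (Rel1 n) p) = Φ p) ∧
      (∃ e : GenAlg (Hf n) (FreeAlgebra LL (Fin n)) (Rel2 n) ≃ₐ[LL] Hpol n,
        (∀ u, (e (GenAlg.left (Rel2 n) u) : Hecke n) = u) ∧
        ∀ i, (e (GenAlg.right (Rel2 n) (FreeAlgebra.ι LL i)) : Hecke n) = Z n i) ∧
      (∃ e : GenAlg (Hf n) (FreeAlgebra LL Unit) (Rel3 n) ≃ₐ[LL] Hpol n,
        (∀ u, (e (GenAlg.left (Rel3 n) u) : Hecke n) = u) ∧
        (e (GenAlg.right (Rel3 n) (FreeAlgebra.ι LL ())) : Hecke n) = Z n 0) ∧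
      (∃ e : GenAlg (Hf n) (FreeAlgebra LL Unit) (Rel4 n) ≃ₐ[LL] Hpol n,
        (∀ u, (e (GenAlg.left (Rel4 n) u) : Hecke n) = u) ∧
        (e (GenAlg.right (Rel4 n) (FreeAlgebra.ι LL ())) : Hecke n) = omU n) := by
  refine ⟨fun w => ⟨exists_isReducedExpr w, fun l k h => HwU_eq_wordU h⟩, toSubmodule_Hf,
    exists_basis_Hpol, Z_mem_Hpol, ?_⟩
  obtain ⟨Φ, hΦ⟩ := exists_algHom_of_commute (zPol n) sat2_Hpol.commZ
  have hΦ' : ∀ i, (Φ (MvPolynomial.X i) : Hecke n) = Z n i := fun i => congrArg Subtype.val (hΦ i)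
  have hz : (fun i => Φ (MvPolynomial.X i)) = zPol n := funext hΦ
  have hsat1 : Sat1 (inclHf n) Φ := Sat2.sat1 (by rw [hz]; exact sat2_Hpol)
  -- the canonical homomorphisms from the four algebras to `H^pol`
  obtain ⟨e1, e1l, e1r⟩ := hsat1.exists_lift
  obtain ⟨e2, e2l, e2r⟩ := (sat2_Hpol (n := n)).exists_lift
  obtain ⟨e3, e3l, e3r⟩ := (sat3_Hpol (n := n)).exists_lift
  obtain ⟨e4, e4l, e4r⟩ := (sat4_Hpol (n := n)).exists_lift
  -- the homomorphisms from each of the four algebras to the next one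
  obtain ⟨Ψ, hΨ⟩ := exists_algHom_of_commute _ (sat2_genAlg (n := n)).commZ
  have hsatΨ : Sat1 (A := GenAlg (Hf n) (FreeAlgebra LL (Fin n)) (Rel2 n))
      (GenAlg.leftHom (Rel2 n)) Ψ := Sat2.sat1 (by rw [funext hΨ]; exact sat2_genAlg)
  obtain ⟨f1, f1l, f1r⟩ := hsatΨ.exists_lift
  obtain ⟨f2, f2l, f2r⟩ := (sat3_genAlg (n := n)).sat2.exists_lift
  obtain ⟨f3, f3l, f3r⟩ := (sat4_genAlg (n := n)).sat3.exists_lift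
  have hcomp1 : ∀ x, e2 (f1 x) = e1 x := by
    refine AlgHom.congr_fun (GenAlg.hom_ext (f := e2.comp f1) (fun u => ?_) fun p => ?_)
    · rw [AlgHom.comp_apply, f1l, e2l, e1l]
    · rw [AlgHom.comp_apply, f1r, e1r]
      refine AlgHom.congr_fun (φ₁ := e2.comp Ψ) (MvPolynomial.algHom_ext fun i => ?_) p
      rw [AlgHom.comp_apply, hΨ, e2r, hΦ]
  have hcomp2 : ∀ x, e3 (f2 x) = e2 x := by
    refine AlgHom.congr_fun (GenAlg.hom_ext (f := e3.comp f2) (fun u => ?_) fun c => ?_)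
    · rw [AlgHom.comp_apply, f2l, e3l, e2l]
    · refine AlgHom.congr_fun (φ₁ := (e3.comp f2).comp (GenAlg.rightHom (Rel2 n)))
        (φ₂ := e2.comp (GenAlg.rightHom (Rel2 n))) (FreeAlgebra.hom_ext (funext fun i => ?_)) c
      simp only [Function.comp_apply, AlgHom.comp_apply]
      rw [f2r, e2r, ← zSeq_zPol]
      rw [map_zSeq, e3r]
      simp only [e3l]
  have hcomp3 : ∀ x, e4 (f3 x) = e3 x := by
    refine AlgHom.congr_fun (GenAlg.hom_ext (f := e4.comp f3) (fun u => ?_) fun c => ?_)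
    · rw [AlgHom.comp_apply, f3l, e4l, e3l]
    · refine AlgHom.congr_fun (φ₁ := (e4.comp f3).comp (GenAlg.rightHom (Rel3 n)))
        (φ₂ := e3.comp (GenAlg.rightHom (Rel3 n))) (FreeAlgebra.hom_ext (funext fun i => ?_)) c
      simp only [Function.comp_apply, AlgHom.comp_apply]
      rw [f3r, e3r, zPol_zero, map_mul, e4l, e4r]
  have hsurj1 : Function.Surjective f1 := by
    refine GenAlg.mem_of_left_right f1.range (fun u => ⟨_, f1l u⟩) ?_
    refine GenAlg.rightHom_mem fun i => ?_
    exact ⟨polyHom n (MvPolynomial.X i), (f1r _).trans (hΨ i)⟩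
  -- `Z_1` of the third algebra is the image of the first variable
  have hsurj2 : Function.Surjective f2 := by
    refine GenAlg.mem_of_left_right f2.range (fun u => ⟨_, f2l u⟩) ?_
    refine GenAlg.rightHom_mem fun _ => ?_
    exact ⟨_, f2r 0⟩
  -- `ω = (H_1⁻¹ ⋯ H_{n-1}⁻¹)⁻¹ Z_1`
  have hsurj3 : Function.Surjective f3 := by
    refine GenAlg.mem_of_left_right f3.range (fun u => ⟨_, f3l u⟩) ?_
    refine GenAlg.rightHom_mem fun _ => ?_
    refine ⟨GenAlg.leftHom (Rel3 n) ((cU n)⁻¹ : (Hf n)ˣ) *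
      GenAlg.rightHom (Rel3 n) (FreeAlgebra.ι LL ()), ?_⟩
    rw [AlgHom.toRingHom_eq_coe, RingHom.coe_coe, map_mul, f3l, f3r]
    exact map_cU_inv_mul (A := GenAlg (Hf n) (FreeAlgebra LL Unit) (Rel4 n))
      (GenAlg.leftHom (Rel4 n)) _
  -- the factorization, and the first presentation
  have hsurj : Function.Surjective e1 :=
    mem_Hpol_of_gen (S := e1.range) (fun u => ⟨_, e1l u⟩)
      ⟨GenAlg.leftHom (Rel1 n) ((cU n)⁻¹ : (Hf n)ˣ) * polyHom n (MvPolynomial.X 0), by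
        rw [AlgHom.toRingHom_eq_coe, RingHom.coe_coe, map_mul, e1l]
        refine (congrArg _ ((e1r _).trans ((hΦ 0).trans zPol_zero))).trans
          (map_cU_inv_mul (inclHf n) _)⟩
  have hfac : ∀ t, e1 (tensorMap (A := GenAlg (Hf n) (PolyZ n) (Rel1 n)) (GenAlg.leftHom (Rel1 n))
      (polyHom n) t) =
      tensorMap (inclHf n) Φ t := by
    intro t
    induction t using TensorProduct.induction_on with
    | zero => simp
    | tmul p u =>
      rw [tensorMap_tmul, tensorMap_tmul, map_mul, e1l]
      exact congrArg (· * _) (e1r p)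
    | add s t hs ht => rw [map_add, map_add, map_add, hs, ht]
  have hbij : Function.Bijective (tensorMap (inclHf n) Φ) := by
    refine ⟨injective_tensorMap hΦ', ?_⟩
    rw [← funext hfac]
    exact hsurj.comp surjective_tensorMap_genAlg
  have hb1 : Function.Bijective e1 := bijective_of_comp hbij surjective_tensorMap_genAlg hfac
  have hb2 := bijective_of_comp hb1 hsurj1 hcomp1
  have hb3 := bijective_of_comp hb2 hsurj2 hcomp2
  have hb4 := bijective_of_comp hb3 hsurj3 hcomp3
  refine ⟨Φ, hΦ', ⟨LinearEquiv.ofBijective _ hbij, fun p u => ?_⟩,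
    ⟨AlgEquiv.ofBijective e1 hb1, fun u => congrArg Subtype.val (e1l u), e1r⟩,
    ⟨AlgEquiv.ofBijective e2 hb2, fun u => congrArg Subtype.val (e2l u),
      fun i => congrArg Subtype.val (e2r i)⟩,
    ⟨AlgEquiv.ofBijective e3 hb3, fun u => congrArg Subtype.val (e3l u), congrArg Subtype.val e3r⟩,
    ⟨AlgEquiv.ofBijective e4 hb4, fun u => congrArg Subtype.val (e4l u), congrArg Subtype.val e4r⟩⟩
  exact congrArg Subtype.val (tensorMap_tmul (inclHf n) Φ p u)
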